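/- A \emph{symmetric norm} is a norm $\Phi$ on the space $c_{00}$ of finitely supported real sequences with $\Phi(1,0,0,\dots)=1$ and $\Phi(\xi)=\Phi(|\xi_{\pi_1}|,|\xi_{\pi_2}|,\dots)$ for every $\xi\in c_{00}$ and every permutation $\pi$ of the index set. For a real sequence $\xi$ put $\Phi(\xi):=\lim_n\Phi(\xi_1,\dots,\xi_n,0,0,\dots)\in[0,\infty]$, and let $\ell_\Phi$ be the set of sequences $\xi\to 0$ with $\Phi(\xi)<\infty$. $\Phi$ is \emph{regular} if $\lim_n\Phi(\xi_{n+1},\xi_{n+2},\dots)=0$ for all $\xi\in\ell_\Phi$. Let $(X,d)$ be a metric space and $x_0\in X$. A \emph{countable multiset} in $(X,x_0)$ is a function $S:X\to\{0,1,2,\dots,\infty\}$ with countable support for which $x_0$ is the only point of infinite multiplicity. A sequence $(s_i)_{i\in\mathbb N}$ in $X$ is an \emph{enumeration} of $S$ if every $x\neq x_0$ occurs in it exactly $S(x)$ times. Let $\mathcal S_\Phi(X,x_0)$ be the set of those $S$ that have an enumeration with $(d(x_0,s_i))_i\in\ell_\Phi$, with the metric $d_\Phi(S,T)=\inf\Phi(d(s_1,t_1),d(s_2,t_2),\dots)$,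 the infimum being over all enumerations $(s_i)$ of $S$ and $(t_i)$ of $T$. Let $O_{x_0}\in\mathcal S_\Phi(X,x_0)$ be the multiset with support $\{x_0\}$. A \emph{continuous enumeration} of a path $S:[0,1]\to\mathcal S_\Phi(X,x_0)$ is a sequence of continuous maps $\lambda_i:[0,1]\to X$ such that $(\lambda_i(t))_i$ is an enumeration of $S(t)$ for every $t\in[0,1]$. For a sequence $(\lambda_i)$ of paths in $X$, all but finitely many of which are null-homotopic loops based at $x_0$, let $\sum_{i}\lambda_i$ be the singular $1$-chain that is the sum of the finitely many $\lambda_i$ that are not null-homotopic loops based at $x_0$. For a set $U\ni x_0$, a \emph{$U$-extension} of a path $\lambda$ in $X$ is a concatenation $\theta_l\cdot\lambda\cdot\theta_r$, where $\theta_r$ is a path in $U$ from $\lambda(1)$ to $x_0$ if $\lambda(1)\in U$ and is constant otherwise, and $\theta_l$ is a path in $U$ from $x_0$ to $\lambda(0)$ if $\lambda(0)\in U$ and is constant otherwise. \textbf{Theorem.} Let $\Phi$ be a regular symmetric norm, let $X$ be a path-connected metric space in which every point has a local base of simply connected open sets, and let $x_0\in X$. \begin{enumerate} \item Every loop in $\mathcal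 S_\Phi(X,x_0)$ based at $O_{x_0}$ has a continuous enumeration, and there is a group isomorphism $$\Psi_\Phi:\pi_1(\mathcal S_\Phi(X,x_0),O_{x_0})\to H_1(X)$$ onto the first integral singular homology group such that, for every loop $S$ based at $O_{x_0}$ and every continuous enumeration $(\lambda_i)$ of $S$, each $\lambda_i$ is a loop based at $x_0$, all but finitely many $\lambda_i$ are null-homotopic, and $\Psi_\Phi([S])=\left[\sum_i\lambda_i\right]_{H_1}$. \item Let $U$ be a simply connected neighbourhood of $x_0$ and $S_0\in\mathcal S_\Phi(X,x_0)$. Let $S,T$ be homotopic loops in $\mathcal S_\Phi(X,x_0)$ based at $S_0$ with continuous enumerations $(\lambda_i)$, $(\mu_i)$, and for each $i$ let $\lambda_i'$, $\mu_i'$ be $U$-extensions of $\lambda_i$, $\mu_i$. Then all but finitely many $\lambda_i'$ and all but finitely many $\mu_i'$ are null-homotopic loops based at $x_0$, the chains $\sum_i\lambda_i'$ and $\sum_i\mu_i'$ are $1$-cycles, and they have the same class in $H_1(X)$. \end{enumerate} -/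

import Mathlib

open Filter Topology
open scoped ENNReal

universe u

/-! ### Symmetric norms -/

/-- A symmetric norm on the space `c₀₀ = ℕ →₀ ℝ` of finitely supported real sequences. -/
structure SymmetricNorm extends Seminorm ℝ (ℕ →₀ ℝ) where
  eq_zero_of_apply_eq_zero : ∀ ξ : ℕ →₀ ℝ, toFun ξ = 0 → ξ = 0
  apply_single : toFun (Finsupp.single 0 1) = 1
  apply_perm : ∀ (ξ η : ℕ →₀ ℝ) (π : Equiv.Perm ℕ), (∀ i, η i = |ξ (π i)|) → toFun η = toFun ξ

namespace SymmetricNorm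

variable (Φ : SymmetricNorm)

/-- The truncation `(ξ₀, …, ξₙ₋₁, 0, 0, …)` of a real sequence. -/
noncomputable def trunc (ξ : ℕ → ℝ) (n : ℕ) : ℕ →₀ ℝ :=
  Finsupp.onFinset (Finset.range n) (fun i => if i < n then ξ i else 0) (by
    intro i hi
    by_contra h
    simp [Finset.mem_range] at h hi
    omega)

/-- The extension of `Φ` to arbitrary real sequences, with values in `[0, ∞]`: the supremum, which
is also the limit (see `tendsto_ext`), of the values of `Φ` at the truncations. -/
noncomputable def ext (ξ : ℕ → ℝ) : ℝ≥0∞ :=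
  ⨆ n, ENNReal.ofReal (Φ.toSeminorm (trunc ξ n))

/-- `ξ` is `Φ`-summable, i.e. it lies in the natural domain `ℓ_Φ` of `Φ`. -/
def IsSummable (ξ : ℕ → ℝ) : Prop :=
  Tendsto ξ atTop (𝓝 0) ∧ Φ.ext ξ < ⊤

/-- `Φ` is regular: the tails of every `Φ`-summable sequence tend to `0` with respect to `Φ`. -/
def IsRegular : Prop :=
  ∀ ξ : ℕ → ℝ, Φ.IsSummable ξ → Tendsto (fun n => Φ.ext fun i => ξ (n + i)) atTop (𝓝 0)

@[simp] theorem trunc_apply (ξ : ℕ → ℝ) (n i : ℕ) :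
    trunc ξ n i = if i < n then ξ i else 0 := rfl

theorem apply_congr_perm {ξ η : ℕ →₀ ℝ} (π : Equiv.Perm ℕ) (h : ∀ i, |η i| = |ξ (π i)|) :
    Φ.toSeminorm η = Φ.toSeminorm ξ := by
  have h1 := Φ.apply_perm ξ (η.mapRange (fun x => |x|) abs_zero) π (by intro i; simp [h])
  have h2 := Φ.apply_perm η (η.mapRange (fun x => |x|) abs_zero) 1 (by intro i; simp)
  exact h2.symm.trans h1

theorem apply_update_le (η : ℕ →₀ ℝ) (a : ℕ) (c : ℝ) (hc : |c| ≤ |η a|) :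
    Φ.toSeminorm (η.update a c) ≤ Φ.toSeminorm η := by
  rcases eq_or_ne (η a) 0 with h0 | h0
  · have : c = η a := by rw [h0] at hc ⊢; simpa using hc
    subst this
    simp
  · have hq : |c / η a| ≤ 1 := by
      rw [abs_div]; exact div_le_one_of_le₀ hc (abs_nonneg _)
    obtain ⟨hq1, hq2⟩ := abs_le.1 hq
    set q := c / η a with hqd
    have hcq : c = q * η a := by rw [hqd]; field_simp
    have hflip : Φ.toSeminorm (η.update a (-η a)) = Φ.toSeminorm η := by
      apply Φ.apply_congr_perm 1
      intro i
      by_cases hi : i = a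
      · subst hi; simp
      · simp [Function.update_of_ne hi]
    have hcomb : η.update a c = ((1 + q) / 2) • η + ((1 - q) / 2) • η.update a (-η a) := by
      ext i
      by_cases hi : i = a
      · subst hi; simp [hcq]; ring
      · simp [Function.update_of_ne hi]; ring
    calc Φ.toSeminorm (η.update a c)
        ≤ Φ.toSeminorm (((1 + q) / 2) • η) + Φ.toSeminorm (((1 - q) / 2) • η.update a (-η a)) := by
          rw [hcomb]; exact map_add_le_add _ _ _
      _ = (1 + q) / 2 * Φ.toSeminorm η + (1 - q) / 2 * Φ.toSeminorm η := by
          rw [map_smul_eq_mul, map_smul_eq_mul, hflip, Real.norm_of_nonneg (by linarith),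
            Real.norm_of_nonneg (by linarith)]
      _ = Φ.toSeminorm η := by ring

theorem apply_mono {ξ η : ℕ →₀ ℝ} (h : ∀ i, |ξ i| ≤ |η i|) :
    Φ.toSeminorm ξ ≤ Φ.toSeminorm η := by
  have key : ∀ (A : Finset ℕ) (ξ η : ℕ →₀ ℝ), (∀ i, |ξ i| ≤ |η i|) → (∀ i ∉ A, ξ i = η i) →
      Φ.toSeminorm ξ ≤ Φ.toSeminorm η := by
    intro A
    induction A using Finset.induction_on with
    | empty =>
      intro ξ η _ h2
      rw [show ξ = η from Finsupp.ext fun i => h2 i (by simp)]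
    | insert a A ha ih =>
      intro ξ η h1 h2
      refine le_trans (ih ξ (η.update a (ξ a)) ?_ ?_) (Φ.apply_update_le η a (ξ a) (h1 a))
      · intro i
        by_cases hi : i = a
        · subst hi; simp
        · simpa [Function.update_of_ne hi] using h1 i
      · intro i hiA
        by_cases hi : i = a
        · subst hi; simp
        · simpa [Function.update_of_ne hi] using h2 i (by simp [hi, hiA])
  refine key (ξ.support ∪ η.support) ξ η h ?_
  intro i hi
  simp only [Finset.mem_union, Finsupp.mem_support_iff, not_or, not_not] at hi
  rw [hi.1, hi.2]

theorem trunc_mono (ξ : ℕ → ℝ) : Monotone fun n => ENNReal.ofReal (Φ.toSeminorm (trunc ξ n)) := by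
  intro m n hmn
  refine ENNReal.ofReal_le_ofReal (Φ.apply_mono fun i => ?_)
  by_cases hi : i < m
  · simp [hi, lt_of_lt_of_le hi hmn]
  · simp [hi]

theorem tendsto_ext (ξ : ℕ → ℝ) :
    Tendsto (fun n => ENNReal.ofReal (Φ.toSeminorm (trunc ξ n))) atTop (𝓝 (Φ.ext ξ)) :=
  tendsto_atTop_iSup (Φ.trunc_mono ξ)

/-- Comparison of two sequences along an injective relabelling of the nonzero terms. -/
theorem ext_le_of_injOn {α β : ℕ → ℝ} (h : ℕ → ℕ) (hinj : Set.InjOn h {i | β i ≠ 0})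
    (hle : ∀ i, β i ≠ 0 → |β i| ≤ |α (h i)|) : Φ.ext β ≤ Φ.ext α := by
  refine iSup_le fun n => ?_
  let A : Finset ℕ := (Finset.range n).filter fun i => β i ≠ 0
  obtain ⟨σ, hσ⟩ := Equiv.Perm.exists_extending_pair (α := A) (fun i => (i : ℕ))
    (fun i => h i) Subtype.val_injective (by
      rintro ⟨i, hi⟩ ⟨j, hj⟩ hij
      exact Subtype.ext (hinj (Finset.mem_filter.1 hi).2 (Finset.mem_filter.1 hj).2 hij))
  have hσ' : ∀ i ∈ A, σ i = h i := fun i hi => by simpa using hσ ⟨i, hi⟩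
  let m := A.sup h + 1
  refine le_trans (ENNReal.ofReal_le_ofReal ?_)
    (le_iSup (fun n => ENNReal.ofReal (Φ.toSeminorm (trunc α n))) m)
  rw [← Φ.apply_congr_perm (ξ := trunc β n)
    (η := (trunc β n).comapDomain σ.symm σ.symm.injective.injOn) σ.symm (by intro i; simp)]
  refine Φ.apply_mono fun j => ?_
  by_cases hj : σ.symm j ∈ A
  · have hj' : j = h (σ.symm j) := by rw [← hσ' _ hj]; simp
    have hjm : j < m := by
      have : h (σ.symm j) ≤ A.sup h := Finset.le_sup hj
      omega
    have hA := Finset.mem_filter.1 hj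
    have := hle _ hA.2
    rw [← hj'] at this
    simpa [hjm, Finset.mem_range.1 hA.1] using this
  · have : trunc β n (σ.symm j) = 0 := by
      by_contra hne
      apply hj
      simp only [trunc_apply] at hne
      split_ifs at hne with h1
      · exact Finset.mem_filter.2 ⟨Finset.mem_range.2 h1, hne⟩
      · exact absurd rfl hne
    simp only [Finsupp.comapDomain_apply, this, abs_zero]
    exact abs_nonneg _

theorem ext_mono {α β : ℕ → ℝ} (h : ∀ i, |β i| ≤ |α i|) : Φ.ext β ≤ Φ.ext α :=
  Φ.ext_le_of_injOn id (fun _ _ _ _ h => h) fun i _ => h i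

theorem ext_add_le (α β : ℕ → ℝ) : Φ.ext (fun i => α i + β i) ≤ Φ.ext α + Φ.ext β := by
  refine iSup_le fun n => ?_
  have : trunc (fun i => α i + β i) n = trunc α n + trunc β n := by
    ext i
    by_cases hi : i < n <;> simp [hi]
  rw [this]
  calc _ ≤ ENNReal.ofReal (Φ.toSeminorm (trunc α n) + Φ.toSeminorm (trunc β n)) :=
        ENNReal.ofReal_le_ofReal (map_add_le_add _ _ _)
    _ ≤ _ := ENNReal.ofReal_add_le
    _ ≤ _ := add_le_add
        (le_iSup (fun n => ENNReal.ofReal (Φ.toSeminorm (trunc α n))) n)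
        (le_iSup (fun n => ENNReal.ofReal (Φ.toSeminorm (trunc β n))) n)

theorem ofReal_abs_le_ext (α : ℕ → ℝ) (i : ℕ) : ENNReal.ofReal |α i| ≤ Φ.ext α := by
  have h1 : Φ.toSeminorm (Finsupp.single i 1) = 1 := by
    rw [← Φ.apply_congr_perm (η := Finsupp.single 0 1) (ξ := Finsupp.single i 1)
      (Equiv.swap 0 i) ?_]
    · exact Φ.apply_single
    · intro j
      by_cases hj : j = 0
      · subst hj; simp
      · have : Equiv.swap 0 i j ≠ i := by
          intro h
          apply hj
          have := congrArg (Equiv.swap 0 i) h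
          simpa using this
        simp [Ne.symm hj, Ne.symm this]
  have h2 : Φ.toSeminorm (Finsupp.single i (α i)) = |α i| := by
    rw [show Finsupp.single i (α i) = (α i) • Finsupp.single i (1 : ℝ) by simp,
      map_smul_eq_mul, h1, mul_one, Real.norm_eq_abs]
  refine le_trans (ENNReal.ofReal_le_ofReal ?_)
    (le_iSup (fun n => ENNReal.ofReal (Φ.toSeminorm (trunc α n))) (i + 1))
  rw [← h2]
  refine Φ.apply_mono fun j => ?_
  by_cases hj : j = i
  · subst hj; simp
  · simp [Ne.symm hj]

theorem ext_zero : Φ.ext (fun _ => 0) = 0 := by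
  have : ∀ n, trunc (fun _ => 0) n = 0 := fun n => by ext i; simp
  simp [ext, this]

end SymmetricNorm

/-! ### Countable multisets -/

/-- A countable multiset in `(X, x₀)`: a multiplicity function `X → {0, 1, 2, …, ∞}` with countable
support for which `x₀` is the only point of infinite multiplicity. -/
@[ext] structure CountableMultiset {X : Type u} (x₀ : X) where
  mult : X → ℕ∞
  mult_base : mult x₀ = ⊤
  mult_ne_top : ∀ x, x ≠ x₀ → mult x ≠ ⊤
  countable_support : {x | mult x ≠ 0}.Countable

namespace CountableMultiset

variable {X : Type u} {x₀ : X}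

/-- The sequence `s` is an enumeration of `S`, i.e. `S = {s₀, s₁, …}^*`, where the multiplicity of
the basepoint in `{s₀, s₁, …}^*` is infinite by convention. -/
def IsEnumeration (S : CountableMultiset x₀) (s : ℕ → X) : Prop :=
  ∀ x, x ≠ x₀ → {i | s i = x}.encard = S.mult x

/-- The trivial multiset `O_{x₀} = {x₀, x₀, …}^*`. -/
noncomputable def trivialMultiset (x₀ : X) : CountableMultiset x₀ := by
  classical
  exact
  { mult := fun x => if x = x₀ then ⊤ else 0
    mult_base := by simp
    mult_ne_top := by intro x hx; simp [hx]
    countable_support := by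
      refine (Set.countable_singleton x₀).mono fun x hx => ?_
      by_contra h
      exact hx (if_neg h) }

theorem isEnumeration_trivial : (trivialMultiset x₀).IsEnumeration fun _ => x₀ := by
  intro x hx
  simp [trivialMultiset, hx, Ne.symm hx]

theorem IsEnumeration.comp_perm {S : CountableMultiset x₀} {s : ℕ → X} (h : S.IsEnumeration s)
    (π : Equiv.Perm ℕ) : S.IsEnumeration (s ∘ π) := by
  intro x hx
  rw [← h x hx]
  exact Set.encard_preimage_of_bijective π.bijective {i | s i = x}

/-- The sequence `(s₀, x₀, s₁, x₀, …)`. -/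
def pad (x₀ : X) (s : ℕ → X) (n : ℕ) : X := if n % 2 = 0 then s (n / 2) else x₀

theorem IsEnumeration.pad {S : CountableMultiset x₀} {s : ℕ → X} (h : S.IsEnumeration s) :
    S.IsEnumeration (pad x₀ s) := by
  intro x hx
  have : {i | CountableMultiset.pad x₀ s i = x} = (fun i => 2 * i) '' {i | s i = x} := by
    ext n
    simp only [CountableMultiset.pad, Set.mem_ofPred_eq, Set.mem_image]
    constructor
    · intro hn
      split_ifs at hn with h0
      · exact ⟨n / 2, hn, by omega⟩
      · exact absurd hn.symm hx
    · rintro ⟨i, hi, rfl⟩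
      simpa using hi
  rw [this, Set.InjOn.encard_image (fun a _ b _ hab => by simpa using hab), h x hx]

theorem infinite_pad (s : ℕ → X) : {i | pad x₀ s i = x₀}.Infinite := by
  refine Set.infinite_of_injective_forall_mem (f := fun i => 2 * i + 1)
    (fun a b hab => by simpa using hab) fun i => ?_
  have : (2 * i + 1) % 2 = 1 := by omega
  simp [pad, this]

theorem nonempty_equiv_of_encard_eq {A B : Set ℕ} (h : A.encard = B.encard) : Nonempty (A ≃ B) := by
  by_cases hA : A.Finite
  · have hB : B.Finite := by rw [← Set.encard_lt_top_iff] at hA ⊢; rwa [← h]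
    have := hA.to_subtype
    have := hB.to_subtype
    refine Finite.card_eq.1 ?_
    rw [Nat.card_coe_set_eq, Nat.card_coe_set_eq, Set.ncard_def, Set.ncard_def, h]
  · have hB : ¬ B.Finite := by rw [← Set.encard_lt_top_iff] at hA ⊢; rwa [← h]
    have := Set.Infinite.to_subtype hA
    have := Set.Infinite.to_subtype hB
    exact nonempty_equiv_of_countable

/-- Two enumerations that repeat `x₀` infinitely often agree up to a permutation. -/
theorem IsEnumeration.exists_perm {S : CountableMultiset x₀} {s t : ℕ → X}
    (hs : S.IsEnumeration s) (ht : S.IsEnumeration t) (hs' : {i | s i = x₀}.Infinite)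
    (ht' : {i | t i = x₀}.Infinite) : ∃ π : Equiv.Perm ℕ, ∀ i, t (π i) = s i := by
  have : ∀ x, Nonempty ({i // s i = x} ≃ {i // t i = x}) := by
    intro x
    apply nonempty_equiv_of_encard_eq (A := {i | s i = x}) (B := {i | t i = x})
    by_cases hx : x = x₀
    · subst hx; rw [hs'.encard_eq, ht'.encard_eq]
    · rw [hs x hx, ht x hx]
  exact ⟨Equiv.ofFiberEquiv fun x => (this x).some, fun i => Equiv.ofFiberEquiv_map _ i⟩

end CountableMultiset

/-! ### The metric space of summable multisets -/

/-- The set `𝒮_Φ(X, x₀)` of `Φ`-summable countable multisets in `(X, x₀)`. -/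
def SummableMultiset {X : Type u} [MetricSpace X] (Φ : SymmetricNorm) (x₀ : X) : Type u :=
  {S : CountableMultiset x₀ //
    ∃ s, S.IsEnumeration s ∧ Φ.IsSummable fun i => dist x₀ (s i)}

namespace SummableMultiset

variable {X : Type u} [MetricSpace X] {Φ : SymmetricNorm} {x₀ : X}

/-- The sequence `s` is an enumeration of `S`. -/
def IsEnumeration (S : SummableMultiset Φ x₀) (s : ℕ → X) : Prop :=
  CountableMultiset.IsEnumeration S.1 s

/-- The trivial multiset `O_{x₀}` as an element of `𝒮_Φ(X, x₀)`. -/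
noncomputable def trivialMultiset (Φ : SymmetricNorm) (x₀ : X) : SummableMultiset Φ x₀ :=
  ⟨CountableMultiset.trivialMultiset x₀, fun _ => x₀, CountableMultiset.isEnumeration_trivial, by
    simp, by simp [Φ.ext_zero]⟩

/-- The `Φ`-distance: the infimum of `Φ(d(s₀, t₀), d(s₁, t₁), …)` over all enumerations `s` of `S`
and `t` of `T`. -/
noncomputable instance : EDist (SummableMultiset Φ x₀) where
  edist S T := ⨅ (s : ℕ → X) (_ : S.IsEnumeration s) (t : ℕ → X) (_ : T.IsEnumeration t),
    Φ.ext fun i => dist (s i) (t i)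

theorem edist_le {S T : SummableMultiset Φ x₀} {s t : ℕ → X} (hs : S.IsEnumeration s)
    (ht : T.IsEnumeration t) : edist S T ≤ Φ.ext fun i => dist (s i) (t i) :=
  iInf₂_le_of_le s hs (iInf₂_le t ht)

theorem le_edist {S T : SummableMultiset Φ x₀} {a : ℝ≥0∞}
    (h : ∀ s t, S.IsEnumeration s → T.IsEnumeration t → a ≤ Φ.ext fun i => dist (s i) (t i)) :
    a ≤ edist S T :=
  le_iInf₂ fun s hs => le_iInf₂ fun t ht => h s t hs ht

theorem edist_self' (S : SummableMultiset Φ x₀) : edist S S = 0 := by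
  obtain ⟨s, hs, -⟩ := S.2
  refine le_antisymm ((edist_le (S := S) (T := S) hs hs).trans ?_) zero_le
  simp [Φ.ext_zero]

theorem edist_comm' (S T : SummableMultiset Φ x₀) : edist S T = edist T S := by
  have : ∀ S T : SummableMultiset Φ x₀, edist S T ≤ edist T S := fun S T =>
    le_edist fun t s ht hs => by
      simpa only [dist_comm] using edist_le hs ht
  exact le_antisymm (this S T) (this T S)

theorem ext_pad_le (s t : ℕ → X) :
    (Φ.ext fun i => dist (CountableMultiset.pad x₀ s i) (CountableMultiset.pad x₀ t i)) ≤
      Φ.ext fun i => dist (s i) (t i) := by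
  have hodd : ∀ i, dist (CountableMultiset.pad x₀ s i) (CountableMultiset.pad x₀ t i) ≠ 0 →
      i % 2 = 0 := by
    intro i hi
    by_contra h
    simp [CountableMultiset.pad, h] at hi
  refine Φ.ext_le_of_injOn (fun i => i / 2) ?_ ?_
  · intro i hi j hj hij
    have h1 := hodd i hi
    have h2 := hodd j hj
    simp only at hij
    omega
  · intro i hi
    simp [CountableMultiset.pad, hodd i hi]

theorem edist_triangle' (S U T : SummableMultiset Φ x₀) :
    edist S T ≤ edist S U + edist U T := by
  have key : ∀ s u u' t, S.IsEnumeration s → U.IsEnumeration u → U.IsEnumeration u' →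
      T.IsEnumeration t → edist S T ≤
        (Φ.ext fun i => dist (s i) (u i)) + Φ.ext fun i => dist (u' i) (t i) := by
    intro s u u' t hs hu hu' ht
    obtain ⟨π, hπ⟩ := CountableMultiset.IsEnumeration.exists_perm
      (CountableMultiset.IsEnumeration.pad hu) (CountableMultiset.IsEnumeration.pad hu')
      (CountableMultiset.infinite_pad u) (CountableMultiset.infinite_pad u')
    refine (edist_le (CountableMultiset.IsEnumeration.pad hs)
      ((CountableMultiset.IsEnumeration.pad ht).comp_perm π)).trans ?_
    refine le_trans (Φ.ext_mono (α := fun i =>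
      dist (CountableMultiset.pad x₀ s i) (CountableMultiset.pad x₀ u i) +
      dist (CountableMultiset.pad x₀ u' (π i)) (CountableMultiset.pad x₀ t (π i))) ?_) ?_
    · intro i
      rw [abs_of_nonneg dist_nonneg, abs_of_nonneg (by positivity), hπ]
      exact dist_triangle _ _ _
    · refine (Φ.ext_add_le _ _).trans (add_le_add (ext_pad_le s u)
        (le_trans ?_ (ext_pad_le (x₀ := x₀) u' t)))
      exact Φ.ext_le_of_injOn π π.injective.injOn fun i _ => le_rfl
  rw [show edist S U + edist U T = (⨅ (p : {p : (ℕ → X) × (ℕ → X) //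
      S.IsEnumeration p.1 ∧ U.IsEnumeration p.2}), Φ.ext fun i => dist (p.1.1 i) (p.1.2 i)) +
      edist U T from ?_]
  · rw [ENNReal.iInf_add]
    refine le_iInf fun p => ?_
    rw [add_comm]
    refine le_trans ?_ (le_refl _)
    have : edist U T = ⨅ (q : {q : (ℕ → X) × (ℕ → X) //
      U.IsEnumeration q.1 ∧ T.IsEnumeration q.2}), Φ.ext fun i => dist (q.1.1 i) (q.1.2 i) :=
      le_antisymm (le_iInf fun q => edist_le q.2.1 q.2.2)
        (le_edist fun s t hs ht => iInf_le_of_le ⟨(s, t), hs, ht⟩ le_rfl)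
    rw [this, ENNReal.iInf_add]
    refine le_iInf fun q => ?_
    rw [add_comm]
    exact key _ _ _ _ p.2.1 p.2.2 q.2.1 q.2.2
  · congr 1
    exact le_antisymm (le_iInf fun q => edist_le q.2.1 q.2.2)
      (le_edist fun s t hs ht => iInf_le_of_le ⟨(s, t), hs, ht⟩ le_rfl)

theorem edist_ne_top' (S T : SummableMultiset Φ x₀) : edist S T ≠ ⊤ := by
  have : ∀ S : SummableMultiset Φ x₀, edist (trivialMultiset Φ x₀) S < ⊤ := by
    intro S
    obtain ⟨s, hs, hs'⟩ := S.2
    exact (edist_le (S := trivialMultiset Φ x₀) (T := S) CountableMultiset.isEnumeration_trivial hs).trans_lt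
      hs'.2
  refine ((edist_triangle' S (trivialMultiset Φ x₀) T).trans_lt ?_).ne
  rw [edist_comm' S]
  exact ENNReal.add_lt_top.2 ⟨this S, this T⟩

theorem mult_le_of_edist_eq_zero {S T : SummableMultiset Φ x₀} (h : edist S T = 0) (x : X) :
    T.1.mult x ≤ S.1.mult x := by
  by_cases hx : x = x₀
  · subst hx; rw [S.1.mult_base]; exact le_top
  by_contra! hlt
  obtain ⟨s₁, hs₁, hs₁', -⟩ := S.2
  -- the points of `S` other than `x` keep a positive distance from `x`
  obtain ⟨ε, hε, hsep⟩ : ∃ ε > 0, ∀ y, y ≠ x → S.1.mult y ≠ 0 → ε ≤ dist y x := by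
    have hd : 0 < dist x₀ x := dist_pos.2 (Ne.symm hx)
    obtain ⟨N, hN⟩ := eventually_atTop.1 (hs₁'.eventually_lt_const (half_pos hd))
    obtain ⟨δ, hδ, hδ'⟩ : ∃ δ > 0, ∀ i < N, s₁ i ≠ x → δ ≤ dist (s₁ i) x := by
      clear hN
      induction N with
      | zero => exact ⟨1, one_pos, fun i hi => absurd hi (Nat.not_lt_zero i)⟩
      | succ N ih =>
        obtain ⟨δ, hδ, hδ'⟩ := ih
        by_cases hN : s₁ N = x
        · refine ⟨δ, hδ, fun i hi hne => ?_⟩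
          rcases Nat.lt_succ_iff_lt_or_eq.1 hi with h1 | rfl
          · exact hδ' i h1 hne
          · exact absurd hN hne
        · refine ⟨min δ (dist (s₁ N) x), lt_min hδ (dist_pos.2 hN), fun i hi hne => ?_⟩
          rcases Nat.lt_succ_iff_lt_or_eq.1 hi with h1 | rfl
          · exact (min_le_left _ _).trans (hδ' i h1 hne)
          · exact min_le_right _ _
    refine ⟨min δ (dist x₀ x / 2), lt_min hδ (half_pos hd), fun y hyx hy => ?_⟩
    by_cases hy0 : y = x₀
    · subst hy0; exact (min_le_right _ _).trans (by linarith)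
    have : {i | s₁ i = y}.Nonempty := by
      rw [← Set.encard_ne_zero, hs₁ y hy0]; exact hy
    obtain ⟨i, rfl⟩ := this
    by_cases hi : i < N
    · exact (min_le_left _ _).trans (hδ' i hi hyx)
    · have h1 := hN i (not_lt.1 hi)
      have h2 := dist_triangle x₀ (s₁ i) x
      exact (min_le_right _ _).trans (by linarith)
  have : ENNReal.ofReal ε ≤ edist S T := by
    refine le_edist fun s t hs ht => ?_
    obtain ⟨i, hi, hi'⟩ : ∃ i, t i = x ∧ s i ≠ x := by
      by_contra! hcon
      have : {i | t i = x}.encard ≤ {i | s i = x}.encard := Set.encard_le_encard hcon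
      rw [hs x hx, ht x hx] at this
      exact absurd hlt (not_lt.2 this)
    refine le_trans (ENNReal.ofReal_le_ofReal ?_) (Φ.ofReal_abs_le_ext _ i)
    rw [abs_of_nonneg dist_nonneg, hi]
    refine hsep _ hi' ?_
    by_cases hs0 : s i = x₀
    · rw [hs0, S.1.mult_base]; simp
    · rw [← hs _ hs0, Set.encard_ne_zero]; exact ⟨i, rfl⟩
  rw [h] at this
  exact absurd this (not_le.2 (by simpa using hε))

noncomputable instance : EMetricSpace (SummableMultiset Φ x₀) where
  edist_self := edist_self'
  edist_comm := edist_comm'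
  edist_triangle := edist_triangle'
  eq_of_edist_eq_zero := by
    intro S T h
    refine Subtype.ext (CountableMultiset.ext (funext fun x => ?_))
    exact le_antisymm (mult_le_of_edist_eq_zero (by rwa [edist_comm'])  x)
      (mult_le_of_edist_eq_zero h x)

/-- The metric `d_Φ` on `𝒮_Φ(X, x₀)`. -/
noncomputable instance : MetricSpace (SummableMultiset Φ x₀) :=
  EMetricSpace.toMetricSpace edist_ne_top'

/-- The sequence of continuous maps `γ₀, γ₁, … : [0, 1] → X` is a continuous enumeration of the path
`S`, i.e. `S(t) = {γ₀(t), γ₁(t), …}^*` for all `t`. -/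
def IsContinuousEnumeration {S₀ S₁ : SummableMultiset Φ x₀} (S : Path S₀ S₁) (γ : ℕ → C(unitInterval, X)) :
    Prop :=
  ∀ t : unitInterval, (S t).IsEnumeration fun i => γ i t

end SummableMultiset

/-! ### Topological notions -/

/-- Every point has a local base of simply connected open sets. -/
def LocallySimplyConnected (X : Type u) [TopologicalSpace X] : Prop :=
  ∀ x : X, ∀ V ∈ 𝓝 x, ∃ U ⊆ V, IsOpen U ∧ x ∈ U ∧ IsSimplyConnected U

section Paths

variable {X : Type u} [TopologicalSpace X]

/-- `γ` is a null-homotopic loop based at `x₀`. -/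
def IsNullHomotopicLoop (x₀ : X) (γ : C(unitInterval, X)) : Prop :=
  ∃ p : Path x₀ x₀, p.toContinuousMap = γ ∧ p.Homotopic (Path.refl x₀)

/-- `γ'` is a `U`-extension of `γ`: a path `θₗ ⋅ γ ⋅ θᵣ`, where `θᵣ` is a path in `U` from `γ(1)` to
`x₀` if `γ(1) ∈ U` and is constant otherwise, and `θₗ` is a path in `U` from `x₀` to `γ(0)` if
`γ(0) ∈ U` and is constant otherwise. -/
def IsUExtension (x₀ : X) (U : Set X) (γ γ' : C(unitInterval, X)) : Prop :=
  ∃ (a b : X) (θₗ : Path a (γ 0)) (θᵣ : Path (γ 1) b),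
    ((γ 0 ∈ U ∧ a = x₀ ∧ ∀ t, θₗ t ∈ U) ∨ (γ 0 ∉ U ∧ ∀ t, θₗ t = γ 0)) ∧
    ((γ 1 ∈ U ∧ b = x₀ ∧ ∀ t, θᵣ t ∈ U) ∨ (γ 1 ∉ U ∧ ∀ t, θᵣ t = γ 1)) ∧
    γ' = ((θₗ.trans (⟨γ, rfl, rfl⟩ : Path (γ 0) (γ 1))).trans θᵣ).toContinuousMap

end Paths

/-! ### First singular homology -/

section Homology

open CategoryTheory Simplicial

/-- The integral singular chain complex of `X`. -/
noncomputable abbrev singularChains (X : Type u) [TopologicalSpace X] :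
    ChainComplex (ModuleCat.{u} ℤ) ℕ :=
  ((AlgebraicTopology.singularChainComplexFunctor (ModuleCat.{u} ℤ)).obj
    (ModuleCat.of ℤ (ULift.{u} ℤ))).obj (TopCat.of X)

/-- The first integral singular homology group `H₁(X)`. -/
noncomputable abbrev singularH1 (X : Type u) [TopologicalSpace X] : ModuleCat.{u} ℤ :=
  ((AlgebraicTopology.singularHomologyFunctor (ModuleCat.{u} ℤ) 1).obj
    (ModuleCat.of ℤ (ULift.{u} ℤ))).obj (TopCat.of X)

variable {X : Type u} [TopologicalSpace X]

/-- A path in `X` as a singular `1`-simplex, through the identification of the standard `1`-simplex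
with `[0, 1]` that sends vertex `0` to `0` and vertex `1` to `1`. -/
noncomputable def pathSimplex (γ : C(unitInterval, X)) : (TopCat.toSSet.obj (TopCat.of X)) _⦋1⦌ :=
  ((TopCat.of X).toSSetObjEquiv (.op ⦋1⦌)).symm
    (γ.comp (stdSimplexHomeomorphUnitInterval : C(stdSimplex ℝ (Fin 2), unitInterval)))

/-- A path in `X` as a singular `1`-chain. -/
noncomputable def pathChain (γ : C(unitInterval, X)) : (singularChains X).X 1 :=
  ((TopCat.toSSet.obj (TopCat.of X)).ιChainComplex (R := ModuleCat.of ℤ (ULift.{u} ℤ))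
    (pathSimplex γ)).hom ⟨1⟩

/-- The `1`-chain `c` is a cycle, and `h` is its homology class. -/
def IsHomologyClass (c : (singularChains X).X 1) (h : singularH1 X) : Prop :=
  ∃ z : (singularChains X).cycles 1,
    ((singularChains X).iCycles 1).hom z = c ∧ ((singularChains X).homologyπ 1).hom z = h

/-- The formal infinite sum `∑ γᵢ`, i.e. the finite sum of those `γᵢ` that are not null-homotopic
loops based at `x₀` (all but finitely many are), is a `1`-cycle with homology class `h`. -/
def IsFormalSumClass (x₀ : X) (γ : ℕ → C(unitInterval, X)) (h : singularH1 X) : Prop :=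
  ∃ hfin : {i | ¬ IsNullHomotopicLoop x₀ (γ i)}.Finite,
    IsHomologyClass (∑ i ∈ hfin.toFinset, pathChain (γ i)) h

end Homology

/-! A loop of multisets at `O_{x₀}` unfolds into a sequence of loops in `X` at `x₀`, almost all
inside a small simply connected neighbourhood. Members may be permuted and, where they meet,
exchange their continuations; what survives is the sum of their homology classes.

Existence of enumerations (`exists_continuous_enumeration`): at finitely many times, enumerations of
consecutive multisets can be matched. Limits along an ultrafilter of ever finer matchings give
curves indexed by germs. They are continuous because distances to a multiset leave gaps that short
steps cannot cross (`exists_modulus`); multiplicities are right because points other than `x₀` are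
isolated.

Invariance (`finsum_normalizedClass_eq_of_homotopic`): classes of paths are taken in chains modulo
boundaries, with a correction `Θ` at the end points that encodes `U`-extensions. Multisets near a
given one are spread over disjoint simply connected sets, on each of which the class of a path is a
difference of a potential. Hence the sum over an enumeration is locally a difference of a function
of multisets (`exists_local_potential`). It is therefore independent of the enumeration and additive
along small triangles; subdivision extends this to all triangles, and so to homotopies.

Isomorphism: addition makes the space of multisets a commutative topological monoid, so its
fundamental group is abelian (`fundamentalGroup_mul_comm`). The embedding of `X` induces a
surjection from `π₁(X)`: by regularity the small loops can be contracted one after the other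
(`homotopic_refl_of_forall_mem`), and the finitely many others split off. Followed by the sum of
classes it is the Hurewicz map, which is onto `H₁(X)` (`exists_pathClass_eq`) and has kernel in the
commutator subgroup (`mem_commutator_of_loopClass_eq_one`). That subgroup dies in the abelian group
of multiset loops, so the sum of classes is bijective. -/

/-! ### Classes of paths in singular chains modulo boundaries -/

section Homology

open CategoryTheory Simplicial

variable {X : Type u} [TopologicalSpace X]

/-- Singular `1`-chains modulo boundaries. -/
noncomputable abbrev chainClasses (X : Type u) [TopologicalSpace X] : ModuleCat.{u} ℤ :=
  (singularChains X).opcycles 1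

/-- The class of a path in the group of singular `1`-chains modulo boundaries. -/
noncomputable def pathClass (γ : C(unitInterval, X)) : chainClasses X :=
  ((singularChains X).pOpcycles 1).hom (pathChain γ)

/-- A point as a singular `0`-chain. -/
noncomputable def pointChain (x : X) : (singularChains X).X 0 :=
  ((TopCat.toSSet.obj (TopCat.of X)).ιChainComplex (R := ModuleCat.of ℤ (ULift.{u} ℤ))
    (((TopCat.of X).toSSetObjEquiv (.op ⦋0⦌)).symm (ContinuousMap.const _ x))).hom ⟨1⟩

/-- A singular simplex as a singular chain. -/
noncomputable def simplexChain {n : ℕ} (x : (TopCat.toSSet.obj (TopCat.of X)) _⦋n⦌) :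
    (singularChains X).X n :=
  ((TopCat.toSSet.obj (TopCat.of X)).ιChainComplex (R := ModuleCat.of ℤ (ULift.{u} ℤ)) x).hom ⟨1⟩

theorem d_simplexChain_one (x : (TopCat.toSSet.obj (TopCat.of X)) _⦋1⦌) :
    ((singularChains X).d 1 0).hom (simplexChain x) =
      simplexChain ((TopCat.toSSet.obj (TopCat.of X)).δ 0 x) -
        simplexChain ((TopCat.toSSet.obj (TopCat.of X)).δ 1 x) := by
  have h := ((TopCat.toSSet.obj (TopCat.of X)).ιChainComplex_d
    (R := ModuleCat.of ℤ (ULift.{u} ℤ)) x).trans (Fin.sum_univ_two _)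
  refine (congrArg (fun f => f.hom (⟨1⟩ : ULift.{u} ℤ)) h).trans ?_
  simp only [Fin.val_zero, Fin.val_one, pow_zero, pow_one, one_smul, neg_smul]
  exact (sub_eq_add_neg _ _).symm

theorem d_simplexChain_two (x : (TopCat.toSSet.obj (TopCat.of X)) _⦋2⦌) :
    ((singularChains X).d 2 1).hom (simplexChain x) =
      simplexChain ((TopCat.toSSet.obj (TopCat.of X)).δ 0 x) -
        simplexChain ((TopCat.toSSet.obj (TopCat.of X)).δ 1 x) +
          simplexChain ((TopCat.toSSet.obj (TopCat.of X)).δ 2 x) := by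
  have h := ((TopCat.toSSet.obj (TopCat.of X)).ιChainComplex_d
    (R := ModuleCat.of ℤ (ULift.{u} ℤ)) x).trans (Fin.sum_univ_three _)
  refine (congrArg (fun f => f.hom (⟨1⟩ : ULift.{u} ℤ)) h).trans ?_
  simp only [Fin.val_zero, Fin.val_one, Fin.val_two, pow_zero, pow_one, one_smul, neg_smul, neg_one_sq]
  exact congrArg (fun y : (singularChains X).X 1 =>
    y + simplexChain ((TopCat.toSSet.obj (TopCat.of X)).δ 2 x)) (sub_eq_add_neg _ _).symm

theorem d_pathChain (γ : C(unitInterval, X)) :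
    ((singularChains X).d 1 0).hom (pathChain γ) = pointChain (γ 1) - pointChain (γ 0) := by
  have e0 : (TopCat.toSSet.obj (TopCat.of X)).δ 0 (pathSimplex γ) =
      ((TopCat.of X).toSSetObjEquiv (.op ⦋0⦌)).symm (ContinuousMap.const _ (γ 1)) := by
    apply ((TopCat.of X).toSSetObjEquiv (.op ⦋0⦌)).injective
    ext z
    refine congrArg γ (Subtype.ext ?_)
    change FunOnFinite.linearMap ℝ ℝ _ z.1 1 = 1
    have : ∑ i : Fin 1, z.1 i = 1 := z.2.2
    rw [FunOnFinite.linearMap_apply_apply, ← this]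
    refine Finset.sum_congr ?_ fun _ _ => rfl
    ext i
    fin_cases i
    simp
    rfl
  have e1 : (TopCat.toSSet.obj (TopCat.of X)).δ 1 (pathSimplex γ) =
      ((TopCat.of X).toSSetObjEquiv (.op ⦋0⦌)).symm (ContinuousMap.const _ (γ 0)) := by
    apply ((TopCat.of X).toSSetObjEquiv (.op ⦋0⦌)).injective
    ext z
    refine congrArg γ (Subtype.ext ?_)
    change FunOnFinite.linearMap ℝ ℝ _ z.1 1 = 0
    rw [FunOnFinite.linearMap_apply_apply]
    refine Finset.sum_eq_zero fun i hi => ?_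
    simp only [Finset.mem_filter, Finset.mem_univ, true_and] at hi
    fin_cases i
    exact absurd (show (0 : Fin 2) = 1 from hi) (by decide)
  exact (d_simplexChain_one (pathSimplex γ)).trans
    (congrArg₂ (· - ·) (congrArg simplexChain e0) (congrArg simplexChain e1))

/-- A continuous map on a real vector space, restricted to a segment. -/
def segmentPath {E : Type*} [AddCommGroup E] [Module ℝ E] [TopologicalSpace E]
    [IsTopologicalAddGroup E] [ContinuousSMul ℝ E] (f : C(E, X)) (p q : E) : C(unitInterval, X) where
  toFun t := f (AffineMap.lineMap p q (t : ℝ))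
  continuous_toFun := by
    simp only [AffineMap.lineMap_apply_module]
    fun_prop

/-- A continuous map on the standard 2-simplex yields a relation between the classes of its edges. -/
theorem pathClass_triangle (g : C(stdSimplex ℝ (Fin 3), X)) (a b c : C(unitInterval, X))
    (ha : ∀ z : stdSimplex ℝ (Fin 2), g (stdSimplex.map (Fin.succAbove 2) z) = a (stdSimplexHomeomorphUnitInterval z))
    (hb : ∀ z : stdSimplex ℝ (Fin 2), g (stdSimplex.map (Fin.succAbove 0) z) = b (stdSimplexHomeomorphUnitInterval z))
    (hc : ∀ z : stdSimplex ℝ (Fin 2), g (stdSimplex.map (Fin.succAbove 1) z) = c (stdSimplexHomeomorphUnitInterval z)) :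
    pathClass a + pathClass b = pathClass c := by
  have e0 : (TopCat.toSSet.obj (TopCat.of X)).δ 0 (((TopCat.of X).toSSetObjEquiv (.op ⦋2⦌)).symm g) =
      pathSimplex b := by
    apply ((TopCat.of X).toSSetObjEquiv (.op ⦋1⦌)).injective
    ext z
    exact hb z
  have e1 : (TopCat.toSSet.obj (TopCat.of X)).δ 1 (((TopCat.of X).toSSetObjEquiv (.op ⦋2⦌)).symm g) =
      pathSimplex c := by
    apply ((TopCat.of X).toSSetObjEquiv (.op ⦋1⦌)).injective
    ext z
    exact hc z
  have e2 : (TopCat.toSSet.obj (TopCat.of X)).δ 2 (((TopCat.of X).toSSetObjEquiv (.op ⦋2⦌)).symm g) =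
      pathSimplex a := by
    apply ((TopCat.of X).toSSetObjEquiv (.op ⦋1⦌)).injective
    ext z
    exact ha z
  have hd : ((singularChains X).pOpcycles 1).hom (((singularChains X).d 2 1).hom (simplexChain
      (((TopCat.of X).toSSetObjEquiv (.op ⦋2⦌)).symm g))) = 0 :=
    congrArg (fun f => f.hom (simplexChain (((TopCat.of X).toSSetObjEquiv (.op ⦋2⦌)).symm g)))
      ((singularChains X).d_pOpcycles 2 1)
  rw [d_simplexChain_two, e0, e1, e2, map_add, map_sub] at hd
  change pathClass b - pathClass c + pathClass a = 0 at hd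
  rw [← sub_eq_zero, ← hd]
  abel

/-- The affine triangle with vertices `p`, `q`, `r`, possibly degenerate, is mapped to `X` by `f`.
Constants, concatenation, reversal and homotopy are instances with `E = ℝ` or `E = ℝ × ℝ`. -/
theorem pathClass_segment {E : Type*} [AddCommGroup E] [Module ℝ E] [TopologicalSpace E]
    [IsTopologicalAddGroup E] [ContinuousSMul ℝ E] (f : C(E, X)) (p q r : E) :
    pathClass (segmentPath f p q) + pathClass (segmentPath f q r) =
      pathClass (segmentPath f p r) := by
  refine pathClass_triangle ⟨fun x => f (x.1 0 • p + x.1 1 • q + x.1 2 • r), by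
    have h (i : Fin 3) : Continuous fun x : stdSimplex ℝ (Fin 3) => x.1 i :=
      (continuous_apply i).comp continuous_subtype_val
    exact f.continuous.comp ((((h 0).smul continuous_const).add
      ((h 1).smul continuous_const)).add ((h 2).smul continuous_const))⟩ _ _ _ ?_ ?_ ?_
  all_goals
    intro z
    have hz : z.1 0 = 1 - z.1 1 := by
      have := z.2.2
      rw [Fin.sum_univ_two] at this
      exact eq_sub_of_add_eq this
    refine congrArg f ?_
    rw [AffineMap.lineMap_apply_module]
    change FunOnFinite.linearMap ℝ ℝ _ z.1 0 • p + FunOnFinite.linearMap ℝ ℝ _ z.1 1 • q +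
      FunOnFinite.linearMap ℝ ℝ _ z.1 2 • r = (1 - z.1 1) • _ + z.1 1 • _
    rw [← hz]
    have h21 : (Fin.succAbove (2 : Fin 3) (1 : Fin 2)) = 1 := rfl
    simp [FunOnFinite.linearMap_apply_apply, Finset.sum_filter, h21]

theorem pathClass_const (x : X) : pathClass (ContinuousMap.const unitInterval x) = 0 := by
  have h := pathClass_segment (ContinuousMap.const ℝ x) 0 0 0
  exact left_eq_add.1 h.symm

/-- The extension of a path to the real line, constant outside the unit interval. -/
noncomputable def extendPath (γ : C(unitInterval, X)) : C(ℝ, X) :=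
  γ.comp ⟨Set.projIcc 0 1 zero_le_one, continuous_projIcc⟩

theorem extendPath_coe (γ : C(unitInterval, X)) (t : unitInterval) : extendPath γ t = γ t := by
  simp [extendPath]

theorem segmentPath_extendPath (γ : C(unitInterval, X)) :
    segmentPath (extendPath γ) 0 1 = γ := by
  ext t
  have : AffineMap.lineMap (0 : ℝ) 1 (t : ℝ) = (t : ℝ) := by simp [AffineMap.lineMap_apply]
  simp only [segmentPath, ContinuousMap.coe_mk, this, extendPath_coe]

theorem pathClass_trans {x y z : X} (p : Path x y) (q : Path y z) :
    pathClass (p.trans q).toContinuousMap =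
      pathClass p.toContinuousMap + pathClass q.toContinuousMap := by
  -- The two halves and the whole path are the sides of the degenerate triangle with vertices `0`,
  -- `1 / 2`, `1`.
  have h := pathClass_segment (extendPath (p.trans q).toContinuousMap) 0 (1 / 2) 1
  rw [segmentPath_extendPath] at h
  rw [← h]
  congr 2
  · ext t
    have ht : ((1 / 2 : ℝ) * t) ∈ unitInterval := ⟨by have := t.2.1; positivity, by linarith [t.2.2]⟩
    have e : AffineMap.lineMap (0 : ℝ) (1 / 2) (t : ℝ) = (1 / 2 : ℝ) * t := by
      simp [AffineMap.lineMap_apply, mul_comm]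
    have := extendPath_coe (p.trans q).toContinuousMap ⟨_, ht⟩
    simp only [segmentPath, ContinuousMap.coe_mk, e]
    rw [this]
    simp only [Path.coe_toContinuousMap, Path.trans_apply]
    rw [dif_pos (by linarith [t.2.2])]
    congr 1
    ext
    simp
  · ext t
    have ht : (1 / 2 + (1 / 2 : ℝ) * t) ∈ unitInterval :=
      ⟨by have := t.2.1; positivity, by linarith [t.2.2]⟩
    have e : AffineMap.lineMap (1 / 2 : ℝ) 1 (t : ℝ) = 1 / 2 + (1 / 2 : ℝ) * t := by
      simp [AffineMap.lineMap_apply]; ring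
    have := extendPath_coe (p.trans q).toContinuousMap ⟨_, ht⟩
    simp only [segmentPath, ContinuousMap.coe_mk, e]
    rw [this]
    simp only [Path.coe_toContinuousMap]
    rw [← Path.extend_apply _ ht]
    rw [Path.extend_trans_of_half_le _ _ (by linarith [t.2.1])]
    rw [show (2 * (1 / 2 + 1 / 2 * (t : ℝ)) - 1) = t by ring]
    exact Path.extend_extends' q t

theorem pathClass_symm {x y : X} (p : Path x y) :
    pathClass p.symm.toContinuousMap = - pathClass p.toContinuousMap := by
  have h := pathClass_segment (extendPath p.toContinuousMap) 0 1 0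
  rw [segmentPath_extendPath] at h
  have e1 : segmentPath (extendPath p.toContinuousMap) 1 0 = p.symm.toContinuousMap := by
    ext t
    have : AffineMap.lineMap (1 : ℝ) 0 (t : ℝ) = (unitInterval.symm t : ℝ) := by
      simp [AffineMap.lineMap_apply]; ring
    simp only [segmentPath, ContinuousMap.coe_mk, this, extendPath_coe]
    rfl
  have e2 : segmentPath (extendPath p.toContinuousMap) 0 0 = ContinuousMap.const _ x := by
    ext t
    have := extendPath_coe p.toContinuousMap 0
    simpa [segmentPath] using this
  rw [e1, e2, pathClass_const] at h
  exact eq_neg_of_add_eq_zero_right h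

/-- The extension of a map on the unit square to the plane. -/
noncomputable def extendSquare (F : C(unitInterval × unitInterval, X)) : C(ℝ × ℝ, X) :=
  F.comp ⟨fun p => (Set.projIcc 0 1 zero_le_one p.1, Set.projIcc 0 1 zero_le_one p.2),
    (continuous_projIcc.comp continuous_fst).prodMk (continuous_projIcc.comp continuous_snd)⟩

theorem extendSquare_coe (F : C(unitInterval × unitInterval, X)) (s t : unitInterval) :
    extendSquare F (s, t) = F (s, t) := by
  simp [extendSquare]

/-- The two triangles cut out of the square by a diagonal share that diagonal; the sides where the
homotopy is fixed contribute zero. -/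
theorem pathClass_homotopic {x y : X} {p q : Path x y} (h : p.Homotopic q) :
    pathClass p.toContinuousMap = pathClass q.toContinuousMap := by
  obtain ⟨F⟩ := h
  have e (a b c d s t : unitInterval) : ∀ r : unitInterval,
      ((1 - (r : ℝ)) * a + r * c = s) → ((1 - (r : ℝ)) * b + r * d = t) →
      segmentPath (extendSquare F.toContinuousMap) (a, b) (c, d) r = F (s, t) := by
    intro r h1 h2
    have : AffineMap.lineMap ((a : ℝ), (b : ℝ)) ((c : ℝ), (d : ℝ)) (r : ℝ) = ((s : ℝ), (t : ℝ)) := by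
      rw [AffineMap.lineMap_apply_module, ← h1, ← h2]
      simp
    simp only [segmentPath, ContinuousMap.coe_mk, this, extendSquare_coe]
    rfl
  have h1 := pathClass_segment (extendSquare F.toContinuousMap) ((0 : unitInterval), (0 : unitInterval))
    ((0 : unitInterval), (1 : unitInterval)) ((1 : unitInterval), (1 : unitInterval))
  have h2 := pathClass_segment (extendSquare F.toContinuousMap) ((0 : unitInterval), (0 : unitInterval))
    ((1 : unitInterval), (0 : unitInterval)) ((1 : unitInterval), (1 : unitInterval))
  have a1 : segmentPath (extendSquare F.toContinuousMap) ((0 : unitInterval), (0 : unitInterval))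
    ((0 : unitInterval), (1 : unitInterval)) = p.toContinuousMap := by
    ext r
    rw [e 0 0 0 1 0 r r (by simp) (by simp)]
    simp
  have a2 : segmentPath (extendSquare F.toContinuousMap) ((0 : unitInterval), (1 : unitInterval))
    ((1 : unitInterval), (1 : unitInterval)) = ContinuousMap.const _ y := by
    ext r
    rw [e 0 1 1 1 r 1 r (by simp) (by simp)]
    simp
  have a3 : segmentPath (extendSquare F.toContinuousMap) ((0 : unitInterval), (0 : unitInterval))
    ((1 : unitInterval), (0 : unitInterval)) = ContinuousMap.const _ x := by
    ext r
    rw [e 0 0 1 0 r 0 r (by simp) (by simp)]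
    simp
  have a4 : segmentPath (extendSquare F.toContinuousMap) ((1 : unitInterval), (0 : unitInterval))
    ((1 : unitInterval), (1 : unitInterval)) = q.toContinuousMap := by
    ext r
    rw [e 1 0 1 1 1 r r (by simp) (by simp)]
    simp
  rw [a1, a2, pathClass_const, add_zero] at h1
  rw [a3, a4, pathClass_const, zero_add] at h2
  rw [h1, h2]

end Homology

/-! ### The first homology group inside chains modulo boundaries -/

section Homology

open CategoryTheory Simplicial

variable {X : Type u} [TopologicalSpace X]

/-- The inclusion of homology classes into chains modulo boundaries. -/
noncomputable def homologyInclusion : singularH1 X →ₗ[ℤ] chainClasses X :=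
  ((singularChains X).homologyι 1).hom

theorem homologyInclusion_injective : Function.Injective (homologyInclusion (X := X)) :=
  (ModuleCat.mono_iff_injective ((singularChains X).homologyι 1)).1 inferInstance

/-- This replaces lifts to the object of cycles by two equations for the chain itself. Later
computations take place in chains modulo boundaries, where paths that are not closed also have
classes. -/
theorem isHomologyClass_iff (c : (singularChains X).X 1) (h : singularH1 X) :
    IsHomologyClass c h ↔ ((singularChains X).d 1 0).hom c = 0 ∧
      ((singularChains X).pOpcycles 1).hom c = homologyInclusion h := by
  have hπ (z : (singularChains X).cycles 1) :
      homologyInclusion (((singularChains X).homologyπ 1).hom z) =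
        ((singularChains X).pOpcycles 1).hom (((singularChains X).iCycles 1).hom z) :=
    congrArg (fun f => f.hom z) ((singularChains X).homology_π_ι 1)
  constructor
  · rintro ⟨z, rfl, rfl⟩
    refine ⟨?_, (hπ z).symm⟩
    exact congrArg (fun f => f.hom z) ((singularChains X).iCycles_d 1 0)
  · rintro ⟨h1, h2⟩
    refine ⟨((singularChains X).cyclesMk c 0 (by simp) h1), ?_, ?_⟩
    · exact (singularChains X).i_cyclesMk c 0 (by simp) h1
    · apply homologyInclusion_injective
      rw [hπ, ← h2]
      congr 1
      exact (singularChains X).i_cyclesMk c 0 (by simp) h1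

theorem exists_isHomologyClass (c : (singularChains X).X 1)
    (hc : ((singularChains X).d 1 0).hom c = 0) : ∃ h, IsHomologyClass c h :=
  ⟨_, (singularChains X).cyclesMk c 0 (by simp) hc,
    (singularChains X).i_cyclesMk c 0 (by simp) hc, rfl⟩

end Homology

/-! ### The Hurewicz map in degree one -/

section Hurewicz

open CategoryTheory Simplicial

variable {X : Type u} [TopologicalSpace X] {x₀ : X} (θ : ∀ x : X, Path x₀ x)

/-- The class in the abelianized fundamental group of a path, closed up by fixed paths from the
base point. -/
noncomputable def closedUpClass {x y : X} (p : Path.Homotopic.Quotient x y) :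
    Additive (Abelianization (FundamentalGroup X x₀)) :=
  Additive.ofMul (Abelianization.of (FundamentalGroup.fromPath
    (((Path.Homotopic.Quotient.mk (θ x)).trans p).trans (Path.Homotopic.Quotient.mk (θ y)).symm)))

theorem closedUpClass_trans {x y z : X} (p : Path.Homotopic.Quotient x y)
    (q : Path.Homotopic.Quotient y z) :
    closedUpClass θ (p.trans q) = closedUpClass θ p + closedUpClass θ q := by
  -- The product of the fundamental group composes in the order opposite to `trans`; the target is
  -- commutative.
  rw [add_comm]
  unfold closedUpClass
  rw [← ofMul_mul, ← map_mul, FundamentalGroup.mul_def]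
  congr 2
  change _ = Path.Homotopic.Quotient.trans _ _
  simp only [Path.Homotopic.Quotient.trans_assoc]
  rw [← Path.Homotopic.Quotient.trans_assoc (Path.Homotopic.Quotient.mk (θ y)).symm, Path.Homotopic.Quotient.symm_trans,
    Path.Homotopic.Quotient.refl_trans]

/-- The path `θ x₀` need not be constant, so closing up conjugates the loop; the abelianization does
not see this. -/
theorem closedUpClass_loop (p : Path.Homotopic.Quotient x₀ x₀) :
    closedUpClass θ p =
      Additive.ofMul (Abelianization.of (FundamentalGroup.fromPath p)) := by
  have : closedUpClass θ p = Additive.ofMul (Abelianization.of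
    ((FundamentalGroup.fromPath (Path.Homotopic.Quotient.mk (θ x₀)))⁻¹ * (FundamentalGroup.fromPath p *
      FundamentalGroup.fromPath (Path.Homotopic.Quotient.mk (θ x₀))))) := rfl
  rw [this]
  refine congrArg Additive.ofMul ?_
  rw [map_mul, map_mul, map_inv, mul_comm, mul_assoc, mul_inv_cancel, mul_one]

/-- A singular `1`-simplex as a path. -/
noncomputable def simplexPath (x : (TopCat.toSSet.obj (TopCat.of X)) _⦋1⦌) : C(unitInterval, X) :=
  ((TopCat.of X).toSSetObjEquiv (.op ⦋1⦌) x : C(stdSimplex ℝ (Fin 2), X)).comp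
    (stdSimplexHomeomorphUnitInterval.symm : C(unitInterval, stdSimplex ℝ (Fin 2)))

theorem simplexPath_pathSimplex (γ : C(unitInterval, X)) : simplexPath (pathSimplex γ) = γ := by
  ext t
  exact congrArg γ (stdSimplexHomeomorphUnitInterval.apply_symm_apply t)

theorem pathSimplex_simplexPath (x : (TopCat.toSSet.obj (TopCat.of X)) _⦋1⦌) :
    pathSimplex (simplexPath x) = x := by
  apply ((TopCat.of X).toSSetObjEquiv (.op ⦋1⦌)).injective
  ext z
  exact congrArg ((TopCat.of X).toSSetObjEquiv (.op ⦋1⦌) x)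
    (stdSimplexHomeomorphUnitInterval.symm_apply_apply z)

/-- A continuous map on the interval as a path between its end points. -/
def asPath (γ : C(unitInterval, X)) : Path (γ 0) (γ 1) := ⟨γ, rfl, rfl⟩

theorem singularChains_hom_ext {n : ℕ} {M : ModuleCat.{u} ℤ} {f g : (singularChains X).X n ⟶ M}
    (h : ∀ x : (TopCat.toSSet.obj (TopCat.of X)) _⦋n⦌,
      f.hom (simplexChain x) = g.hom (simplexChain x)) : f = g := by
  refine SSet.chainComplex_hom_ext (X := TopCat.toSSet.obj (TopCat.of X))
    (R := ModuleCat.of ℤ (ULift.{u} ℤ)) fun x => ?_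
  have aux (F : ULift.{u} ℤ →ₗ[ℤ] M) (r : ULift.{u} ℤ) : F r = r.down • F ⟨1⟩ := by
    have e : r = r.down • (⟨1⟩ : ULift.{u} ℤ) := by ext; simp
    exact (congrArg F e).trans (map_zsmul F r.down ⟨1⟩)
  refine ModuleCat.hom_ext (LinearMap.ext fun r => ?_)
  have hf := aux (ModuleCat.Hom.hom ((TopCat.toSSet.obj (TopCat.of X)).ιChainComplex x ≫ f)) r
  have hg := aux (ModuleCat.Hom.hom ((TopCat.toSSet.obj (TopCat.of X)).ιChainComplex x ≫ g)) r
  exact hf.trans (Eq.trans (congrArg (fun y : M => r.down • y) (h x)) hg.symm)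

/-- The homomorphism on singular chains with given values on the simplices. -/
noncomputable def chainLift {n : ℕ} {M : ModuleCat.{u} ℤ}
    (v : (TopCat.toSSet.obj (TopCat.of X)) _⦋n⦌ → M) : (singularChains X).X n ⟶ M :=
  Limits.Sigma.desc fun x => ModuleCat.ofHom
    ((LinearMap.toSpanSingleton ℤ M (v x)).comp (ULift.moduleEquiv (R := ℤ)).toLinearMap)

theorem chainLift_simplexChain {n : ℕ} {M : ModuleCat.{u} ℤ}
    (v : (TopCat.toSSet.obj (TopCat.of X)) _⦋n⦌ → M) (x : (TopCat.toSSet.obj (TopCat.of X)) _⦋n⦌) :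
    (chainLift v).hom (simplexChain x) = v x := by
  have h := Limits.Sigma.ι_desc (fun x => ModuleCat.ofHom ((LinearMap.toSpanSingleton ℤ M (v x)).comp
    (ULift.moduleEquiv (R := ℤ) (M := ℤ)).toLinearMap)) x
  refine (congrArg (fun f => f.hom (⟨1⟩ : ULift.{u} ℤ)) h).trans ?_
  simp
  exact M.isModule.one_smul (v x)

/-- The homomorphism on chains extending `closedUpClass`. -/
noncomputable def chainToLoops : (singularChains X).X 1 ⟶
    ModuleCat.of ℤ (Additive (Abelianization (FundamentalGroup X x₀))) :=
  chainLift fun x => closedUpClass θ (Path.Homotopic.Quotient.mk (asPath (simplexPath x)))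

theorem chainToLoops_simplexChain (x : (TopCat.toSSet.obj (TopCat.of X)) _⦋1⦌) :
    (chainToLoops θ).hom (simplexChain x) =
      closedUpClass θ (Path.Homotopic.Quotient.mk (asPath (simplexPath x))) :=
  chainLift_simplexChain _ x

theorem closedUpClass_asPath {x y : X} (p : Path x y) :
    closedUpClass θ (Path.Homotopic.Quotient.mk (asPath p.toContinuousMap)) =
      closedUpClass θ (Path.Homotopic.Quotient.mk p) := by
  obtain ⟨γ, rfl, rfl⟩ := p
  rfl

/-- In a simply connected space two sides of a triangle are homotopic to the third, and `f` carries
the homotopy to `X`. -/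
theorem closedUpClass_triangle {Y : Type*} [TopologicalSpace Y] [SimplyConnectedSpace Y]
    (f : C(Y, X)) (a b c : C(unitInterval, Y)) (h₁ : a 1 = b 0) (h₂ : a 0 = c 0)
    (h₃ : b 1 = c 1) :
    closedUpClass θ (Path.Homotopic.Quotient.mk (asPath (f.comp a))) +
      closedUpClass θ (Path.Homotopic.Quotient.mk (asPath (f.comp b))) =
        closedUpClass θ (Path.Homotopic.Quotient.mk (asPath (f.comp c))) := by
  let pa : Path (c 0) (b 0) := ⟨a, h₂, h₁⟩
  let pb : Path (b 0) (c 1) := ⟨b, rfl, h₃⟩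
  have h := ((SimplyConnectedSpace.paths_homotopic (pa.trans pb) (asPath c))).map f
  rw [Path.map_trans, ← Path.Homotopic.Quotient.eq, Path.Homotopic.Quotient.mk_trans] at h
  have h' := congrArg (closedUpClass θ) h
  rw [closedUpClass_trans] at h'
  rw [← closedUpClass_asPath, ← closedUpClass_asPath θ (pb.map _),
    ← closedUpClass_asPath θ ((asPath c).map _)] at h'
  exact h'

instance : ContractibleSpace (stdSimplex ℝ (Fin 3)) :=
  (convex_stdSimplex ℝ (Fin 3)).contractibleSpace ⟨_, single_mem_stdSimplex ℝ 0⟩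

/-- The edges of the standard `2`-simplex. -/
noncomputable def simplexEdge (i : Fin 3) : C(unitInterval, stdSimplex ℝ (Fin 3)) :=
  (⟨stdSimplex.map (Fin.succAbove i), by continuity⟩ : C(stdSimplex ℝ (Fin 2), stdSimplex ℝ (Fin 3))).comp
    (stdSimplexHomeomorphUnitInterval.symm : C(unitInterval, stdSimplex ℝ (Fin 2)))

theorem simplexEdge_zero (i : Fin 3) :
    (simplexEdge i 0 : stdSimplex ℝ (Fin 3)) = ⟨_, single_mem_stdSimplex ℝ (i.succAbove 0)⟩ := by
  have : stdSimplexHomeomorphUnitInterval.symm 0 = ⟨_, single_mem_stdSimplex ℝ 0⟩ :=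
    (Homeomorph.symm_apply_eq _).2 rfl
  change stdSimplex.map _ (stdSimplexHomeomorphUnitInterval.symm 0) = _
  rw [this]
  apply Subtype.ext
  ext j
  simp [stdSimplex.map]

theorem simplexEdge_one (i : Fin 3) :
    (simplexEdge i 1 : stdSimplex ℝ (Fin 3)) = ⟨_, single_mem_stdSimplex ℝ (i.succAbove 1)⟩ := by
  have : stdSimplexHomeomorphUnitInterval.symm 1 = ⟨_, single_mem_stdSimplex ℝ 1⟩ :=
    (Homeomorph.symm_apply_eq _).2 rfl
  change stdSimplex.map _ (stdSimplexHomeomorphUnitInterval.symm 1) = _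
  rw [this]
  apply Subtype.ext
  ext j
  simp [stdSimplex.map]

/-- The edges of a singular 2-simplex factor through the contractible standard simplex. The map thus
descends to chains modulo boundaries, where it is a left inverse of the abelianized Hurewicz map. -/
theorem chainToLoops_d : (singularChains X).d 2 1 ≫ chainToLoops θ = 0 := by
  refine singularChains_hom_ext fun x => ?_
  change (chainToLoops θ).hom (((singularChains X).d 2 1).hom (simplexChain x)) = 0
  rw [d_simplexChain_two, map_add, map_sub, chainToLoops_simplexChain, chainToLoops_simplexChain,
    chainToLoops_simplexChain]
  have h := closedUpClass_triangle θ (Y := stdSimplex ℝ (Fin 3))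
    ((TopCat.of X).toSSetObjEquiv (.op ⦋2⦌) x : C(stdSimplex ℝ (Fin 3), X))
    (simplexEdge 2) (simplexEdge 0) (simplexEdge 1)
    (by rw [simplexEdge_zero, simplexEdge_one]; rfl) (by rw [simplexEdge_zero, simplexEdge_zero]; rfl)
    (by rw [simplexEdge_one, simplexEdge_one]; rfl)
  change _ - closedUpClass θ (Path.Homotopic.Quotient.mk (asPath (ContinuousMap.comp
    ((TopCat.of X).toSSetObjEquiv (.op ⦋2⦌) x : C(stdSimplex ℝ (Fin 3), X)) (simplexEdge 1)))) + _ = _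
  rw [← h]
  change closedUpClass θ (Path.Homotopic.Quotient.mk (asPath (ContinuousMap.comp
    ((TopCat.of X).toSSetObjEquiv (.op ⦋2⦌) x : C(stdSimplex ℝ (Fin 3), X)) (simplexEdge 0)))) - _ +
    closedUpClass θ (Path.Homotopic.Quotient.mk (asPath (ContinuousMap.comp
    ((TopCat.of X).toSSetObjEquiv (.op ⦋2⦌) x : C(stdSimplex ℝ (Fin 3), X)) (simplexEdge 2)))) = 0
  abel

/-- The homomorphism on chains modulo boundaries extending `closedUpClass`. -/
noncomputable def classToLoops : chainClasses X →ₗ[ℤ]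
    Additive (Abelianization (FundamentalGroup X x₀)) :=
  ((singularChains X).descOpcycles (chainToLoops θ) 2 (by simp) (chainToLoops_d θ)).hom

theorem classToLoops_pOpcycles (c : (singularChains X).X 1) :
    classToLoops θ (((singularChains X).pOpcycles 1).hom c) = (chainToLoops θ).hom c :=
  congrArg (fun f => f.hom c)
    ((singularChains X).p_descOpcycles (chainToLoops θ) 2 (by simp) (chainToLoops_d θ))

theorem classToLoops_pathClass (γ : C(unitInterval, X)) :
    classToLoops θ (pathClass γ) = closedUpClass θ (Path.Homotopic.Quotient.mk (asPath γ)) := by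
  refine (classToLoops_pOpcycles θ _).trans ((chainToLoops_simplexChain θ (pathSimplex γ)).trans ?_)
  rw [simplexPath_pathSimplex]

/-- The class of a loop in the group of chains modulo boundaries, as a group homomorphism. -/
noncomputable def loopClass (x₀ : X) :
    FundamentalGroup X x₀ →* Multiplicative (chainClasses X) where
  toFun g := Multiplicative.ofAdd (Quotient.lift (fun p : Path x₀ x₀ => pathClass p.toContinuousMap)
    (fun _ _ h => pathClass_homotopic h) (FundamentalGroup.toPath g))
  map_one' := by
    change Multiplicative.ofAdd (pathClass (ContinuousMap.const _ x₀)) = 1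
    rw [pathClass_const]
    rfl
  map_mul' g h := by
    obtain ⟨p, rfl⟩ := Path.Homotopic.Quotient.mk_surjective g
    obtain ⟨q, rfl⟩ := Path.Homotopic.Quotient.mk_surjective h
    change Multiplicative.ofAdd (pathClass (q.trans p).toContinuousMap) = _
    rw [pathClass_trans, add_comm]
    rfl

/-- A loop that is null-homologous is a product of commutators. -/
theorem mem_commutator_of_loopClass_eq_one [PathConnectedSpace X] (g : FundamentalGroup X x₀)
    (hg : loopClass x₀ g = 1) : g ∈ commutator (FundamentalGroup X x₀) := by
  obtain ⟨p, rfl⟩ := Path.Homotopic.Quotient.mk_surjective g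
  let θ := fun x : X => PathConnectedSpace.somePath x₀ x
  have h : pathClass p.toContinuousMap = 0 := hg
  have h2 := classToLoops_pathClass θ p.toContinuousMap
  rw [h, map_zero, closedUpClass_asPath, closedUpClass_loop] at h2
  rw [← Abelianization.ker_of, MonoidHom.mem_ker]
  exact h2.symm

/-- The homomorphism `loopClass` on the abelianized fundamental group. -/
noncomputable def abelianizedLoopClass (x₀ : X) :
    Additive (Abelianization (FundamentalGroup X x₀)) →+ chainClasses X :=
  MonoidHom.toAdditiveLeft (Abelianization.lift (loopClass x₀))

theorem abelianizedLoopClass_closedUpClass {x y : X} (p : Path x y) :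
    abelianizedLoopClass x₀ (closedUpClass θ (Path.Homotopic.Quotient.mk p)) =
      pathClass (θ x).toContinuousMap + pathClass p.toContinuousMap -
        pathClass (θ y).toContinuousMap := by
  change pathClass (((θ x).trans p).trans (θ y).symm).toContinuousMap = _
  rw [pathClass_trans, pathClass_trans, pathClass_symm, sub_eq_add_neg]

/-- Closing up a path changes its class by `θ` at the start minus `θ` at the end, a function of the
boundary. On cycles the second summand vanishes, so a cycle is homologous to a loop. -/
theorem pOpcycles_eq (c : (singularChains X).X 1) :
    ((singularChains X).pOpcycles 1).hom c =
      abelianizedLoopClass x₀ ((chainToLoops θ).hom c) +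
        (chainLift (M := chainClasses X) fun x =>
          pathClass (θ ((TopCat.of X).toSSetObjEquiv (.op ⦋0⦌) x default)).toContinuousMap).hom
            (((singularChains X).d 1 0).hom c) := by
  let L : (singularChains X).X 0 ⟶ chainClasses X := (chainLift (M := chainClasses X) fun x : (TopCat.toSSet.obj (TopCat.of X)) _⦋0⦌ =>
    pathClass (θ ((TopCat.of X).toSSetObjEquiv (.op ⦋0⦌) x default)).toContinuousMap)
  have hs (r : ℤ) (x : Additive (Abelianization (FundamentalGroup X x₀))) :
      abelianizedLoopClass x₀ (r • x) = r • abelianizedLoopClass x₀ x := by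
    exact map_zsmul _ r x
  let A : ModuleCat.of ℤ (Additive (Abelianization (FundamentalGroup X x₀))) ⟶ chainClasses X :=
    ModuleCat.ofHom
      { toFun := abelianizedLoopClass x₀
        map_add' := map_add _
        map_smul' := fun r x => (hs r x).trans
          (int_smul_eq_zsmul (chainClasses X).isModule r _).symm }
  have key : (singularChains X).pOpcycles 1 = chainToLoops θ ≫ A + (singularChains X).d 1 0 ≫ L := by
    refine singularChains_hom_ext fun x => ?_
    change _ = abelianizedLoopClass x₀ ((chainToLoops θ).hom (simplexChain x)) +
      L.hom (((singularChains X).d 1 0).hom (simplexChain x))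
    rw [chainToLoops_simplexChain, abelianizedLoopClass_closedUpClass]
    obtain ⟨γ, rfl⟩ : ∃ γ, pathSimplex γ = x := ⟨_, pathSimplex_simplexPath x⟩
    have hL (y : X) : L.hom (pointChain y) = pathClass (θ y).toContinuousMap :=
      chainLift_simplexChain _ _
    rw [simplexPath_pathSimplex]
    change pathClass γ = _ + L.hom (((singularChains X).d 1 0).hom (pathChain γ))
    rw [d_pathChain, map_sub, hL, hL]
    change _ = _ + pathClass γ - _ + _
    abel
  exact congrArg (fun f => (ModuleCat.Hom.hom f) c) key

/-- Every `1`-cycle is homologous to a loop at the base point. -/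
theorem exists_pathClass_eq [PathConnectedSpace X] (x₀ : X) (h : singularH1 X) :
    ∃ p : Path x₀ x₀, pathClass p.toContinuousMap = homologyInclusion h := by
  let θ := fun x : X => PathConnectedSpace.somePath x₀ x
  obtain ⟨z, hz⟩ := (ModuleCat.epi_iff_surjective ((singularChains X).homologyπ 1)).1 inferInstance h
  obtain ⟨h1, h2⟩ := (isHomologyClass_iff _ h).1 ⟨z, rfl, hz⟩
  -- Any lift to the fundamental group of the value of `chainToLoops` on the cycle will do.
  obtain ⟨a, ha⟩ := QuotientGroup.mk_surjective
    (Additive.toMul ((chainToLoops θ).hom (((singularChains X).iCycles 1).hom z)))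
  obtain ⟨p, rfl⟩ := Path.Homotopic.Quotient.mk_surjective a
  refine ⟨p, ?_⟩
  rw [← h2, pOpcycles_eq θ, h1, map_zero, add_zero]
  exact congrArg (abelianizedLoopClass x₀) (congrArg Additive.ofMul ha)

end Hurewicz

/-! ### Comparison of enumerations of a multiset -/

namespace CountableMultiset

variable {X : Type u} {x₀ : X}

/-- The set of points of positive multiplicity; it contains the base point. -/
def carrier (S : CountableMultiset x₀) : Set X := {x | S.mult x ≠ 0}

theorem base_mem_carrier (S : CountableMultiset x₀) : x₀ ∈ S.carrier := by
  simp [carrier, S.mult_base]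

theorem IsEnumeration.mem_carrier {S : CountableMultiset x₀} {s : ℕ → X} (hs : S.IsEnumeration s)
    (i : ℕ) : s i ∈ S.carrier := by
  by_cases h : s i = x₀
  · rw [h]; exact S.base_mem_carrier
  · change S.mult (s i) ≠ 0
    rw [← hs _ h, Set.encard_ne_zero]
    exact ⟨i, rfl⟩

theorem IsEnumeration.exists_eq {S : CountableMultiset x₀} {s : ℕ → X} (hs : S.IsEnumeration s)
    {x : X} (hx : x ∈ S.carrier) (hx₀ : x ≠ x₀) : ∃ i, s i = x := by
  have : {i | s i = x}.Nonempty := by rw [← Set.encard_ne_zero, hs x hx₀]; exact hx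
  exact this

theorem IsEnumeration.carrier_eq {S : CountableMultiset x₀} {s : ℕ → X} (hs : S.IsEnumeration s) :
    S.carrier = insert x₀ (Set.range s) := by
  ext x
  refine ⟨fun hx => ?_, ?_⟩
  · by_cases h : x = x₀
    · exact Or.inl h
    · exact Or.inr (hs.exists_eq hx h)
  · rintro (rfl | ⟨i, rfl⟩)
    exacts [S.base_mem_carrier, hs.mem_carrier i]

/-- Two enumerations agree up to a bijection, apart from the terms equal to the base point. -/
theorem IsEnumeration.exists_equiv {S : CountableMultiset x₀} {s t : ℕ → X}
    (hs : S.IsEnumeration s) (ht : S.IsEnumeration t) :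
    ∃ e : {i // s i ≠ x₀} ≃ {i // t i ≠ x₀}, ∀ i, t (e i) = s i := by
  have h : ∀ x : {x // x ≠ x₀}, Nonempty ({i : {i // s i ≠ x₀} // (⟨s i, i.2⟩ : {x // x ≠ x₀}) = x} ≃
      {i : {i // t i ≠ x₀} // (⟨t i, i.2⟩ : {x // x ≠ x₀}) = x}) := by
    intro x
    obtain ⟨e⟩ := nonempty_equiv_of_encard_eq ((hs x.1 x.2).trans (ht x.1 x.2).symm)
    have aux (u : ℕ → X) : {i : {i // u i ≠ x₀} // (⟨u i, i.2⟩ : {x // x ≠ x₀}) = x} ≃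
        {i | u i = x.1} :=
      { toFun := fun i => ⟨i.1.1, congrArg Subtype.val i.2⟩
        invFun := fun i => ⟨⟨i.1, fun h => x.2 (i.2.symm.trans h)⟩, Subtype.ext i.2⟩
        left_inv := fun _ => rfl
        right_inv := fun _ => rfl }
    exact ⟨(aux s).trans (e.trans (aux t).symm)⟩
  refine ⟨Equiv.ofFiberEquiv fun x => (h x).some, fun i => ?_⟩
  exact congrArg Subtype.val (Equiv.ofFiberEquiv_map (fun x => (h x).some) i)

/-- Two enumerations differ, up to a bijection, only in repetitions of `x₀`, where `φ` vanishes.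
Potentials on points thereby become functions of multisets. -/
theorem IsEnumeration.finsum_comp_eq {M : Type*} [AddCommMonoid M] {S : CountableMultiset x₀}
    {s t : ℕ → X} (hs : S.IsEnumeration s) (ht : S.IsEnumeration t) (φ : X → M) (hφ : φ x₀ = 0) :
    ∑ᶠ i, φ (s i) = ∑ᶠ i, φ (t i) := by
  have aux (u : ℕ → X) : ∑ᶠ i, φ (u i) = ∑ᶠ i : {i // u i ≠ x₀}, φ (u i) := by
    rw [finsum_subtype_eq_finsum_cond (f := fun i => φ (u i)) fun i => u i ≠ x₀]
    refine finsum_congr fun i => ?_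
    by_cases h : u i = x₀
    · simp [h, hφ]
    · simp [h]
  obtain ⟨e, he⟩ := hs.exists_equiv ht
  rw [aux s, aux t, ← finsum_comp_equiv e]
  exact finsum_congr fun i => by rw [he]

theorem IsEnumeration.ext_comp_le (Φ : SymmetricNorm) {S : CountableMultiset x₀}
    {s t : ℕ → X} (hs : S.IsEnumeration s) (ht : S.IsEnumeration t) (ψ : X → ℝ) (hψ : ψ x₀ = 0) :
    (Φ.ext fun i => ψ (s i)) ≤ Φ.ext fun i => ψ (t i) := by
  classical
  obtain ⟨e, he⟩ := hs.exists_equiv ht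
  have hne {i : ℕ} (hi : ψ (s i) ≠ 0) : s i ≠ x₀ := fun h => hi (by rw [h, hψ])
  refine Φ.ext_le_of_injOn (fun i => if h : s i ≠ x₀ then (e ⟨i, h⟩ : ℕ) else 0) ?_ ?_
  · intro i hi j hj hij
    simp only [dif_pos (hne hi), dif_pos (hne hj)] at hij
    exact congrArg Subtype.val (e.injective (Subtype.ext hij))
  · intro i hi
    simp only [dif_pos (hne hi), he]
    exact le_rfl

theorem IsEnumeration.encard_eq {S : CountableMultiset x₀} {s t : ℕ → X} (hs : S.IsEnumeration s)
    (ht : S.IsEnumeration t) {A : Set X} (hA : x₀ ∉ A) :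
    {i | s i ∈ A}.encard = {i | t i ∈ A}.encard := by
  obtain ⟨e, he⟩ := hs.exists_equiv ht
  have hne {u : ℕ → X} {i : ℕ} (hi : u i ∈ A) : u i ≠ x₀ := fun h => hA (h ▸ hi)
  refine Set.encard_congr
    { toFun := fun i => ⟨e ⟨i, hne i.2⟩, by
        have h2 := i.2
        simp only [Set.mem_ofPred_eq] at h2 ⊢
        rwa [he]⟩
      invFun := fun i => ⟨e.symm ⟨i, hne i.2⟩, by
        have := he (e.symm ⟨i, hne i.2⟩)
        rw [e.apply_symm_apply] at this
        have h2 := i.2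
        simp only [Set.mem_ofPred_eq] at h2 ⊢
        rwa [← this]⟩
      left_inv := fun i => by simp
      right_inv := fun i => by simp }

end CountableMultiset

/-! ### Metric properties: finiteness, compactness, gaps -/

namespace SummableMultiset

variable {X : Type u} [MetricSpace X] {Φ : SymmetricNorm} {x₀ : X}

theorem IsEnumeration.finite_le_dist {S : SummableMultiset Φ x₀} {s : ℕ → X}
    (hs : S.IsEnumeration s) {r : ℝ} (hr : 0 < r) : {i | r ≤ dist x₀ (s i)}.Finite := by
  obtain ⟨t, ht, ht', -⟩ := S.2
  have h := CountableMultiset.IsEnumeration.encard_eq hs ht (A := {x | r ≤ dist x₀ x})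
    (by simpa using hr)
  rw [← Set.encard_lt_top_iff]
  refine h.trans_lt ?_
  rw [Set.encard_lt_top_iff]
  have := ht'.eventually_lt_const hr
  rw [← Nat.cofinite_eq_atTop, Filter.eventually_cofinite] at this
  simpa using this

theorem IsEnumeration.tendsto {S : SummableMultiset Φ x₀} {s : ℕ → X} (hs : S.IsEnumeration s) :
    Tendsto s atTop (𝓝 x₀) := by
  rw [Metric.tendsto_nhds, ← Nat.cofinite_eq_atTop]
  intro ε hε
  rw [Filter.eventually_cofinite]
  simpa [dist_comm] using hs.finite_le_dist hε

/-- Membership in the space provides one summable enumeration only; comparison of enumerations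
passes to all others. -/
theorem IsEnumeration.isSummable {S : SummableMultiset Φ x₀} {s : ℕ → X} (hs : S.IsEnumeration s) :
    Φ.IsSummable fun i => dist x₀ (s i) := by
  obtain ⟨t, ht, -, ht'⟩ := S.2
  refine ⟨?_, (CountableMultiset.IsEnumeration.ext_comp_le Φ hs ht _ (dist_self x₀)).trans_lt ht'⟩
  simpa using (tendsto_const_nhds (x := x₀)).dist hs.tendsto

theorem exists_enumerations_of_edist_lt {S T : SummableMultiset Φ x₀} {a : ℝ≥0∞}
    (h : edist S T < a) : ∃ s t, S.IsEnumeration s ∧ T.IsEnumeration t ∧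
      (Φ.ext fun i => dist (s i) (t i)) < a := by
  change (⨅ (s : ℕ → X) (_ : S.IsEnumeration s) (t : ℕ → X) (_ : T.IsEnumeration t),
    Φ.ext fun i => dist (s i) (t i)) < a at h
  simp only [iInf_lt_iff] at h
  obtain ⟨s, hs, t, ht, h⟩ := h
  exact ⟨s, t, hs, ht, h⟩

theorem dist_lt_of_ext_lt {s t : ℕ → X} {κ : ℝ}
    (h : (Φ.ext fun i => dist (s i) (t i)) < ENNReal.ofReal κ) (i : ℕ) : dist (s i) (t i) < κ := by
  have := (Φ.ofReal_abs_le_ext (fun i => dist (s i) (t i)) i).trans_lt h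
  rw [abs_of_nonneg dist_nonneg] at this
  exact (ENNReal.ofReal_lt_ofReal_iff_of_nonneg dist_nonneg).1 this

theorem exists_enumerations_of_dist_lt {S T : SummableMultiset Φ x₀} {κ : ℝ} (h : dist S T < κ) :
    ∃ s t, S.IsEnumeration s ∧ T.IsEnumeration t ∧
      (Φ.ext fun i => dist (s i) (t i)) < ENNReal.ofReal κ ∧ ∀ i, dist (s i) (t i) < κ := by
  obtain ⟨s, t, hs, ht, h⟩ := exists_enumerations_of_edist_lt (edist_lt_ofReal.2 h)
  exact ⟨s, t, hs, ht, h, dist_lt_of_ext_lt h⟩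

theorem exists_mem_carrier_dist_lt {S T : SummableMultiset Φ x₀} {κ : ℝ} (h : dist S T < κ) {x : X}
    (hx : x ∈ S.1.carrier) : ∃ y ∈ T.1.carrier, dist x y < κ := by
  by_cases hx₀ : x = x₀
  · exact ⟨x₀, T.1.base_mem_carrier, by rw [hx₀, dist_self]; exact dist_nonneg.trans_lt h⟩
  · obtain ⟨s, t, hs, ht, -, h⟩ := exists_enumerations_of_dist_lt h
    obtain ⟨i, rfl⟩ := CountableMultiset.IsEnumeration.exists_eq hs hx hx₀
    exact ⟨t i, CountableMultiset.IsEnumeration.mem_carrier ht i, h i⟩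

/-- A close multiset has an enumeration close to a given enumeration that repeats the base point
infinitely often. -/
theorem exists_enumeration_close {S T : SummableMultiset Φ x₀} {κ : ℝ} (h : dist S T < κ)
    {s : ℕ → X} (hs : S.IsEnumeration s) (hs' : {i | s i = x₀}.Infinite) :
    ∃ t, T.IsEnumeration t ∧ {i | t i = x₀}.Infinite ∧ ∀ i, dist (s i) (t i) < κ := by
  obtain ⟨u, v, hu, hv, h⟩ := exists_enumerations_of_edist_lt (edist_lt_ofReal.2 h)
  -- Padding gives `u` infinitely many base points, which makes it a permutation of `s`; its partner
  -- `v` is padded and permuted along.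
  obtain ⟨π, hπ⟩ := CountableMultiset.IsEnumeration.exists_perm hs
    (CountableMultiset.IsEnumeration.pad hu) hs' (CountableMultiset.infinite_pad u)
  refine ⟨CountableMultiset.pad x₀ v ∘ π,
    (CountableMultiset.IsEnumeration.pad hv).comp_perm π, ?_, fun i => ?_⟩
  · exact (CountableMultiset.infinite_pad v).preimage (by simp)
  · rw [← hπ]
    exact dist_lt_of_ext_lt ((ext_pad_le u v).trans_lt h) (π i)

theorem isCompact_carrier (S : SummableMultiset Φ x₀) : IsCompact S.1.carrier := by
  obtain ⟨s, hs, -⟩ := S.2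
  rw [CountableMultiset.IsEnumeration.carrier_eq hs]
  exact (IsEnumeration.tendsto hs).isCompact_insert_range

theorem finite_carrier_dist (S : SummableMultiset Φ x₀) {r : ℝ} (hr : 0 < r) :
    {x ∈ S.1.carrier | r ≤ dist x₀ x}.Finite := by
  obtain ⟨s, hs, -⟩ := S.2
  refine ((IsEnumeration.finite_le_dist hs hr).image s).subset ?_
  rintro x ⟨hx, hr'⟩
  have hx₀ : x ≠ x₀ := by rintro rfl; rw [dist_self] at hr'; exact absurd hr (not_lt.2 hr')
  obtain ⟨i, rfl⟩ := CountableMultiset.IsEnumeration.exists_eq hs hx hx₀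
  exact ⟨i, hr', rfl⟩

/-- The distances from a point to the points of a summable multiset leave gaps everywhere. -/
theorem exists_gap (S : SummableMultiset Φ x₀) (p : X) {a b : ℝ} (hab : a < b) :
    ∃ r ∈ Set.Ioo a b, ∃ κ > 0, ∀ z ∈ S.1.carrier, κ ≤ |dist p z - r| := by
  -- The set of distances is countable, so it misses some `r` in the interval, and compact, so it
  -- keeps away from that `r`.
  have hc : ((fun z => dist p z) '' S.1.carrier).Countable := S.1.countable_support.image _
  obtain ⟨r, hr, hr'⟩ := (hc.dense_compl ℝ).exists_between hab
  have hcl : IsClosed ((fun z => dist p z) '' S.1.carrier) :=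
    (S.isCompact_carrier.image (by fun_prop)).isClosed
  obtain ⟨κ, hκ, hb⟩ := Metric.isOpen_iff.1 hcl.isOpen_compl r hr
  refine ⟨r, hr', κ, hκ, fun z hz => ?_⟩
  by_contra! h
  exact hb (show dist p z ∈ Metric.ball r κ from h) ⟨z, hz, rfl⟩

end SummableMultiset

/-! ### Estimates by initial segments and tails -/

namespace SymmetricNorm

variable (Φ : SymmetricNorm)

theorem ext_le_of_subsingleton {β : ℕ → ℝ} {c : ℝ} (hβ : ∀ i j, β i ≠ 0 → β j ≠ 0 → i = j)
    (hc : ∀ i, |β i| ≤ c) : Φ.ext β ≤ ENNReal.ofReal c := by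
  have hc0 : 0 ≤ c := (abs_nonneg _).trans (hc 0)
  have h1 : Φ.ext β ≤ Φ.ext (fun i => if i = 0 then c else 0) :=
    Φ.ext_le_of_injOn (fun _ => 0) (fun i hi j hj _ => hβ i j hi hj)
      fun i _ => by simpa [abs_of_nonneg hc0] using hc i
  refine h1.trans (iSup_le fun n => ENNReal.ofReal_le_ofReal ?_)
  have h2 : Φ.toSeminorm (c • Finsupp.single 0 1) = c := by
    rw [map_smul_eq_mul, Real.norm_of_nonneg hc0]
    exact (congrArg (c * ·) Φ.apply_single).trans (mul_one c)
  refine (Φ.apply_mono fun i => ?_).trans h2.le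
  by_cases hi : i = 0
  · subst hi
    simp only [trunc_apply, Finsupp.smul_apply, Finsupp.single_eq_same, if_true]
    split_ifs <;> simp
  · simp [hi]

theorem ext_initial_le {r : ℝ} (hr : 0 ≤ r) (n : ℕ) :
    Φ.ext (fun i => if i < n then r else 0) ≤ ENNReal.ofReal (n * r) := by
  induction n with
  | zero => simp [Φ.ext_zero]
  | succ n ih =>
    have : (fun i => if i < n + 1 then r else 0) =
        fun i => (if i < n then r else 0) + (if i = n then r else 0) := by
      funext i
      rcases lt_trichotomy i n with h | h | h
      · simp [h, h.ne, Nat.lt_succ_of_lt h]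
      · simp [h]
      · simp [not_lt.2 h.le, h.ne', not_lt.2 (Nat.succ_le_of_lt h)]
    rw [this]
    refine (Φ.ext_add_le _ _).trans ?_
    rw [Nat.cast_succ, add_mul, one_mul, ENNReal.ofReal_add (by positivity) hr]
    refine add_le_add ih (Φ.ext_le_of_subsingleton ?_ ?_)
    · intro i j hi hj
      simp only [ne_eq, ite_eq_right_iff, Classical.not_imp] at hi hj
      rw [hi.1, hj.1]
    · intro i
      split_ifs
      exacts [(abs_of_nonneg hr).le, by simpa using hr]

theorem ext_tail_antitone (ξ : ℕ → ℝ) {m n : ℕ} (h : m ≤ n) :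
    (Φ.ext fun i => ξ (n + i)) ≤ Φ.ext fun i => ξ (m + i) :=
  Φ.ext_le_of_injOn (fun i => n - m + i) (fun i _ j _ hij => by simpa using hij) fun i _ => by
    rw [show m + (n - m + i) = n + i by omega]

theorem ext_le_initial_add_tail {ξ : ℕ → ℝ} {n : ℕ} {r : ℝ} (hξ : ∀ i < n, |ξ i| ≤ r) :
    Φ.ext ξ ≤ ENNReal.ofReal (n * r) + Φ.ext fun i => ξ (n + i) := by
  by_cases hn : n = 0
  · subst hn; simp
  have hr : 0 ≤ r := (abs_nonneg _).trans (hξ 0 (Nat.pos_of_ne_zero hn))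
  have h1 : Φ.ext ξ ≤ Φ.ext (fun i => (if i < n then r else 0) + (if i < n then 0 else |ξ i|)) := by
    refine Φ.ext_mono fun i => ?_
    by_cases hi : i < n
    · simpa [hi, abs_of_nonneg hr] using hξ i hi
    · simp [hi]
  refine h1.trans ((Φ.ext_add_le _ _).trans (add_le_add (Φ.ext_initial_le hr n) ?_))
  refine Φ.ext_le_of_injOn (fun i => i - n) ?_ ?_
  · intro i hi j hj hij
    have h1 : ¬ i < n := fun h => hi (by simp [h])
    have h2 : ¬ j < n := fun h => hj (by simp [h])
    simp only at hij
    omega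
  · intro i hi
    have h1 : ¬ i < n := fun h => hi (by simp [h])
    simp [h1, Nat.add_sub_cancel' (not_lt.1 h1)]

end SymmetricNorm

/-! ### Uniform smallness of the tails of an enumeration -/

namespace SummableMultiset

variable {X : Type u} [MetricSpace X] {Φ : SymmetricNorm} {x₀ : X}
variable {Y : Type*} [TopologicalSpace Y] {S : Y → SummableMultiset Φ x₀} {γ : ℕ → Y → X}

/-- The terms of a continuous enumeration outside a ball whose boundary sphere is avoided are locally
constant. -/
theorem eventually_lt_dist_iff (hS : Continuous S) (hγ : ∀ i, Continuous (γ i))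
    (h : ∀ y, (S y).IsEnumeration fun i => γ i y) (y₀ : Y) {r κ : ℝ} (hr : 0 < r) (hκ : 0 < κ)
    (hgap : ∀ z ∈ (S y₀).1.carrier, κ ≤ |dist x₀ z - r|) :
    ∀ᶠ y in 𝓝 y₀, ∀ i, r < dist x₀ (γ i y) ↔ r < dist x₀ (γ i y₀) := by
  have hfin : {i | r < dist x₀ (γ i y₀)}.Finite :=
    ((h y₀).finite_le_dist hr).subset fun i (hi : r < _) => Set.mem_ofPred_eq ▸ hi.le
  have h1 : ∀ᶠ y in 𝓝 y₀, ∀ i ∈ {i | r < dist x₀ (γ i y₀)}, r < dist x₀ (γ i y) := by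
    rw [Filter.eventually_all_finite hfin]
    intro i hi
    exact (continuous_const.dist (hγ i)).continuousAt.eventually_const_lt hi
  have h2 : ∀ᶠ y in 𝓝 y₀, dist (S y) (S y₀) < κ :=
    hS.continuousAt.eventually (Metric.ball_mem_nhds _ hκ)
  filter_upwards [h1, h2] with y h1 h2
  obtain ⟨s, u, hs, hu, -, hsu⟩ := exists_enumerations_of_dist_lt h2
  have hiff (i : ℕ) : r < dist x₀ (s i) ↔ r < dist x₀ (u i) := by
    have h3 := hgap (u i) (CountableMultiset.IsEnumeration.mem_carrier hu i)
    have h4 := dist_triangle x₀ (s i) (u i)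
    have h5 := dist_triangle x₀ (u i) (s i)
    have h6 := hsu i
    rw [dist_comm (u i)] at h5
    rcases le_abs.1 h3 with h3 | h3 <;> constructor <;> intro h7 <;> linarith
  have hA : x₀ ∉ {x | r < dist x₀ x} := by simpa using hr.le
  -- The finitely many terms outside at `y₀` stay outside. By the gap, matched points lie on the
  -- same side of the sphere, so the number of terms outside is unchanged and no further term can
  -- cross.
  have hcard : {i | r < dist x₀ (γ i y)}.encard = {i | r < dist x₀ (γ i y₀)}.encard := by
    refine (CountableMultiset.IsEnumeration.encard_eq (h y) hs hA).trans
      (Eq.trans ?_ (CountableMultiset.IsEnumeration.encard_eq hu (h y₀) hA))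
    exact congrArg Set.encard (Set.ext fun i => hiff i)
  have := hfin.eq_of_subset_of_encard_le (t := {i | r < dist x₀ (γ i y)}) h1 hcard.le
  intro i
  exact (Set.ext_iff.1 this i).symm

/-- All but finitely many terms of a continuous enumeration over a compact space stay close to the
base point. -/
theorem finite_exists_le_dist [CompactSpace Y] (hS : Continuous S) (hγ : ∀ i, Continuous (γ i))
    (h : ∀ y, (S y).IsEnumeration fun i => γ i y) {r : ℝ} (hr : 0 < r) :
    {i | ∃ y, r ≤ dist x₀ (γ i y)}.Finite := by
  have key : {i | ∃ y ∈ (Set.univ : Set Y), r ≤ dist x₀ (γ i y)}.Finite := by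
    refine isCompact_univ.induction_on (p := fun s => {i | ∃ y ∈ s, r ≤ dist x₀ (γ i y)}.Finite)
      (by simp) ?_ ?_ ?_
    · intro s t hst ht
      exact ht.subset fun i ⟨y, hy, hi⟩ => ⟨y, hst hy, hi⟩
    · intro s t hs ht
      refine (hs.union ht).subset ?_
      rintro i ⟨y, hy | hy, hi⟩
      exacts [Or.inl ⟨y, hy, hi⟩, Or.inr ⟨y, hy, hi⟩]
    · intro y₀ _
      obtain ⟨r', hr', κ, hκ, hgap⟩ := (S y₀).exists_gap x₀ hr
      refine ⟨_, nhdsWithin_le_nhds (eventually_lt_dist_iff hS hγ h y₀ hr'.1 hκ hgap),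
        ((h y₀).finite_le_dist hr'.1).subset ?_⟩
      rintro i ⟨y, hy, hi⟩
      exact ((hy i).1 (hr'.2.trans_le hi)).le
  simpa using key

/-- For a regular norm the tails of a continuous enumeration over a compact space are uniformly
small. -/
theorem exists_tail_le [CompactSpace Y] (hΦ : Φ.IsRegular) (hS : Continuous S)
    (hγ : ∀ i, Continuous (γ i)) (h : ∀ y, (S y).IsEnumeration fun i => γ i y) {ε : ℝ}
    (hε : 0 < ε) :
    ∃ n, ∀ y, (Φ.ext fun i => dist x₀ (γ (n + i) y)) ≤ ENNReal.ofReal ε := by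
  have key : ∃ n, ∀ y ∈ (Set.univ : Set Y),
      (Φ.ext fun i => dist x₀ (γ (n + i) y)) ≤ ENNReal.ofReal ε := by
    refine isCompact_univ.induction_on
      (p := fun s => ∃ n, ∀ y ∈ s, (Φ.ext fun i => dist x₀ (γ (n + i) y)) ≤ ENNReal.ofReal ε)
      ⟨0, by simp⟩ ?_ ?_ ?_
    · rintro s t hst ⟨n, hn⟩
      exact ⟨n, fun y hy => hn y (hst hy)⟩
    · rintro s t ⟨m, hm⟩ ⟨n, hn⟩
      refine ⟨max m n, fun y hy => ?_⟩
      rcases hy with hy | hy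
      · exact (Φ.ext_tail_antitone (fun i => dist x₀ (γ i y)) (le_max_left m n)).trans (hm y hy)
      · exact (Φ.ext_tail_antitone (fun i => dist x₀ (γ i y)) (le_max_right m n)).trans (hn y hy)
    · intro y₀ _
      have hε3 : 0 < ε / 3 := by positivity
      -- The thirds of `ε` go to the distance of the multisets, to the first `n` terms, each at most
      -- `r`, and to the tail at `y₀`. The bound on `r` makes `n * r` at most `ε / 3`.
      obtain ⟨n, hn⟩ := ((hΦ _ (h y₀).isSummable).eventually_lt_const
        (ENNReal.ofReal_pos.2 hε3)).exists
      obtain ⟨r, ⟨hr, hrn⟩, κ, hκ, hgap⟩ := (S y₀).exists_gap x₀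
        (show 0 < ε / 3 / (n + 1) by positivity)
      have hκ' : 0 < min κ (ε / 3) := lt_min hκ hε3
      have hfin := (h y₀).finite_le_dist hr
      obtain ⟨N, hN⟩ := hfin.bddAbove
      refine ⟨_, nhdsWithin_le_nhds ((eventually_lt_dist_iff hS hγ h y₀ hr hκ hgap).and
        (hS.continuousAt.eventually (Metric.ball_mem_nhds _ hκ'))), N + 1, ?_⟩
      rintro y ⟨h1, h2⟩
      obtain ⟨s, u, hs, hu, hext, hsu⟩ := exists_enumerations_of_dist_lt (show dist (S y) (S y₀) < _ from h2)
      -- `ψ` discards the points outside the sphere, and no term with index beyond `N` lies there.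
      -- The `Φ`-size of `ψ` depends on the multiset alone, which allows a comparison through `s`
      -- and `u`, whose order is unrelated to `γ`.
      let ψ : X → ℝ := fun x => if r < dist x₀ x then 0 else dist x₀ x
      have hψ : ψ x₀ = 0 := by simp [ψ]
      have hψ0 (x : X) : 0 ≤ ψ x := by simp only [ψ]; split_ifs; exacts [le_rfl, dist_nonneg]
      calc (Φ.ext fun i => dist x₀ (γ (N + 1 + i) y))
          ≤ Φ.ext fun i => ψ (γ i y) := by
            refine Φ.ext_le_of_injOn (fun i => N + 1 + i) (fun i _ j _ hij => by simpa using hij) ?_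
            intro i _
            have : ¬ r < dist x₀ (γ (N + 1 + i) y) := by
              rw [h1]
              intro hlt
              have := hN (Set.mem_ofPred_eq ▸ hlt.le : N + 1 + i ∈ {i | r ≤ dist x₀ (γ i y₀)})
              omega
            simp [ψ, this]
        _ ≤ Φ.ext fun i => ψ (s i) := CountableMultiset.IsEnumeration.ext_comp_le Φ (h y) hs ψ hψ
        _ ≤ Φ.ext fun i => dist (s i) (u i) + ψ (u i) := by
            refine Φ.ext_mono fun i => ?_
            rw [abs_of_nonneg (hψ0 _), abs_of_nonneg (add_nonneg dist_nonneg (hψ0 _))]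
            -- The gap puts `s i` and `u i` on the same side of the sphere, so `ψ` changes by at
            -- most their distance.
            have h3 := hgap (u i) (CountableMultiset.IsEnumeration.mem_carrier hu i)
            have h4 := dist_triangle x₀ (s i) (u i)
            have h5 := dist_triangle x₀ (u i) (s i)
            have h6 := (hsu i).trans_le (min_le_left _ _)
            have h7 := dist_nonneg (x := s i) (y := u i)
            rw [dist_comm (u i)] at h5
            simp only [ψ]
            rcases le_abs.1 h3 with h3 | h3 <;> split_ifs <;> linarith
        _ ≤ ENNReal.ofReal (ε / 3) + Φ.ext fun i => ψ (γ i y₀) :=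
            (Φ.ext_add_le _ _).trans (add_le_add
              (hext.le.trans (ENNReal.ofReal_le_ofReal (min_le_right _ _)))
              (CountableMultiset.IsEnumeration.ext_comp_le Φ hu (h y₀) ψ hψ))
        _ ≤ ENNReal.ofReal (ε / 3) + (ENNReal.ofReal (n * r) + Φ.ext fun i => ψ (γ (n + i) y₀)) := by
            refine add_le_add le_rfl (Φ.ext_le_initial_add_tail fun i _ => ?_)
            rw [abs_of_nonneg (hψ0 _)]
            simp only [ψ]
            split_ifs
            exacts [hr.le, by linarith]
        _ ≤ ENNReal.ofReal (ε / 3) + (ENNReal.ofReal (ε / 3) + ENNReal.ofReal (ε / 3)) := by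
            refine add_le_add le_rfl (add_le_add (ENNReal.ofReal_le_ofReal ?_) (le_trans ?_ hn.le))
            · rw [lt_div_iff₀ (by positivity)] at hrn
              nlinarith
            · refine Φ.ext_mono fun i => ?_
              rw [abs_of_nonneg (hψ0 _), abs_of_nonneg dist_nonneg]
              simp only [ψ]
              split_ifs
              exacts [dist_nonneg, le_rfl]
        _ = ENNReal.ofReal ε := by
            rw [← ENNReal.ofReal_add hε3.le hε3.le, ← ENNReal.ofReal_add hε3.le (by positivity)]
            congr 1
            ring
  simpa using key

end SummableMultiset

/-! ### Matched enumerations at finitely many times -/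

namespace SummableMultiset

variable {X : Type u} [MetricSpace X] {Φ : SymmetricNorm} {x₀ : X}

/-- Two elements of a finite set with no element of the set strictly between them. -/
def IsStep (D : Finset unitInterval) (t t' : unitInterval) : Prop :=
  t ∈ D ∧ t' ∈ D ∧ t < t' ∧ ∀ u ∈ D, ¬ (t < u ∧ u < t')

/-- Along finitely many times a family of multisets has enumerations that are close at consecutive
times. -/
theorem exists_matched_enumerations (S : unitInterval → SummableMultiset Φ x₀)
    (D : Finset unitInterval) {η : ℝ} (hη : 0 < η) :
    ∃ s : unitInterval → ℕ → X, (∀ t ∈ D, (S t).IsEnumeration (s t)) ∧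
      ∀ t t', IsStep D t t' → ∀ i, dist (s t i) (s t' i) < dist (S t) (S t') + η := by
  -- Infinitely many base points are carried along, so that the next multiset can be matched with
  -- the enumeration already chosen. Times are added in increasing order; the only new step starts
  -- at the previous maximum.
  suffices h : ∃ s : unitInterval → ℕ → X, (∀ t ∈ D, (S t).IsEnumeration (s t)) ∧
      (∀ t ∈ D, {i | s t i = x₀}.Infinite) ∧
      ∀ t t', IsStep D t t' → ∀ i, dist (s t i) (s t' i) < dist (S t) (S t') + η by
    obtain ⟨s, h1, -, h2⟩ := h
    exact ⟨s, h1, h2⟩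
  induction D using Finset.induction_on_max with
  | empty => exact ⟨fun _ _ => x₀, by simp, by simp, fun t t' h => absurd h.1 (by simp)⟩
  | insert a D hD ih =>
    obtain ⟨s, h1, h2, h3⟩ := ih
    have haD : a ∉ D := fun h => lt_irrefl a (hD a h)
    have key : ∃ v, (S a).IsEnumeration v ∧ {i | v i = x₀}.Infinite ∧
        ∀ t, IsStep (insert a D) t a → ∀ i, dist (s t i) (v i) < dist (S t) (S a) + η := by
      rcases D.eq_empty_or_nonempty with rfl | hne
      · obtain ⟨u, hu, -⟩ := (S a).2
        refine ⟨CountableMultiset.pad x₀ u, CountableMultiset.IsEnumeration.pad hu,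
          CountableMultiset.infinite_pad u, fun t ht => ?_⟩
        have : t = a := by simpa using ht.1
        exact absurd ht.2.2.1 (by simp [this])
      · have hb := D.max'_mem hne
        obtain ⟨v, hv1, hv2, hv3⟩ := exists_enumeration_close
          (show dist (S (D.max' hne)) (S a) < dist (S (D.max' hne)) (S a) + η by linarith)
          (h1 _ hb) (h2 _ hb)
        refine ⟨v, hv1, hv2, fun t ht => ?_⟩
        have htD : t ∈ D := (Finset.mem_insert.1 ht.1).resolve_left ht.2.2.1.ne
        have : t = D.max' hne := by
          refine le_antisymm (D.le_max' t htD) (not_lt.1 fun h => ?_)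
          exact ht.2.2.2 _ (Finset.mem_insert_of_mem hb) ⟨h, hD _ hb⟩
        rw [this]
        exact hv3
    obtain ⟨v, hv1, hv2, hv3⟩ := key
    have hne {t : unitInterval} (ht : t ∈ D) : t ≠ a := fun h => haD (h ▸ ht)
    refine ⟨Function.update s a v, ?_, ?_, ?_⟩
    · intro t ht
      rcases Finset.mem_insert.1 ht with rfl | ht
      · simpa using hv1
      · simpa [hne ht] using h1 t ht
    · intro t ht
      rcases Finset.mem_insert.1 ht with rfl | ht
      · simpa using hv2
      · simpa [hne ht] using h2 t ht
    · intro t t' h i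
      rcases Finset.mem_insert.1 h.2.1 with rfl | ht'
      · rw [Function.update_self, Function.update_of_ne h.2.2.1.ne]
        exact hv3 t h i
      · have hta : t ≠ a := (h.2.2.1.trans (hD _ ht')).ne
        have htD : t ∈ D := (Finset.mem_insert.1 h.1).resolve_left hta
        rw [Function.update_of_ne hta, Function.update_of_ne (hne ht')]
        exact h3 t t' ⟨htD, ht', h.2.2.1, fun u hu => h.2.2.2 u (Finset.mem_insert_of_mem hu)⟩ i

/-- A discrete selection of points with small steps moves little in a short time. -/
theorem exists_modulus {S : unitInterval → SummableMultiset Φ x₀} (hS : Continuous S)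
    (t₀ : unitInterval) {ε : ℝ} (hε : 0 < ε) : ∃ δ > 0, ∃ κ > 0, ∀ (D : Finset unitInterval)
      (g : unitInterval → X), (∀ t ∈ D, g t ∈ (S t).1.carrier) →
      (∀ t t', IsStep D t t' → dist (g t) (g t') < κ) →
      ∀ t₁ ∈ D, ∀ t₂ ∈ D, dist t₁ t₀ < δ → dist t₂ t₀ < δ → dist (g t₁) (g t₂) ≤ ε := by
  have hA : (insert x₀ {z ∈ (S t₀).1.carrier | ε / 8 ≤ dist x₀ z}).Finite :=
    ((S t₀).finite_carrier_dist (by positivity)).insert x₀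
  have hev : ∀ᶠ κ : ℝ in 𝓝[>] 0, ∀ p ∈ insert x₀ {z ∈ (S t₀).1.carrier | ε / 8 ≤ dist x₀ z},
      ∃ r ∈ Set.Ioo (ε / 4) (ε / 2), ∀ z ∈ (S t₀).1.carrier, 4 * κ ≤ |dist p z - r| := by
    rw [Filter.eventually_all_finite hA]
    intro p _
    obtain ⟨r, hr, κ, hκ, h⟩ := (S t₀).exists_gap p (show ε / 4 < ε / 2 by linarith)
    filter_upwards [Ioo_mem_nhdsGT (show 0 < κ / 4 by positivity)] with κ' hκ'
    exact ⟨r, hr, fun z hz => le_trans (by linarith [hκ'.2]) (h z hz)⟩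
  obtain ⟨κ, hκ, hκ8⟩ := (hev.and (Ioo_mem_nhdsGT (show 0 < ε / 8 by positivity))).exists
  obtain ⟨hκ0, hκ8⟩ := hκ8
  obtain ⟨δ, hδ, hSδ⟩ := Metric.continuousAt_iff.1 hS.continuousAt κ hκ0
  refine ⟨δ, hδ, κ, hκ0, ?_⟩
  intro D g hg hstep
  have main : ∀ t₁ ∈ D, ∀ t₂ ∈ D, t₁ ≤ t₂ → dist t₁ t₀ < δ → dist t₂ t₀ < δ →
      dist (g t₁) (g t₂) ≤ ε := by
    intro t₁ h₁ t₂ h₂ h₁₂ hd₁ hd₂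
    have hnear : ∀ τ ∈ D, t₁ ≤ τ → τ ≤ t₂ → ∃ z ∈ (S t₀).1.carrier, dist (g τ) z < κ := by
      intro τ hτ hτ₁ hτ₂
      refine exists_mem_carrier_dist_lt (hSδ ?_) (hg τ hτ)
      rw [Subtype.dist_eq, Real.dist_eq, abs_lt] at hd₁ hd₂ ⊢
      have h1 : (t₁ : ℝ) ≤ τ := hτ₁
      have h2 : (τ : ℝ) ≤ t₂ := hτ₂
      constructor <;> linarith [hd₁.1, hd₂.2]
    obtain ⟨p, hp, hgp⟩ : ∃ p ∈ insert x₀ {z ∈ (S t₀).1.carrier | ε / 8 ≤ dist x₀ z},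
        dist p (g t₁) < ε / 4 := by
      obtain ⟨z, hz, hz'⟩ := hnear t₁ h₁ le_rfl h₁₂
      by_cases h : ε / 8 ≤ dist x₀ z
      · exact ⟨z, Or.inr ⟨hz, h⟩, by rw [dist_comm]; linarith⟩
      · refine ⟨x₀, Or.inl rfl, ?_⟩
        have := dist_triangle_right x₀ (g t₁) z
        linarith
    obtain ⟨r, hr, hgap⟩ := hκ p hp
    have hgap' : ∀ τ ∈ D, t₁ ≤ τ → τ ≤ t₂ →
        dist p (g τ) ≤ r - 3 * κ ∨ r + 3 * κ ≤ dist p (g τ) := by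
      intro τ hτ hτ₁ hτ₂
      obtain ⟨z, hz, hz'⟩ := hnear τ hτ hτ₁ hτ₂
      have h1 := dist_triangle p (g τ) z
      have h2 := dist_triangle_right p (g τ) z
      rcases le_abs.1 (hgap z hz) with h | h
      · right; linarith
      · left; linarith
    -- To leave the ball of radius `r` around `p`, a step shorter than `κ` would have to cross a
    -- shell of width `6 * κ` without values of `g`. Here `τ` is the first time outside and the
    -- maximum of `C` the time just before it.
    have hlt : dist p (g t₂) < r := by
      by_contra! hcon
      let B := D.filter fun τ => t₁ ≤ τ ∧ τ ≤ t₂ ∧ r ≤ dist p (g τ)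
      have hB : B.Nonempty := ⟨t₂, Finset.mem_filter.2 ⟨h₂, h₁₂, le_rfl, hcon⟩⟩
      obtain ⟨hτD, hτ₁, hτ₂, hτr⟩ := Finset.mem_filter.1 (B.min'_mem hB)
      set τ := B.min' hB with hτ
      have hlt : t₁ < τ := by
        refine lt_of_le_of_ne hτ₁ fun h => ?_
        rw [← h] at hτr
        linarith [hr.1]
      let C := D.filter fun σ => t₁ ≤ σ ∧ σ < τ
      have hC : C.Nonempty := ⟨t₁, Finset.mem_filter.2 ⟨h₁, le_rfl, hlt⟩⟩
      obtain ⟨hσD, hσ₁, hσ₂⟩ := Finset.mem_filter.1 (C.max'_mem hC)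
      have hst : IsStep D (C.max' hC) τ := by
        refine ⟨hσD, hτD, hσ₂, fun u hu h => ?_⟩
        exact absurd (C.le_max' u (Finset.mem_filter.2 ⟨hu, hσ₁.trans h.1.le, h.2⟩)) (not_le.2 h.1)
      have hσr : dist p (g (C.max' hC)) < r := by
        by_contra! h
        have := B.min'_le _ (Finset.mem_filter.2 ⟨hσD, hσ₁, hσ₂.le.trans hτ₂, h⟩)
        exact absurd hσ₂ (not_lt.2 this)
      have h1 := (hgap' _ hσD hσ₁ (hσ₂.le.trans hτ₂)).resolve_right (by linarith)
      have h2 := (hgap' _ hτD hτ₁ hτ₂).resolve_left (by linarith)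
      have h3 := hstep _ _ hst
      have h4 := dist_triangle p (g (C.max' hC)) (g τ)
      linarith
    have := dist_triangle_left (g t₁) (g t₂) p
    linarith [hr.2]
  intro t₁ h₁ t₂ h₂ hd₁ hd₂
  rcases le_total t₁ t₂ with h | h
  · exact main t₁ h₁ t₂ h₂ h hd₁ hd₂
  · rw [dist_comm]
    exact main t₂ h₂ t₁ h₁ h hd₂ hd₁

/-- Points other than the base point are isolated in the carrier. -/
theorem eventually_eq_of_mem_carrier (S : SummableMultiset Φ x₀) {x : X} (hx : x ≠ x₀) :
    ∀ᶠ z in 𝓝 x, z ∈ S.1.carrier → z = x := by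
  have hd : 0 < dist x₀ x := dist_pos.2 hx.symm
  have hfin := (S.finite_carrier_dist (half_pos hd)).subset
    (Set.sdiff_subset (t := {x}))
  have h1 : ∀ᶠ z in 𝓝 x, z ∉ {z ∈ S.1.carrier | dist x₀ x / 2 ≤ dist x₀ z} \ {x} :=
    hfin.isClosed.isOpen_compl.mem_nhds (by simp)
  have h2 : ∀ᶠ z in 𝓝 x, dist x₀ x / 2 < dist x₀ z :=
    (continuous_const.dist continuous_id).continuousAt.eventually_const_lt (half_lt_self hd)
  filter_upwards [h1, h2] with z h1 h2 hz
  by_contra hne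
  exact h1 ⟨⟨hz, h2.le⟩, hne⟩

/-- For fine finite sets of times the steps of matched enumerations are small. -/
theorem eventually_step_lt {S : unitInterval → SummableMultiset Φ x₀} (hS : Continuous S)
    {κ : ℝ} (hκ : 0 < κ) : ∀ᶠ j : Finset unitInterval × ℕ in atTop,
      ∀ t t', IsStep j.1 t t' → dist (S t) (S t') + 1 / ((j.2 : ℝ) + 1) < κ := by
  classical
  obtain ⟨δ, hδ, h⟩ := Metric.uniformContinuous_iff.1
    (CompactSpace.uniformContinuous_of_continuous hS) (κ / 2) (half_pos hκ)
  obtain ⟨G, -, hGfin, hG⟩ := finite_cover_balls_of_compact (isCompact_univ (X := unitInterval))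
    (half_pos hδ)
  obtain ⟨N, hN⟩ := exists_nat_one_div_lt (half_pos hκ)
  filter_upwards [eventually_ge_atTop (hGfin.toFinset, N)] with j hj t t' hst
  -- The net `G` has a point within `δ / 2` of the midpoint of `t` and `t'`; if these were `δ` apart
  -- it would lie strictly between them.
  have h1 : dist t t' < δ := by
    by_contra! hcon
    have htt : (t : ℝ) < t' := hst.2.2.1
    rw [Subtype.dist_eq, Real.dist_eq, abs_sub_comm, abs_of_pos (by linarith)] at hcon
    have hm : ((t : ℝ) + t') / 2 ∈ unitInterval :=
      ⟨by linarith [t.2.1, t'.2.1], by linarith [t.2.2, t'.2.2]⟩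
    obtain ⟨g, hgG, hg⟩ := Set.mem_iUnion₂.1 (hG (Set.mem_univ ⟨_, hm⟩))
    rw [Metric.mem_ball, Subtype.dist_eq, Real.dist_eq, abs_lt] at hg
    refine hst.2.2.2 g (hj.1 (hGfin.mem_toFinset.2 hgG)) ⟨?_, ?_⟩
    · change (t : ℝ) < g
      linarith [hg.1, hg.2]
    · change (g : ℝ) < t'
      linarith [hg.1, hg.2]
  have h2 := h h1
  have h3 : 1 / ((j.2 : ℝ) + 1) ≤ 1 / ((N : ℝ) + 1) := by
    have : (N : ℝ) ≤ j.2 := Nat.cast_le.2 hj.2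
    gcongr
  linarith

end SummableMultiset

/-! ### Existence of continuous enumerations -/

namespace SummableMultiset

variable {X : Type u} [MetricSpace X] {Φ : SymmetricNorm} {x₀ : X}

/-- Every path in the space of summable multisets has a continuous enumeration. -/
theorem exists_continuous_enumeration {S : unitInterval → SummableMultiset Φ x₀}
    (hS : Continuous S) :
    ∃ γ : ℕ → C(unitInterval, X), ∀ t, (S t).IsEnumeration fun i => γ i t := by
  classical
  -- An index is a finite set of times with a precision. Along the ultrafilter each time eventually
  -- belongs to the finite set, so one limit serves all times.
  let J := Finset unitInterval × ℕ
  let 𝒰 : Ultrafilter J := Ultrafilter.of atTop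
  have h𝒰 : (𝒰 : Filter J) ≤ atTop := Ultrafilter.of_le atTop
  have hmem (t : unitInterval) : ∀ᶠ j in (𝒰 : Filter J), t ∈ j.1 := by
    filter_upwards [h𝒰 (eventually_ge_atTop ({t}, 0))] with j hj
    exact hj.1 (Finset.mem_singleton_self t)
  choose s hs hstep using fun j : J => exists_matched_enumerations S j.1
    (η := 1 / ((j.2 : ℝ) + 1)) (by positivity)
  -- A choice `f` of one index in every matching selects points at time `t`; by compactness of the
  -- carrier they converge, and `f` traces a curve.
  have hlim : ∀ (f : J → ℕ) (t : unitInterval), ∃ x ∈ (S t).1.carrier,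
      Tendsto (fun j => s j t (f j)) 𝒰 (𝓝 x) := by
    intro f t
    refine (S t).isCompact_carrier.ultrafilter_le_nhds (𝒰.map fun j => s j t (f j)) ?_
    rw [le_principal_iff]
    change ∀ᶠ j in (𝒰 : Filter J), s j t (f j) ∈ (S t).1.carrier
    filter_upwards [hmem t] with j hj
    exact CountableMultiset.IsEnumeration.mem_carrier (hs j t hj) _
  choose c hcS hc using hlim
  have hcont (f : J → ℕ) : Continuous (c f) := by
    rw [continuous_iff_continuousAt]
    intro t₀
    rw [Metric.continuousAt_iff]
    intro ε hε
    -- The modulus does not depend on the finite set of times, hence survives the limit.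
    obtain ⟨δ, hδ, κ, hκ, h⟩ := exists_modulus hS t₀ (half_pos hε)
    refine ⟨δ, hδ, fun {t} ht => ?_⟩
    refine lt_of_le_of_lt (le_of_tendsto ((hc f t).dist (hc f t₀)) ?_) (half_lt_self hε)
    filter_upwards [hmem t, hmem t₀, h𝒰 (eventually_step_lt hS hκ)] with j h1 h2 h3
    refine h j.1 (fun u => s j u (f j))
      (fun u hu => CountableMultiset.IsEnumeration.mem_carrier (hs j u hu) _)
      (fun u u' huu => (hstep j u u' huu _).trans (h3 u u' huu)) t h1 t₀ h2 ht ?_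
    rwa [dist_self]
  -- Choices that agree along the ultrafilter give the same curve, whereas distinct indices persist
  -- as distinct germs; counting curves by germs therefore keeps multiplicities.
  let 𝔾 := Germ (𝒰 : Filter J) ℕ
  let r : 𝔾 → J → ℕ := fun q => Quotient.out q
  have hr (q : 𝔾) : ((r q : J → ℕ) : 𝔾) = q := Quotient.out_eq q
  let cg : 𝔾 → C(unitInterval, X) := fun q => ⟨c (r q), hcont _⟩
  have hcg (f : J → ℕ) (t : unitInterval) (x : X) (hx : ∀ᶠ j in (𝒰 : Filter J), s j t (f j) = x) :
      cg (f : 𝔾) t = x := by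
    have hrf : r (f : 𝔾) =ᶠ[(𝒰 : Filter J)] f := Germ.coe_eq.1 (hr (f : 𝔾))
    refine tendsto_nhds_unique (hc (r (f : 𝔾)) t) (tendsto_const_nhds.congr' ?_)
    filter_upwards [hrf, hx] with j h1 h2
    rw [h1, h2]
  have hcount (t : unitInterval) (x : X) (hx : x ≠ x₀) :
      {q : 𝔾 | cg q t = x}.encard = (S t).1.mult x := by
    obtain ⟨m, hm⟩ := ENat.ne_top_iff_exists.1 ((S t).1.mult_ne_top x hx)
    have he : ∀ j : J, ∃ e : Fin m → ℕ, t ∈ j.1 → Function.Injective e ∧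
        Set.range e = {i | s j t i = x} := by
      intro j
      by_cases hj : t ∈ j.1
      · have hcard : {i | s j t i = x}.encard = m := (hs j t hj x hx).trans hm.symm
        have hfin := Set.finite_of_encard_eq_coe hcard
        have := hfin.fintype
        have hcard' : Fintype.card {i | s j t i = x} = m := by
          rw [Set.encard_eq_coe_toFinset_card, Set.toFinset_card] at hcard
          exact_mod_cast hcard
        let e := (Fintype.equivFinOfCardEq hcard').symm
        refine ⟨fun k => e k, fun _ => ⟨Subtype.val_injective.comp e.injective, ?_⟩⟩
        change Set.range (Subtype.val ∘ e) = _
        rw [e.surjective.range_comp, Subtype.range_coe]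
      · exact ⟨fun _ => 0, fun h => absurd h hj⟩
    choose e he using he
    let E : Fin m → 𝔾 := fun k => ((fun j => e j k : J → ℕ) : 𝔾)
    have hE : Function.Injective E := by
      intro k k' hkk
      obtain ⟨j, h1, h2⟩ := ((Germ.coe_eq.1 hkk).and (hmem t)).exists
      exact (he j h2).1 h1
    -- As `x` is isolated in the carrier, a curve through `x` comes from indices whose value is
    -- eventually exactly `x`. There are `m` such indices for each `j`, and the ultrafilter settles
    -- on one.
    have hrange : {q : 𝔾 | cg q t = x} = Set.range E := by
      ext q
      constructor
      · intro hq
        have h1 : Tendsto (fun j => s j t (r q j)) 𝒰 (𝓝 x) := by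
          rw [← show c (r q) t = x from hq]
          exact hc (r q) t
        have h2 : ∀ᶠ j in (𝒰 : Filter J), ∃ k, e j k = r q j := by
          filter_upwards [h1.eventually ((S t).eventually_eq_of_mem_carrier hx), hmem t] with j h1 h2
          have h3 : r q j ∈ {i | s j t i = x} :=
            h1 (CountableMultiset.IsEnumeration.mem_carrier (hs j t h2) _)
          rw [← (he j h2).2] at h3
          exact h3
        rw [Ultrafilter.eventually_exists_iff] at h2
        obtain ⟨k, hk⟩ := h2
        refine ⟨k, ?_⟩
        rw [← hr q]
        exact Germ.coe_eq.2 hk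
      · rintro ⟨k, rfl⟩
        refine hcg _ t x ?_
        filter_upwards [hmem t] with j hj
        have : e j k ∈ {i | s j t i = x} := (he j hj).2 ▸ Set.mem_range_self k
        exact this
    rw [hrange, ← Set.image_univ, hE.encard_image, Set.encard_univ, ← hm]
    simp
  -- A curve that leaves `x₀` is away from it at some time of a countable dense set, and at such a
  -- time finitely many curves pass through each of countably many points. The remaining curves are
  -- constant and need no index.
  have hN : {q : 𝔾 | ∃ t, cg q t ≠ x₀}.Countable := by
    refine Set.Countable.mono ?_ (Set.countable_iUnion fun n : ℕ =>
      Set.Countable.biUnion ((S (TopologicalSpace.denseSeq unitInterval n)).1.countable_support.mono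
        (Set.sdiff_subset (t := {x₀}))) (t := fun x _ =>
          {q : 𝔾 | cg q (TopologicalSpace.denseSeq unitInterval n) = x}) ?_)
    · rintro q ⟨t, ht⟩
      obtain ⟨n, hu⟩ := (TopologicalSpace.denseRange_denseSeq unitInterval).exists_mem_open
        (isOpen_ne.preimage (cg q).continuous) ⟨t, ht⟩
      exact Set.mem_iUnion.2 ⟨n, Set.mem_iUnion₂.2 ⟨_, ⟨hcS _ _, hu⟩, rfl⟩⟩
    · intro x hx
      refine (Set.encard_lt_top_iff.1 ?_).countable
      rw [hcount _ x hx.2]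
      exact lt_top_iff_ne_top.2 (CountableMultiset.mult_ne_top _ x hx.2)
  have := hN.to_subtype
  obtain ⟨ι, hι⟩ := Countable.exists_injective_nat {q : 𝔾 | ∃ t, cg q t ≠ x₀}
  refine ⟨Function.extend ι (fun q => cg q) fun _ => ContinuousMap.const _ x₀, fun t x hx => ?_⟩
  rw [← hcount t x hx]
  have h1 : {i | Function.extend ι (fun q => cg q) (fun _ => ContinuousMap.const _ x₀) i t = x} =
      ι '' {q | cg q t = x} := by
    ext i
    constructor
    · intro hi
      by_cases h : ∃ q, ι q = i
      · obtain ⟨q, rfl⟩ := h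
        rw [Set.mem_ofPred_eq, hι.extend_apply] at hi
        exact ⟨q, hi, rfl⟩
      · rw [Set.mem_ofPred_eq, Function.extend_apply' _ _ _ h] at hi
        exact absurd hi.symm hx
    · rintro ⟨q, hq, rfl⟩
      rw [Set.mem_ofPred_eq, hι.extend_apply]
      exact hq
  have h2 : {q : 𝔾 | cg q t = x} =
      Subtype.val '' {q : {q : 𝔾 | ∃ t, cg q t ≠ x₀} | cg q t = x} := by
    ext q
    constructor
    · intro hq
      exact ⟨⟨q, t, fun h => hx ((show cg q t = x from hq).symm.trans h)⟩, hq, rfl⟩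
    · rintro ⟨q, hq, rfl⟩
      exact hq
  rw [h1, h2, hι.encard_image, Subtype.val_injective.encard_image]

end SummableMultiset

/-! ### Path classes corrected at the end points -/

section Normalized

variable {X : Type u} [TopologicalSpace X]

/-- The class of a path, normalized at its end points by a function on points. -/
noncomputable def normalizedClass (Θ : X → chainClasses X) (γ : C(unitInterval, X)) :
    chainClasses X :=
  Θ (γ 0) + pathClass γ - Θ (γ 1)

theorem segmentPath_zero {E : Type*} [AddCommGroup E] [Module ℝ E] [TopologicalSpace E]
    [IsTopologicalAddGroup E] [ContinuousSMul ℝ E] (f : C(E, X)) (p q : E) :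
    segmentPath f p q 0 = f p := by
  simp [segmentPath]

theorem segmentPath_one {E : Type*} [AddCommGroup E] [Module ℝ E] [TopologicalSpace E]
    [IsTopologicalAddGroup E] [ContinuousSMul ℝ E] (f : C(E, X)) (p q : E) :
    segmentPath f p q 1 = f q := by
  simp [segmentPath]

/-- The corrections at `q` cancel, so additivity along triangles persists. -/
theorem normalizedClass_segment {E : Type*} [AddCommGroup E] [Module ℝ E] [TopologicalSpace E]
    [IsTopologicalAddGroup E] [ContinuousSMul ℝ E] (Θ : X → chainClasses X) (f : C(E, X))
    (p q r : E) :
    normalizedClass Θ (segmentPath f p q) + normalizedClass Θ (segmentPath f q r) =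
      normalizedClass Θ (segmentPath f p r) := by
  simp only [normalizedClass, ← pathClass_segment f p q r]
  simp only [segmentPath_zero, segmentPath_one]
  abel

theorem normalizedClass_const (Θ : X → chainClasses X) (x : X) :
    normalizedClass Θ (ContinuousMap.const _ x) = 0 := by
  simp [normalizedClass, pathClass_const]

theorem IsSimplyConnected.homotopic {V : Set X} (hV : IsSimplyConnected V) {x y : X} (p q : Path x y)
    (hp : ∀ t, p t ∈ V) (hq : ∀ t, q t ∈ V) : p.Homotopic q := by
  have := hV.simplyConnectedSpace
  have hx : x ∈ V := p.source ▸ hp 0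
  have hy : y ∈ V := p.target ▸ hp 1
  let p' : Path (⟨x, hx⟩ : V) ⟨y, hy⟩ :=
    ⟨⟨fun t => ⟨p t, hp t⟩, by fun_prop⟩, by simp, by simp⟩
  let q' : Path (⟨x, hx⟩ : V) ⟨y, hy⟩ :=
    ⟨⟨fun t => ⟨q t, hq t⟩, by fun_prop⟩, by simp, by simp⟩
  exact (SimplyConnectedSpace.paths_homotopic p' q').map ⟨Subtype.val, continuous_subtype_val⟩

/-- In a simply connected set the class of a path is the difference of the values of a potential at
its end points. -/
theorem IsSimplyConnected.exists_potential {V : Set X} (hV : IsSimplyConnected V) {z : X}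
    (hz : z ∈ V) : ∃ f : X → chainClasses X, ∀ γ : C(unitInterval, X), (∀ t, γ t ∈ V) → pathClass γ = f (γ 1) - f (γ 0) := by
  classical
  let f : X → chainClasses X := fun y =>
    if h : JoinedIn V z y then pathClass h.somePath.toContinuousMap else 0
  have h1 : ∀ y (p : Path z y), (∀ t, p t ∈ V) → f y = pathClass p.toContinuousMap := by
    intro y p hp
    have h : JoinedIn V z y := ⟨p, hp⟩
    simp only [f, dif_pos h]
    exact pathClass_homotopic (hV.homotopic _ _ h.somePath_mem hp)
  refine ⟨f, ?_⟩
  intro γ hγ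
  have h0 := hV.isPathConnected.joinedIn z hz (γ 0) (hγ 0)
  rw [h1 _ h0.somePath h0.somePath_mem, h1 _ (h0.somePath.trans (asPath γ)) ?_, pathClass_trans]
  · exact (add_sub_cancel_left _ _).symm
  · intro t
    rw [Path.trans_apply]
    split_ifs
    exacts [h0.somePath_mem _, hγ _]

end Normalized

/-! ### Local potentials on the space of multisets -/

namespace SummableMultiset

variable {X : Type u} [MetricSpace X] {Φ : SymmetricNorm} {x₀ : X}

/-- The sum of the normalized classes of the terms of an enumeration of a path locally depends only
on the end points of the path. -/
theorem exists_local_potential (hX : LocallySimplyConnected X) {U : Set X} (hU : U ∈ 𝓝 x₀)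
    {Θ : X → chainClasses X}
    (hΘ : ∀ γ : C(unitInterval, X), (∀ t, γ t ∈ U) → normalizedClass Θ γ = 0)
    (T : SummableMultiset Φ x₀) :
    ∃ κ > 0, ∃ F : SummableMultiset Φ x₀ → chainClasses X,
      ∀ (S : unitInterval → SummableMultiset Φ x₀), (∀ t, dist (S t) T < κ) →
        ∀ γ : ℕ → C(unitInterval, X), (∀ t, (S t).IsEnumeration fun i => γ i t) →
          ∑ᶠ i, normalizedClass Θ (γ i) = F (S 1) - F (S 0) := by
  classical
  obtain ⟨ρ, hρ, hρU⟩ := Metric.mem_nhds_iff.1 hU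
  -- A sphere in `U` that avoids `T`: beyond it lie only the finitely many points of `Z`, which
  -- receive disjoint simply connected neighbourhoods, also beyond it.
  obtain ⟨r, ⟨hr, hrρ⟩, κ₀, hκ₀, hgap⟩ := T.exists_gap x₀ hρ
  set Z := {z ∈ T.1.carrier | r ≤ dist x₀ z} with hZdef
  have hZ : Z.Finite := T.finite_carrier_dist hr
  have hZr : ∀ z ∈ Z, r + κ₀ ≤ dist x₀ z := by
    rintro z ⟨hz, hz'⟩
    have := hgap z hz
    rw [abs_of_nonneg (by linarith)] at this
    linarith
  obtain ⟨W, hW, hWdisj⟩ := hZ.t2_separation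
  choose V hVsub hVo hVmem hVsc using fun z => hX z (W z ∩ Metric.ball z (κ₀ / 2))
    (Filter.inter_mem ((hW z).2.mem_nhds (hW z).1) (Metric.ball_mem_nhds z (half_pos hκ₀)))
  have hVdisj : ∀ z ∈ Z, ∀ z' ∈ Z, ∀ y, y ∈ V z → y ∈ V z' → z = z' := by
    intro z hz z' hz' y hy hy'
    by_contra hne
    exact Set.disjoint_left.1 (hWdisj hz hz' hne) (hVsub z hy).1 (hVsub z' hy').1
  have hVr : ∀ z ∈ Z, ∀ y ∈ V z, r < dist x₀ y := by
    intro z hz y hy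
    have h1 := hZr z hz
    have h2 : dist y z < κ₀ / 2 := (hVsub z hy).2
    have := dist_triangle x₀ y z
    linarith
  obtain ⟨κ, hκ, hκ0, hκκ⟩ : ∃ κ : ℝ, (∀ z ∈ Z, Metric.ball z κ ⊆ V z) ∧ 0 < κ ∧ κ < κ₀ := by
    have hev : ∀ᶠ κ : ℝ in 𝓝[>] 0, ∀ z ∈ Z, Metric.ball z κ ⊆ V z := by
      rw [Filter.eventually_all_finite hZ]
      intro z _
      obtain ⟨δ, hδ, hb⟩ := Metric.isOpen_iff.1 (hVo z) z (hVmem z)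
      filter_upwards [Ioo_mem_nhdsGT hδ] with κ hκ
      exact (Metric.ball_subset_ball hκ.2.le).trans hb
    obtain ⟨κ, h1, h2⟩ := (hev.and (Ioo_mem_nhdsGT hκ₀)).exists
    exact ⟨κ, h1, h2.1, h2.2⟩
  have hcover : ∀ T' : SummableMultiset Φ x₀, dist T' T < κ → ∀ y ∈ T'.1.carrier,
      dist x₀ y < r ∨ ∃ z ∈ Z, y ∈ V z := by
    intro T' hT' y hy
    obtain ⟨w, hw, hyw⟩ := exists_mem_carrier_dist_lt hT' hy
    rcases le_abs.1 (hgap w hw) with h | h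
    · have hwZ : w ∈ Z := ⟨hw, by linarith⟩
      exact Or.inr ⟨w, hwZ, hκ w hwZ hyw⟩
    · left
      have := dist_triangle_right x₀ y w
      linarith
  choose f hf using fun z => (hVsc z).exists_potential (hVmem z)
  -- Near `x₀` normalized classes vanish, so zero is a potential; on `V z` it is the primitive of
  -- path classes, corrected by `Θ`.
  let φ : X → chainClasses X := fun y =>
    if h : ∃ z, z ∈ Z ∧ y ∈ V z then f h.choose y - Θ y else 0
  have hφV : ∀ z ∈ Z, ∀ y ∈ V z, φ y = f z y - Θ y := by
    intro z hz y hy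
    have h : ∃ z, z ∈ Z ∧ y ∈ V z := ⟨z, hz, hy⟩
    have hzz : h.choose = z := hVdisj _ h.choose_spec.1 _ hz y h.choose_spec.2 hy
    simp only [φ, dif_pos h]
    rw [hzz]
  have hφ0 : ∀ y, dist x₀ y ≤ r → φ y = 0 := by
    intro y hy
    refine dif_neg ?_
    rintro ⟨z, hz, hyz⟩
    exact absurd (hVr z hz y hyz) (not_lt.2 hy)
  have hpath : ∀ γ : C(unitInterval, X), (∀ t, dist x₀ (γ t) < r ∨ ∃ z ∈ Z, γ t ∈ V z) →
      normalizedClass Θ γ = φ (γ 1) - φ (γ 0) := by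
    intro γ hγ
    -- By connectedness the path stays in a single one of the disjoint open pieces.
    have hpre : IsPreconnected (Set.range γ) := isPreconnected_range γ.continuous
    rcases hγ 0 with h0 | ⟨z, hz, h0⟩
    · have hsub : Set.range γ ⊆ {y | dist x₀ y < r} := by
        refine hpre.subset_left_of_subset_union
          (v := ⋃ z ∈ Z, V z) (isOpen_lt (by fun_prop) continuous_const)
          (isOpen_biUnion fun z _ => hVo z) ?_ ?_ ⟨_, ⟨0, rfl⟩, h0⟩
        · rw [Set.disjoint_left]
          intro y hy hy'
          obtain ⟨z, hz, hyz⟩ := Set.mem_iUnion₂.1 hy'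
          exact lt_asymm (hVr z hz y hyz) hy
        · rintro _ ⟨t, rfl⟩
          rcases hγ t with h | ⟨z, hz, h⟩
          exacts [Or.inl h, Or.inr (Set.mem_biUnion hz h)]
      have hmem (t : unitInterval) : dist x₀ (γ t) < r := hsub ⟨t, rfl⟩
      rw [hφ0 _ (hmem 0).le, hφ0 _ (hmem 1).le, sub_zero]
      refine hΘ γ fun t => hρU ?_
      rw [Metric.mem_ball, dist_comm]
      exact (hmem t).trans hrρ
    · have hsub : Set.range γ ⊆ V z := by
        refine hpre.subset_left_of_subset_union
          (v := {y | dist x₀ y < r} ∪ ⋃ z' ∈ Z \ {z}, V z') (hVo z)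
          ((isOpen_lt (by fun_prop) continuous_const).union (isOpen_biUnion fun z _ => hVo z)) ?_ ?_
          ⟨_, ⟨0, rfl⟩, h0⟩
        · rw [Set.disjoint_left]
          rintro y hy (hy' | hy')
          · exact lt_asymm (hVr z hz y hy) hy'
          · obtain ⟨z', hz', hyz⟩ := Set.mem_iUnion₂.1 hy'
            exact hz'.2 (hVdisj z' hz'.1 z hz y hyz hy)
        · rintro _ ⟨t, rfl⟩
          rcases hγ t with h | ⟨z', hz', h⟩
          · exact Or.inr (Or.inl h)
          · by_cases hzz : z' = z
            · subst hzz; exact Or.inl h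
            · exact Or.inr (Or.inr (Set.mem_biUnion (x := z') ⟨hz', hzz⟩ h))
      have hmem (t : unitInterval) : γ t ∈ V z := hsub ⟨t, rfl⟩
      rw [hφV z hz _ (hmem 0), hφV z hz _ (hmem 1), normalizedClass, hf z γ hmem]
      abel
  -- `φ` vanishes on the ball of radius `r`, so the sum is finite, and it does not depend on the
  -- enumeration chosen.
  refine ⟨κ, hκ0, fun T' => ∑ᶠ i, φ (T'.2.choose i), ?_⟩
  intro S hS γ hγ
  have hval (t : unitInterval) : ∑ᶠ i, φ ((S t).2.choose i) = ∑ᶠ i, φ (γ i t) :=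
    CountableMultiset.IsEnumeration.finsum_comp_eq (S t).2.choose_spec.1 (hγ t) φ
      (hφ0 x₀ (by simpa using hr.le))
  have hsupp (t : unitInterval) : (Function.support fun i => φ (γ i t)).Finite := by
    refine ((hγ t).finite_le_dist hr).subset fun i hi => ?_
    by_contra h
    exact hi (hφ0 _ (not_le.1 h).le)
  simp only [hval]
  rw [← finsum_sub_distrib (hsupp 1) (hsupp 0)]
  exact finsum_congr fun i => hpath (γ i) fun t =>
    hcover _ (hS t) _ (CountableMultiset.IsEnumeration.mem_carrier (hγ t) i)

end SummableMultiset

/-! ### From small triangles to independence and homotopy -/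

/-- A midpoint additive antisymmetric function on pairs of points of a convex set whose sum over
small triangles vanishes has vanishing sum over all triangles. -/
theorem triangle_sum_eq_zero_of_small {E G : Type*} [NormedAddCommGroup E] [NormedSpace ℝ E]
    [AddCommGroup G] {K : Set E} (hK : Convex ℝ K) (C : E → E → G)
    (hmid : ∀ p ∈ K, ∀ q ∈ K, C p q = C p (midpoint ℝ p q) + C (midpoint ℝ p q) q)
    (hsymm : ∀ p ∈ K, ∀ q ∈ K, C q p = - C p q) {δ : ℝ} (hδ : 0 < δ)
    (hsmall : ∀ p ∈ K, ∀ q ∈ K, ∀ r ∈ K, dist p q < δ → dist q r < δ → dist p r < δ →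
      C p q + C q r = C p r)
    {p q r : E} (hp : p ∈ K) (hq : q ∈ K) (hr : r ∈ K) : C p q + C q r = C p r := by
  have key : ∀ n : ℕ, ∀ p ∈ K, ∀ q ∈ K, ∀ r ∈ K, dist p q < 2 ^ n * δ → dist q r < 2 ^ n * δ →
      dist p r < 2 ^ n * δ → C p q + C q r = C p r := by
    intro n
    induction n with
    | zero => simpa using hsmall
    | succ n ih =>
      intro p hp q hq r hr hpq hqr hpr
      have hm1 := hK.midpoint_mem hp hq
      have hm2 := hK.midpoint_mem hq hr
      have hm3 := hK.midpoint_mem hp hr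
      have hhalf {x y : ℝ} (h : x < 2 ^ (n + 1) * δ) (hy : y ≤ x / 2) : y < 2 ^ n * δ := by
        rw [pow_succ] at h
        linarith
      have d1 {a b : E} : dist a (midpoint ℝ a b) ≤ dist a b / 2 := by
        rw [dist_left_midpoint, Real.norm_ofNat]
        linarith
      have d2 {a b : E} : dist (midpoint ℝ a b) b ≤ dist a b / 2 := by
        rw [dist_midpoint_right, Real.norm_ofNat]
        linarith
      have d3 {a b c : E} : dist (midpoint ℝ a b) (midpoint ℝ a c) ≤ dist b c / 2 := by
        have := dist_midpoint_midpoint_le a b a c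
        simpa using this
      have d4 {a b c : E} : dist (midpoint ℝ a b) (midpoint ℝ c b) ≤ dist a c / 2 := by
        have := dist_midpoint_midpoint_le a b c b
        simpa using this
      have d5 {a b c : E} : dist (midpoint ℝ a b) (midpoint ℝ b c) ≤ dist a c / 2 := by
        rw [midpoint_comm b c]
        exact d4
      -- Bisected sides give four triangles of half the size; the sides of the middle one cancel
      -- against the outer three.
      have t1 := ih _ hp _ hm1 _ hm3 (hhalf hpq d1) (hhalf hqr d3) (hhalf hpr d1)
      have t2 := ih _ hm1 _ hq _ hm2 (hhalf hpq d2) (hhalf hqr d1) (hhalf hpr d5)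
      have t3 := ih _ hm3 _ hm2 _ hr (hhalf hpq d4) (hhalf hqr d2) (hhalf hpr d2)
      have t4 := ih _ hm1 _ hm2 _ hm3 (hhalf hpr d5) (hhalf hpq (by rw [dist_comm]; exact d4))
        (hhalf hqr d3)
      rw [hmid p hp q hq, hmid q hq r hr, hmid p hp r hr, ← t1, ← t3, ← t4, ← t2,
        hsymm _ hm2 _ hm3]
      abel
  obtain ⟨n, hn⟩ := pow_unbounded_of_one_lt ((dist p q + dist q r + dist p r) / δ) one_lt_two
  rw [div_lt_iff₀ hδ] at hn
  have h1 := dist_nonneg (x := p) (y := q)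
  have h2 := dist_nonneg (x := q) (y := r)
  have h3 := dist_nonneg (x := p) (y := r)
  exact key n p hp q hq r hr (by linarith) (by linarith) (by linarith)

namespace SummableMultiset

variable {X : Type u} [MetricSpace X] {Φ : SymmetricNorm} {x₀ : X}

theorem isEnumeration_extendPath {S : unitInterval → SummableMultiset Φ x₀}
    {γ : ℕ → C(unitInterval, X)} (hγ : ∀ t, (S t).IsEnumeration fun i => γ i t) (τ : ℝ) :
    (S (Set.projIcc 0 1 zero_le_one τ)).IsEnumeration fun i => extendPath (γ i) τ :=
  hγ _

theorem finite_support_normalizedClass {U : Set X} (hU : U ∈ 𝓝 x₀) {Θ : X → chainClasses X}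
    (hΘ : ∀ γ : C(unitInterval, X), (∀ t, γ t ∈ U) → normalizedClass Θ γ = 0)
    {S : unitInterval → SummableMultiset Φ x₀} (hS : Continuous S) {γ : ℕ → C(unitInterval, X)}
    (hγ : ∀ t, (S t).IsEnumeration fun i => γ i t) {δ : ℕ → C(unitInterval, X)}
    (hδ : ∀ i t, ∃ t', δ i t = γ i t') :
    (Function.support fun i => normalizedClass Θ (δ i)).Finite := by
  obtain ⟨ρ, hρ, hρU⟩ := Metric.mem_nhds_iff.1 hU
  refine (finite_exists_le_dist hS (fun i => (γ i).continuous) hγ hρ).subset fun i hi => ?_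
  by_contra hcon
  refine hi (hΘ _ fun t => hρU ?_)
  obtain ⟨t', ht'⟩ := hδ i t
  rw [ht', Metric.mem_ball, dist_comm]
  by_contra h
  exact hcon ⟨t', not_lt.1 h⟩

theorem finsum_normalizedClass_segment {U : Set X} (hU : U ∈ 𝓝 x₀) {Θ : X → chainClasses X}
    (hΘ : ∀ γ : C(unitInterval, X), (∀ t, γ t ∈ U) → normalizedClass Θ γ = 0)
    {S : unitInterval → SummableMultiset Φ x₀} (hS : Continuous S) {γ : ℕ → C(unitInterval, X)}
    (hγ : ∀ t, (S t).IsEnumeration fun i => γ i t) (a b c : ℝ) :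
    ∑ᶠ i, normalizedClass Θ (segmentPath (extendPath (γ i)) a b) +
      ∑ᶠ i, normalizedClass Θ (segmentPath (extendPath (γ i)) b c) =
        ∑ᶠ i, normalizedClass Θ (segmentPath (extendPath (γ i)) a c) := by
  have h (a b : ℝ) := finite_support_normalizedClass hU hΘ hS hγ
    (δ := fun i => segmentPath (extendPath (γ i)) a b) fun i t => ⟨_, rfl⟩
  rw [← finsum_add_distrib (h a b) (h b c)]
  exact finsum_congr fun i => normalizedClass_segment Θ _ a b c

/-- The sum of the normalized classes does not depend on the continuous enumeration of a path. -/
theorem finsum_normalizedClass_eq (hX : LocallySimplyConnected X) {U : Set X} (hU : U ∈ 𝓝 x₀)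
    {Θ : X → chainClasses X}
    (hΘ : ∀ γ : C(unitInterval, X), (∀ t, γ t ∈ U) → normalizedClass Θ γ = 0)
    {S : unitInterval → SummableMultiset Φ x₀} (hS : Continuous S) {γ δ : ℕ → C(unitInterval, X)}
    (hγ : ∀ t, (S t).IsEnumeration fun i => γ i t) (hδ : ∀ t, (S t).IsEnumeration fun i => δ i t) :
    ∑ᶠ i, normalizedClass Θ (γ i) = ∑ᶠ i, normalizedClass Θ (δ i) := by
  let A (γ : ℕ → C(unitInterval, X)) (a b : ℝ) : chainClasses X :=
    ∑ᶠ i, normalizedClass Θ (segmentPath (extendPath (γ i)) a b)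
  have hS' : Continuous fun τ : ℝ => S (Set.projIcc 0 1 zero_le_one τ) :=
    hS.comp continuous_projIcc
  -- Over a short interval both enumerations contribute the same difference of a local potential.
  -- The sums up to time `τ` thus differ by a locally constant function, which vanishes at `0`.
  have hloc : IsLocallyConstant fun τ => A γ 0 τ - A δ 0 τ := by
    rw [IsLocallyConstant.iff_eventually_eq]
    intro τ₀
    obtain ⟨κ, hκ, F, hF⟩ := exists_local_potential hX hU hΘ (S (Set.projIcc 0 1 zero_le_one τ₀))
    obtain ⟨η, hη, hηκ⟩ := Metric.continuousAt_iff.1 hS'.continuousAt κ hκ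
    filter_upwards [Metric.ball_mem_nhds τ₀ hη] with τ hτ
    have hmem (t : unitInterval) : AffineMap.lineMap τ₀ τ (t : ℝ) ∈ Metric.ball τ₀ η :=
      (convex_ball τ₀ η).lineMap_mem (Metric.mem_ball_self hη) hτ t.2
    have hA {γ : ℕ → C(unitInterval, X)} (hγ : ∀ t, (S t).IsEnumeration fun i => γ i t) :
        A γ τ₀ τ = F (S (Set.projIcc 0 1 zero_le_one τ)) - F (S (Set.projIcc 0 1 zero_le_one τ₀)) := by
      refine (hF (fun t => S (Set.projIcc 0 1 zero_le_one (AffineMap.lineMap τ₀ τ (t : ℝ))))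
        (fun t => hηκ (hmem t)) (fun i => segmentPath (extendPath (γ i)) τ₀ τ)
        (fun t => isEnumeration_extendPath hγ _)).trans ?_
      simp
    have h1 := finsum_normalizedClass_segment hU hΘ hS hγ 0 τ₀ τ
    have h2 := finsum_normalizedClass_segment hU hΘ hS hδ 0 τ₀ τ
    change A γ 0 τ₀ + A γ τ₀ τ = A γ 0 τ at h1
    change A δ 0 τ₀ + A δ τ₀ τ = A δ 0 τ at h2
    rw [← h1, ← h2, hA hγ, hA hδ]
    abel
  have h01 := hloc.apply_eq_of_preconnectedSpace 1 0
  have h0 {γ : ℕ → C(unitInterval, X)} (hγ : ∀ t, (S t).IsEnumeration fun i => γ i t) :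
      A γ 0 0 = 0 := by
    have := finsum_normalizedClass_segment hU hΘ hS hγ 0 0 0
    exact left_eq_add.1 this.symm
  simp only [h0 hγ, h0 hδ, sub_zero, A, segmentPath_extendPath] at h01
  exact sub_eq_zero.1 h01

section Homotopy

variable {E : Type*} [NormedAddCommGroup E] [NormedSpace ℝ E]

theorem continuous_comp_lineMap {H : E → SummableMultiset Φ x₀} (hH : Continuous H) (p q : E) :
    Continuous fun t : unitInterval => H (AffineMap.lineMap p q (t : ℝ)) := by
  simp only [AffineMap.lineMap_apply_module]
  fun_prop

/-- The sum of the normalized classes of the terms of an enumeration along a segment. -/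
noncomputable def segmentClass (Θ : X → chainClasses X) {H : E → SummableMultiset Φ x₀}
    (hH : Continuous H) (p q : E) : chainClasses X :=
  ∑ᶠ i, normalizedClass Θ ((exists_continuous_enumeration (continuous_comp_lineMap hH p q)).choose i)

variable (hX : LocallySimplyConnected X) {U : Set X} (hU : U ∈ 𝓝 x₀) {Θ : X → chainClasses X}
  (hΘ : ∀ γ : C(unitInterval, X), (∀ t, γ t ∈ U) → normalizedClass Θ γ = 0)
  {H : E → SummableMultiset Φ x₀} (hH : Continuous H)

include hX hU hΘ

theorem segmentClass_eq {p q : E} {γ : ℕ → C(unitInterval, X)}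
    (hγ : ∀ t : unitInterval, (H (AffineMap.lineMap p q (t : ℝ))).IsEnumeration fun i => γ i t) :
    segmentClass Θ hH p q = ∑ᶠ i, normalizedClass Θ (γ i) :=
  finsum_normalizedClass_eq hX hU hΘ (continuous_comp_lineMap hH p q)
    (exists_continuous_enumeration (continuous_comp_lineMap hH p q)).choose_spec hγ

/-- As the enumeration does not matter, one enumeration over the whole segment can be restricted to
all three subsegments. -/
theorem segmentClass_lineMap_add (p q : E) {a b c : ℝ} (ha : a ∈ unitInterval)
    (hb : b ∈ unitInterval) (hc : c ∈ unitInterval) :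
    segmentClass Θ hH (AffineMap.lineMap p q a) (AffineMap.lineMap p q b) +
      segmentClass Θ hH (AffineMap.lineMap p q b) (AffineMap.lineMap p q c) =
        segmentClass Θ hH (AffineMap.lineMap p q a) (AffineMap.lineMap p q c) := by
  obtain ⟨γ, hγ⟩ := exists_continuous_enumeration (continuous_comp_lineMap hH p q)
  have key {a b : ℝ} (ha : a ∈ unitInterval) (hb : b ∈ unitInterval) :
      segmentClass Θ hH (AffineMap.lineMap p q a) (AffineMap.lineMap p q b) =
        ∑ᶠ i, normalizedClass Θ (segmentPath (extendPath (γ i)) a b) := by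
    refine segmentClass_eq hX hU hΘ hH fun t => ?_
    have hmem : AffineMap.lineMap a b (t : ℝ) ∈ unitInterval :=
      (convex_Icc (0 : ℝ) 1).lineMap_mem ha hb t.2
    have h := hγ ⟨_, hmem⟩
    have e : AffineMap.lineMap (AffineMap.lineMap p q a : E) (AffineMap.lineMap p q b : E) (t : ℝ) =
        AffineMap.lineMap p q (AffineMap.lineMap a b (t : ℝ)) :=
      ((AffineMap.lineMap p q : ℝ →ᵃ[ℝ] E).apply_lineMap a b (t : ℝ)).symm
    rw [e]
    convert h using 2 with i
    exact extendPath_coe (γ i) ⟨_, hmem⟩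
  rw [key ha hb, key hb hc, key ha hc]
  exact finsum_normalizedClass_segment hU hΘ (continuous_comp_lineMap hH p q) hγ a b c

theorem segmentClass_self (p : E) : segmentClass Θ hH p p = 0 := by
  have h := segmentClass_lineMap_add hX hU hΘ hH p p (a := 0) (b := 0) (c := 0) (by simp) (by simp)
    (by simp)
  simp only [AffineMap.lineMap_apply_zero] at h
  exact left_eq_add.1 h.symm

theorem segmentClass_symm (p q : E) : segmentClass Θ hH q p = - segmentClass Θ hH p q := by
  have h := segmentClass_lineMap_add hX hU hΘ hH p q (a := 0) (b := 1) (c := 0) (by simp) (by simp)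
    (by simp)
  simp only [AffineMap.lineMap_apply_zero, AffineMap.lineMap_apply_one] at h
  rw [segmentClass_self hX hU hΘ hH] at h
  exact eq_neg_of_add_eq_zero_right h

theorem segmentClass_midpoint (p q : E) : segmentClass Θ hH p q =
    segmentClass Θ hH p (midpoint ℝ p q) + segmentClass Θ hH (midpoint ℝ p q) q := by
  have h := segmentClass_lineMap_add hX hU hΘ hH p q (a := 0) (b := ⅟2) (c := 1) (by simp)
    (by constructor <;> norm_num) (by simp)
  simp only [AffineMap.lineMap_apply_zero, AffineMap.lineMap_apply_one] at h
  exact h.symm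

/-- Triangles below a Lebesgue number of `K` lie where a single local potential applies, and there
the sum telescopes. Subdivision does the rest. -/
theorem segmentClass_add {K : Set E} (hK : Convex ℝ K) (hKc : IsCompact K) {p q r : E} (hp : p ∈ K)
    (hq : q ∈ K) (hr : r ∈ K) :
    segmentClass Θ hH p q + segmentClass Θ hH q r = segmentClass Θ hH p r := by
  choose κ hκ F hF using exists_local_potential (Φ := Φ) hX hU hΘ
  obtain ⟨δ, hδ, hb⟩ := lebesgue_number_lemma_of_metric hKc
    (c := fun T : SummableMultiset Φ x₀ => H ⁻¹' Metric.ball T (κ T))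
    (fun T => Metric.isOpen_ball.preimage hH)
    (fun x _ => Set.mem_iUnion.2 ⟨H x, Metric.mem_ball_self (hκ _)⟩)
  refine triangle_sum_eq_zero_of_small hK (segmentClass Θ hH)
    (fun p _ q _ => segmentClass_midpoint hX hU hΘ hH p q)
    (fun p _ q _ => segmentClass_symm hX hU hΘ hH p q) hδ ?_ hp hq hr
  intro p hp q _ r _ hpq _ hpr
  obtain ⟨T, hT⟩ := hb p hp
  have key {a b : E} (ha : a ∈ Metric.ball p δ) (hb : b ∈ Metric.ball p δ) :
      segmentClass Θ hH a b = F T (H b) - F T (H a) := by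
    refine (hF T (fun t => H (AffineMap.lineMap a b (t : ℝ)))
      (fun t => hT ((convex_ball p δ).lineMap_mem ha hb t.2)) _
      (exists_continuous_enumeration (continuous_comp_lineMap hH a b)).choose_spec).trans ?_
    simp
  have hp' := Metric.mem_ball_self (x := p) hδ
  have hq' : q ∈ Metric.ball p δ := by rwa [Metric.mem_ball, dist_comm]
  have hr' : r ∈ Metric.ball p δ := by rwa [Metric.mem_ball, dist_comm]
  rw [key hp' hq', key hq' hr', key hp' hr']
  abel

end Homotopy
end SummableMultiset

/-! ### Normalization by paths in a simply connected neighbourhood -/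

section Extension

variable {X : Type u} [TopologicalSpace X] {x₀ : X} {U : Set X}

theorem normalizedClass_of_loop {Θ : X → chainClasses X} {γ : C(unitInterval, X)} (h : γ 0 = γ 1) :
    normalizedClass Θ γ = pathClass γ := by
  rw [normalizedClass, h]
  abel

/-- On `U` the value at `x` is the class of any path in `U` from `x₀` to `x`, which is what a
`U`-extension attaches; outside `U` nothing is attached. -/
theorem IsSimplyConnected.exists_normalization (hU : IsSimplyConnected U) (hx : x₀ ∈ U) :
    ∃ Θ : X → chainClasses X, Θ x₀ = 0 ∧ (∀ x ∉ U, Θ x = 0) ∧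
      ∀ γ : C(unitInterval, X), (∀ t, γ t ∈ U) → normalizedClass Θ γ = 0 := by
  classical
  obtain ⟨f, hf⟩ := hU.exists_potential hx
  refine ⟨fun x => if x ∈ U then f x - f x₀ else 0, by simp, fun x hx => if_neg hx, fun γ hγ => ?_⟩
  simp only [normalizedClass, hγ, if_true, hf γ hγ]
  abel

theorem IsUExtension.pathClass_eq {Θ : X → chainClasses X} (h0 : Θ x₀ = 0)
    (hout : ∀ x ∉ U, Θ x = 0)
    (hΘ : ∀ γ : C(unitInterval, X), (∀ t, γ t ∈ U) → normalizedClass Θ γ = 0)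
    {γ γ' : C(unitInterval, X)} (h : IsUExtension x₀ U γ γ') :
    pathClass γ' = normalizedClass Θ γ := by
  obtain ⟨a, b, θl, θr, hl, hr, rfl⟩ := h
  rw [pathClass_trans, pathClass_trans]
  have el : pathClass θl.toContinuousMap = Θ (γ 0) := by
    rcases hl with ⟨-, rfl, hmem⟩ | ⟨hmem, hc⟩
    · have := hΘ θl.toContinuousMap hmem
      simp only [normalizedClass, Path.coe_toContinuousMap, θl.source, θl.target, h0, zero_add] at this
      exact sub_eq_zero.1 this
    · rw [hout _ hmem, show θl.toContinuousMap = ContinuousMap.const _ (γ 0) from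
        ContinuousMap.ext hc, pathClass_const]
  have er : pathClass θr.toContinuousMap = - Θ (γ 1) := by
    rcases hr with ⟨-, rfl, hmem⟩ | ⟨hmem, hc⟩
    · have := hΘ θr.toContinuousMap hmem
      simp only [normalizedClass, Path.coe_toContinuousMap, θr.source, θr.target, h0, sub_zero] at this
      exact eq_neg_of_add_eq_zero_right this
    · rw [hout _ hmem, show θr.toContinuousMap = ContinuousMap.const _ (γ 1) from
        ContinuousMap.ext hc, pathClass_const, neg_zero]
  rw [el, er, ← sub_eq_add_neg]
  rfl

end Extension

namespace SummableMultiset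

variable {X : Type u} [MetricSpace X] {Φ : SymmetricNorm} {x₀ : X}

/-- Two triangles share the diagonal of the square of the homotopy. The sides where it is fixed are
enumerated by constant paths and contribute zero. -/
theorem finsum_normalizedClass_eq_of_homotopic (hX : LocallySimplyConnected X) {U : Set X}
    (hU : U ∈ 𝓝 x₀) {Θ : X → chainClasses X}
    (hΘ : ∀ γ : C(unitInterval, X), (∀ t, γ t ∈ U) → normalizedClass Θ γ = 0)
    {A B : SummableMultiset Φ x₀} {S T : Path A B} (hST : S.Homotopic T)
    {γ δ : ℕ → C(unitInterval, X)} (hγ : IsContinuousEnumeration S γ)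
    (hδ : IsContinuousEnumeration T δ) :
    ∑ᶠ i, normalizedClass Θ (γ i) = ∑ᶠ i, normalizedClass Θ (δ i) := by
  obtain ⟨F⟩ := hST
  let H : ℝ × ℝ → SummableMultiset Φ x₀ := fun x =>
    F (Set.projIcc 0 1 zero_le_one x.1, Set.projIcc 0 1 zero_le_one x.2)
  have hH : Continuous H := F.continuous.comp
    ((continuous_projIcc.comp continuous_fst).prodMk (continuous_projIcc.comp continuous_snd))
  have hK : Convex ℝ (Set.Icc (0 : ℝ) 1 ×ˢ Set.Icc (0 : ℝ) 1) :=
    (convex_Icc 0 1).prod (convex_Icc 0 1)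
  have hKc : IsCompact (Set.Icc (0 : ℝ) 1 ×ˢ Set.Icc (0 : ℝ) 1) := isCompact_Icc.prod isCompact_Icc
  have hadd := fun p q r hp hq hr =>
    segmentClass_add hX hU hΘ hH hK hKc (p := p) (q := q) (r := r) hp hq hr
  have h1 := hadd (0, 0) (0, 1) (1, 1) (by simp) (by simp) (by simp)
  have h2 := hadd (0, 0) (1, 0) (1, 1) (by simp) (by simp) (by simp)
  have hconst (C : SummableMultiset Φ x₀) (p q : ℝ × ℝ)
      (h : ∀ t : unitInterval, H (AffineMap.lineMap p q (t : ℝ)) = C) :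
      segmentClass Θ hH p q = 0 := by
    obtain ⟨s, hs, -⟩ := C.2
    rw [segmentClass_eq hX hU hΘ hH (γ := fun i => ContinuousMap.const _ (s i))
      fun t => by rw [h]; exact hs]
    simp [normalizedClass_const]
  rw [hconst B (0, 1) (1, 1) fun t => by simp [H, AffineMap.lineMap_apply_module], add_zero,
    segmentClass_eq hX hU hΘ hH (γ := γ) fun t => by
      simpa [H, AffineMap.lineMap_apply_module] using hγ t] at h1
  rw [hconst A (0, 0) (1, 0) fun t => by simp [H, AffineMap.lineMap_apply_module], zero_add,
    segmentClass_eq hX hU hΘ hH (p := (1, 0)) (γ := δ) fun t => by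
      simpa [H, AffineMap.lineMap_apply_module] using hδ t] at h2
  rw [h1, h2]

end SummableMultiset

/-! ### Formal sums and their boundaries -/

section FormalSum

variable {X : Type u} [TopologicalSpace X] {x₀ : X}

theorem IsNullHomotopicLoop.pathClass_eq_zero {γ : C(unitInterval, X)}
    (h : IsNullHomotopicLoop x₀ γ) : pathClass γ = 0 := by
  obtain ⟨p, rfl, hp⟩ := h
  exact (pathClass_homotopic hp).trans (pathClass_const x₀)

theorem IsNullHomotopicLoop.endpoints {γ : C(unitInterval, X)} (h : IsNullHomotopicLoop x₀ γ) :
    γ 0 = x₀ ∧ γ 1 = x₀ := by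
  obtain ⟨p, rfl, -⟩ := h
  exact ⟨p.source, p.target⟩

theorem IsSimplyConnected.isNullHomotopicLoop {U : Set X} (hU : IsSimplyConnected U)
    {γ : C(unitInterval, X)} (hγ : ∀ t, γ t ∈ U) (h0 : γ 0 = x₀) (h1 : γ 1 = x₀) :
    IsNullHomotopicLoop x₀ γ :=
  ⟨⟨γ, h0, h1⟩, rfl, hU.homotopic _ _ hγ fun _ => h0 ▸ hγ 0⟩

variable {γ : ℕ → C(unitInterval, X)}

/-- Null-homotopic loops have class zero, so the sum may run over all terms, whichever of them are
null-homotopic. -/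
theorem pOpcycles_formalSum (hfin : {i | ¬ IsNullHomotopicLoop x₀ (γ i)}.Finite) :
    ((singularChains X).pOpcycles 1).hom (∑ i ∈ hfin.toFinset, pathChain (γ i)) =
      ∑ᶠ i, pathClass (γ i) := by
  rw [map_sum, finsum_eq_sum_of_support_subset (s := hfin.toFinset)]
  · rfl
  · intro i hi
    rw [Set.Finite.coe_toFinset]
    exact fun h => hi h.pathClass_eq_zero

theorem d_formalSum (hfin : {i | ¬ IsNullHomotopicLoop x₀ (γ i)}.Finite) :
    ((singularChains X).d 1 0).hom (∑ i ∈ hfin.toFinset, pathChain (γ i)) =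
      ∑ᶠ i, (pointChain (γ i 1) - pointChain (γ i 0)) := by
  rw [map_sum, finsum_eq_sum_of_support_subset (s := hfin.toFinset)]
  · exact Finset.sum_congr rfl fun i _ => d_pathChain (γ i)
  · intro i hi
    rw [Set.Finite.coe_toFinset]
    refine fun h => hi ?_
    simp [h.endpoints.1, h.endpoints.2]

theorem isFormalSumClass_of_finite (hfin : {i | ¬ IsNullHomotopicLoop x₀ (γ i)}.Finite)
    (hd : ∑ᶠ i, (pointChain (γ i 1) - pointChain (γ i 0)) = 0)
    {h : singularH1 X} (hh : homologyInclusion h = ∑ᶠ i, pathClass (γ i)) :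
    IsFormalSumClass x₀ γ h :=
  ⟨hfin, (isHomologyClass_iff _ _).2
    ⟨(d_formalSum hfin).trans hd, (pOpcycles_formalSum hfin).trans hh.symm⟩⟩

theorem exists_homologyInclusion_eq (hfin : {i | ¬ IsNullHomotopicLoop x₀ (γ i)}.Finite)
    (hd : ∑ᶠ i, (pointChain (γ i 1) - pointChain (γ i 0)) = 0) :
    ∃ h : singularH1 X, homologyInclusion h = ∑ᶠ i, pathClass (γ i) := by
  obtain ⟨h, hh⟩ := exists_isHomologyClass _ ((d_formalSum hfin).trans hd)
  exact ⟨h, ((isHomologyClass_iff _ _).1 hh).2.symm.trans (pOpcycles_formalSum hfin)⟩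

/-- The difference of the end points of a path, where the points of `U` are replaced by `x₀`. -/
theorem IsUExtension.pointChain_sub {U : Set X} [DecidablePred (· ∈ U)] {γ γ' : C(unitInterval, X)}
    (h : IsUExtension x₀ U γ γ') :
    pointChain (γ' 1) - pointChain (γ' 0) =
      (if γ 1 ∈ U then 0 else pointChain (γ 1) - pointChain x₀) -
        (if γ 0 ∈ U then 0 else pointChain (γ 0) - pointChain x₀) := by
  obtain ⟨a, b, θl, θr, hl, hr, rfl⟩ := h
  have ea : pointChain a = pointChain x₀ + if γ 0 ∈ U then 0 else pointChain (γ 0) - pointChain x₀ := by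
    rcases hl with ⟨hm, rfl, -⟩ | ⟨hm, hc⟩
    · simp [hm]
    · rw [if_neg hm, add_sub_cancel, ← θl.source, hc]
  have eb : pointChain b = pointChain x₀ + if γ 1 ∈ U then 0 else pointChain (γ 1) - pointChain x₀ := by
    rcases hr with ⟨hm, rfl, -⟩ | ⟨hm, hc⟩
    · simp [hm]
    · rw [if_neg hm, add_sub_cancel, ← θr.target, hc]
  simp only [Path.coe_toContinuousMap, Path.source, Path.target]
  rw [ea, eb]
  abel

theorem IsUExtension.isNullHomotopicLoop {U : Set X} (hU : IsSimplyConnected U)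
    {γ γ' : C(unitInterval, X)} (h : IsUExtension x₀ U γ γ') (hγ : ∀ t, γ t ∈ U) :
    IsNullHomotopicLoop x₀ γ' := by
  obtain ⟨a, b, θl, θr, hl, hr, rfl⟩ := h
  obtain ⟨-, rfl, hl'⟩ := hl.resolve_right fun h => h.1 (hγ 0)
  obtain ⟨-, rfl, hr'⟩ := hr.resolve_right fun h => h.1 (hγ 1)
  refine hU.isNullHomotopicLoop (fun t => ?_) (Path.source _) (Path.target _)
  simp only [Path.coe_toContinuousMap, Path.trans_apply]
  split_ifs
  exacts [hl' _, hγ _, hr' _]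

end FormalSum

namespace SummableMultiset

variable {X : Type u} [MetricSpace X] {Φ : SymmetricNorm} {x₀ : X}

/-- Almost all terms of a continuous enumeration stay in a neighbourhood of the base point. -/
theorem finite_exists_notMem {S : unitInterval → SummableMultiset Φ x₀} (hS : Continuous S)
    {γ : ℕ → C(unitInterval, X)} (hγ : ∀ t, (S t).IsEnumeration fun i => γ i t) {U : Set X}
    (hU : U ∈ 𝓝 x₀) : {i | ¬ ∀ t, γ i t ∈ U}.Finite := by
  obtain ⟨ρ, hρ, hρU⟩ := Metric.mem_nhds_iff.1 hU
  refine (finite_exists_le_dist hS (fun i => (γ i).continuous) hγ hρ).subset fun i hi => ?_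
  by_contra hcon
  refine hi fun t => hρU ?_
  rw [Metric.mem_ball, dist_comm]
  by_contra h
  exact hcon ⟨t, not_lt.1 h⟩

theorem exists_isFormalSumClass_of_homotopic (hX : LocallySimplyConnected X) {U : Set X}
    (hU : U ∈ 𝓝 x₀) (hUsc : IsSimplyConnected U) {S₀ : SummableMultiset Φ x₀} {S T : Path S₀ S₀}
    (hST : S.Homotopic T) {γ δ : ℕ → C(unitInterval, X)} (hγ : IsContinuousEnumeration S γ)
    (hδ : IsContinuousEnumeration T δ) {γ' δ' : ℕ → C(unitInterval, X)}
    (hγ' : ∀ i, IsUExtension x₀ U (γ i) (γ' i)) (hδ' : ∀ i, IsUExtension x₀ U (δ i) (δ' i)) :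
    ∃ h : singularH1 X, IsFormalSumClass x₀ γ' h ∧ IsFormalSumClass x₀ δ' h := by
  classical
  obtain ⟨Θ, h0, hout, hΘ⟩ := hUsc.exists_normalization (mem_of_mem_nhds hU)
  have hfin {S : Path S₀ S₀} {γ γ' : ℕ → C(unitInterval, X)} (hγ : IsContinuousEnumeration S γ)
      (hγ' : ∀ i, IsUExtension x₀ U (γ i) (γ' i)) :
      {i | ¬ IsNullHomotopicLoop x₀ (γ' i)}.Finite :=
    (finite_exists_notMem S.continuous hγ hU).subset fun i hi hm =>
      hi ((hγ' i).isNullHomotopicLoop hUsc hm)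
  have hd {S : Path S₀ S₀} {γ γ' : ℕ → C(unitInterval, X)} (hγ : IsContinuousEnumeration S γ)
      (hγ' : ∀ i, IsUExtension x₀ U (γ i) (γ' i)) :
      ∑ᶠ i, (pointChain (γ' i 1) - pointChain (γ' i 0)) = 0 := by
    have hsupp (t : unitInterval) : (Function.support fun i =>
        if γ i t ∈ U then 0 else pointChain (γ i t) - pointChain x₀).Finite :=
      (finite_exists_notMem S.continuous hγ hU).subset fun i hi hm => hi (if_pos (hm t))
    -- The boundary is a difference of sums, over the two ends, of a function on points that
    -- vanishes on `U`. Both ends enumerate `S₀`.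
    simp only [fun i => (hγ' i).pointChain_sub]
    rw [finsum_sub_distrib (hsupp 1) (hsupp 0), sub_eq_zero]
    have e0 := hγ 0
    have e1 := hγ 1
    rw [S.source] at e0
    rw [S.target] at e1
    exact CountableMultiset.IsEnumeration.finsum_comp_eq e1 e0
      (fun x => if x ∈ U then 0 else pointChain x - pointChain x₀) (by simp)
  obtain ⟨h, hh⟩ := exists_homologyInclusion_eq (hfin hγ hγ') (hd hγ hγ')
  refine ⟨h, isFormalSumClass_of_finite (hfin hγ hγ') (hd hγ hγ') hh,
    isFormalSumClass_of_finite (hfin hδ hδ') (hd hδ hδ') (hh.trans ?_)⟩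
  simp only [fun i => (hγ' i).pathClass_eq h0 hout hΘ, fun i => (hδ' i).pathClass_eq h0 hout hΘ]
  exact finsum_normalizedClass_eq_of_homotopic hX hU hΘ hST hγ hδ

end SummableMultiset

/-! ### Addition of multisets and continuous families -/

/-- The sequence `(s₀, t₀, s₁, t₁, …)`. -/
def interleave {X : Type*} (s t : ℕ → X) (n : ℕ) : X := if n % 2 = 0 then s (n / 2) else t (n / 2)

namespace SymmetricNorm

variable (Φ : SymmetricNorm)

theorem ext_interleave_le (α β : ℕ → ℝ) : Φ.ext (interleave α β) ≤ Φ.ext α + Φ.ext β := by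
  have e : interleave α β = fun i => interleave α (fun _ => 0) i + interleave (fun _ => 0) β i := by
    funext i
    by_cases h : i % 2 = 0 <;> simp [interleave, h]
  rw [e]
  refine (Φ.ext_add_le _ _).trans (add_le_add ?_ ?_)
  · have h0 : ∀ i, interleave α (fun _ => 0) i ≠ 0 → i % 2 = 0 := by
      intro i hi
      by_contra h
      simp [interleave, h] at hi
    refine Φ.ext_le_of_injOn (fun i => i / 2) (fun i hi j hj hij => ?_) fun i hi => ?_
    · have h1 := h0 i hi
      have h2 := h0 j hj
      simp only at hij
      omega
    · simp [interleave, h0 i hi]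
  · have h0 : ∀ i, interleave (fun _ => 0) β i ≠ 0 → i % 2 = 1 := by
      intro i hi
      by_contra h
      simp [interleave, (Nat.mod_two_ne_one.1 h)] at hi
    refine Φ.ext_le_of_injOn (fun i => i / 2) (fun i hi j hj hij => ?_) fun i hi => ?_
    · have h1 := h0 i hi
      have h2 := h0 j hj
      simp only at hij
      omega
    · simp [interleave, h0 i hi]

theorem isSummable_of_tail_le {ξ : ℕ → ℝ}
    (h : ∀ ε : ℝ, 0 < ε → ∃ n, Φ.ext (fun i => ξ (n + i)) ≤ ENNReal.ofReal ε) : Φ.IsSummable ξ := by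
  constructor
  · rw [Metric.tendsto_atTop]
    intro ε hε
    obtain ⟨n, hn⟩ := h (ε / 2) (half_pos hε)
    refine ⟨n, fun i hi => ?_⟩
    have := (Φ.ofReal_abs_le_ext (fun i => ξ (n + i)) (i - n)).trans hn
    rw [ENNReal.ofReal_le_ofReal_iff (half_pos hε).le, Nat.add_sub_cancel' hi] at this
    rw [Real.dist_eq, sub_zero]
    linarith
  · obtain ⟨n, hn⟩ := h 1 one_pos
    refine (Φ.ext_le_initial_add_tail (n := n) (r := ∑ i ∈ Finset.range n, |ξ i|)
      fun i hi => ?_).trans_lt (ENNReal.add_lt_top.2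
        ⟨ENNReal.ofReal_lt_top, hn.trans_lt ENNReal.ofReal_lt_top⟩)
    exact Finset.single_le_sum (f := fun i => |ξ i|) (fun _ _ => abs_nonneg _) (Finset.mem_range.2 hi)

end SymmetricNorm

namespace CountableMultiset

variable {X : Type u} {x₀ : X}

/-- The sum of two countable multisets. -/
instance : Add (CountableMultiset x₀) where
  add S T :=
    { mult := fun x => S.mult x + T.mult x
      mult_base := by simp [S.mult_base]
      mult_ne_top := fun x hx => WithTop.add_ne_top.2 ⟨S.mult_ne_top x hx, T.mult_ne_top x hx⟩
      countable_support := by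
        refine (S.countable_support.union T.countable_support).mono fun x hx => ?_
        by_contra h
        simp only [Set.mem_union, Set.mem_ofPred_eq, not_or, not_not] at h hx
        exact hx (by simp [h.1, h.2]) }

theorem add_mult (S T : CountableMultiset x₀) (x : X) : (S + T).mult x = S.mult x + T.mult x := rfl

theorem IsEnumeration.interleave {S T : CountableMultiset x₀} {s t : ℕ → X}
    (hs : S.IsEnumeration s) (ht : T.IsEnumeration t) :
    (S + T).IsEnumeration (interleave s t) := by
  intro x hx
  have e : {i | _root_.interleave s t i = x} =
      (fun i => 2 * i) '' {i | s i = x} ∪ (fun i => 2 * i + 1) '' {i | t i = x} := by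
    ext n
    simp only [_root_.interleave, Set.mem_ofPred_eq, Set.mem_image, Set.mem_union]
    constructor
    · intro hn
      split_ifs at hn with h0
      · exact Or.inl ⟨n / 2, hn, by omega⟩
      · exact Or.inr ⟨n / 2, hn, by omega⟩
    · rintro (⟨i, hi, rfl⟩ | ⟨i, hi, rfl⟩)
      · simpa using hi
      · have h1 : (2 * i + 1) % 2 = 1 := by omega
        have h2 : (2 * i + 1) / 2 = i := by omega
        simpa [h1, h2] using hi
  rw [e, Set.encard_union_eq, Set.InjOn.encard_image (fun a _ b _ hab => by simpa using hab),
    Set.InjOn.encard_image (fun a _ b _ hab => by simpa using hab), hs x hx, ht x hx, add_mult]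
  rw [Set.disjoint_left]
  rintro _ ⟨i, -, rfl⟩ ⟨j, -, hj⟩
  simp only at hj
  omega

theorem IsEnumeration.unique {S T : CountableMultiset x₀} {s : ℕ → X} (hs : S.IsEnumeration s)
    (ht : T.IsEnumeration s) : S = T := by
  refine CountableMultiset.ext (funext fun x => ?_)
  by_cases hx : x = x₀
  · rw [hx, S.mult_base, T.mult_base]
  · rw [← hs x hx, ← ht x hx]

theorem exists_isEnumeration {s : ℕ → X} (h : ∀ x, x ≠ x₀ → {i | s i = x}.Finite) :
    ∃ S : CountableMultiset x₀, S.IsEnumeration s := by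
  classical
  refine ⟨{ mult := fun x => if x = x₀ then ⊤ else {i | s i = x}.encard
            mult_base := by simp
            mult_ne_top := fun x hx => by simpa [hx] using h x hx
            countable_support := ?_ }, fun x hx => by simp [hx]⟩
  refine ((Set.countable_range s).union (Set.countable_singleton x₀)).mono fun x hx => ?_
  by_cases hxx : x = x₀
  · exact Or.inr hxx
  · refine Or.inl ?_
    simp only [Set.mem_ofPred_eq, if_neg hxx, ne_eq, Set.encard_eq_zero] at hx
    exact Set.nonempty_iff_ne_empty.2 hx

end CountableMultiset

namespace SummableMultiset

variable {X : Type u} [MetricSpace X] {Φ : SymmetricNorm} {x₀ : X}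

theorem dist_interleave (s t s' t' : ℕ → X) :
    (fun i => dist (interleave s t i) (interleave s' t' i)) =
      interleave (fun i => dist (s i) (s' i)) fun i => dist (t i) (t' i) := by
  funext i
  by_cases h : i % 2 = 0 <;> simp [interleave, h]

/-- The sum of two summable multisets. -/
noncomputable instance : Add (SummableMultiset Φ x₀) where
  add S T := ⟨S.1 + T.1, by
    obtain ⟨s, hs, hs1, hs2⟩ := S.2
    obtain ⟨t, ht, ht1, ht2⟩ := T.2
    have e : (fun i => dist x₀ (interleave s t i)) =
        interleave (fun i => dist x₀ (s i)) fun i => dist x₀ (t i) := by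
      funext i
      by_cases h : i % 2 = 0 <;> simp [interleave, h]
    have hdiv : Tendsto (fun n : ℕ => n / 2) atTop atTop :=
      Nat.tendsto_div_const_atTop two_ne_zero
    refine ⟨_, hs.interleave ht, ?_, ?_⟩
    · rw [e]
      exact (hs1.comp hdiv).if' (ht1.comp hdiv)
    · rw [e]
      exact (Φ.ext_interleave_le _ _).trans_lt (ENNReal.add_lt_top.2 ⟨hs2, ht2⟩)⟩

theorem IsEnumeration.interleave {S T : SummableMultiset Φ x₀} {s t : ℕ → X}
    (hs : S.IsEnumeration s) (ht : T.IsEnumeration t) : (S + T).IsEnumeration (interleave s t) :=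
  CountableMultiset.IsEnumeration.interleave hs ht

theorem IsEnumeration.unique {S T : SummableMultiset Φ x₀} {s : ℕ → X} (hs : S.IsEnumeration s)
    (ht : T.IsEnumeration s) : S = T :=
  Subtype.ext (CountableMultiset.IsEnumeration.unique hs ht)

theorem ext_mult {S T : SummableMultiset Φ x₀} (h : ∀ x, x ≠ x₀ → S.1.mult x = T.1.mult x) :
    S = T := by
  refine Subtype.ext (CountableMultiset.ext (funext fun x => ?_))
  by_cases hx : x = x₀
  · rw [hx, S.1.mult_base, T.1.mult_base]
  · exact h x hx

theorem add_mult (S T : SummableMultiset Φ x₀) (x : X) :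
    (S + T).1.mult x = S.1.mult x + T.1.mult x := rfl

theorem trivialMultiset_mult {x : X} (hx : x ≠ x₀) : (trivialMultiset Φ x₀).1.mult x = 0 := by
  simp [trivialMultiset, CountableMultiset.trivialMultiset, hx]

theorem add_trivialMultiset (S : SummableMultiset Φ x₀) : S + trivialMultiset Φ x₀ = S :=
  ext_mult fun x hx => by rw [add_mult, trivialMultiset_mult hx, add_zero]

theorem trivialMultiset_add (S : SummableMultiset Φ x₀) : trivialMultiset Φ x₀ + S = S :=
  ext_mult fun x hx => by rw [add_mult, trivialMultiset_mult hx, zero_add]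

theorem add_comm' (S T : SummableMultiset Φ x₀) : S + T = T + S :=
  Subtype.ext (CountableMultiset.ext (funext fun x => add_comm (S.1.mult x) (T.1.mult x)))

/-- Nearly optimal matchings of both pairs interleave to a matching of the sums. Addition is thus
Lipschitz, and the space a topological monoid. -/
theorem edist_add_le (S T S' T' : SummableMultiset Φ x₀) :
    edist (S + T) (S' + T') ≤ edist S S' + edist T T' := by
  refine ENNReal.le_of_forall_pos_le_add fun ε hε hfin => ?_
  have hε' : (ε / 2 : ℝ≥0∞) ≠ 0 := by simpa using hε.ne'
  obtain ⟨h1, h2⟩ := ENNReal.add_lt_top.1 hfin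
  obtain ⟨s, s', hs, hs', hss⟩ := exists_enumerations_of_edist_lt (ENNReal.lt_add_right h1.ne hε')
  obtain ⟨t, t', ht, ht', htt⟩ := exists_enumerations_of_edist_lt (ENNReal.lt_add_right h2.ne hε')
  refine (edist_le (hs.interleave ht) (hs'.interleave ht')).trans ?_
  rw [dist_interleave]
  refine (Φ.ext_interleave_le _ _).trans ((add_le_add hss.le htt.le).trans_eq ?_)
  rw [add_add_add_comm, ENNReal.add_halves]

instance : ContinuousAdd (SummableMultiset Φ x₀) where
  continuous_add := by
    refine LipschitzWith.continuous (K := 2) fun p q => (edist_add_le _ _ _ _).trans ?_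
    rw [Prod.edist_eq]
    rw [ENNReal.coe_ofNat, two_mul]
    exact add_le_add (le_max_left _ _) (le_max_right _ _)

section Families

variable {Y : Type*} [TopologicalSpace Y]

/-- Finitely many terms are controlled by continuity and the rest by the uniform tails; the radius
`r` keeps the share of the first `n` terms below `ε / 4`. -/
theorem continuous_of_tail_le {S : Y → SummableMultiset Φ x₀} {k : ℕ → Y → X}
    (hk : ∀ i, Continuous (k i)) (hS : ∀ y, (S y).IsEnumeration fun i => k i y)
    (htail : ∀ ε : ℝ, 0 < ε → ∃ n, ∀ y, (Φ.ext fun i => dist x₀ (k (n + i) y)) ≤ ENNReal.ofReal ε) :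
    Continuous S := by
  rw [continuous_iff_continuousAt]
  intro y₀
  rw [ContinuousAt, Metric.tendsto_nhds]
  intro ε hε
  have hε4 : 0 < ε / 4 := by positivity
  obtain ⟨n, hn⟩ := htail (ε / 4) hε4
  set r : ℝ := ε / 4 / (n + 1) with hr
  have hr0 : 0 < r := by positivity
  have h1 : ∀ᶠ y in 𝓝 y₀, ∀ i ∈ Finset.range n, dist (k i y) (k i y₀) < r := by
    rw [Filter.eventually_all_finset]
    exact fun i _ => (hk i).continuousAt.eventually (Metric.ball_mem_nhds _ hr0)
  filter_upwards [h1] with y hy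
  rw [← edist_lt_ofReal]
  calc edist (S y) (S y₀) ≤ Φ.ext fun i => dist (k i y) (k i y₀) := edist_le (hS y) (hS y₀)
    _ ≤ ENNReal.ofReal (n * r) + Φ.ext fun i => dist (k (n + i) y) (k (n + i) y₀) := by
        refine Φ.ext_le_initial_add_tail fun i hi => ?_
        rw [abs_of_nonneg dist_nonneg]
        exact (hy i (Finset.mem_range.2 hi)).le
    _ ≤ ENNReal.ofReal (ε / 4) + (ENNReal.ofReal (ε / 4) + ENNReal.ofReal (ε / 4)) := by
        refine add_le_add (ENNReal.ofReal_le_ofReal ?_) (le_trans ?_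
          ((Φ.ext_add_le _ _).trans (add_le_add (hn y) (hn y₀))))
        · rw [hr, mul_div_assoc', div_le_iff₀ (by positivity)]
          nlinarith
        · refine Φ.ext_mono fun i => ?_
          rw [abs_of_nonneg dist_nonneg, abs_of_nonneg (by positivity)]
          exact dist_triangle_left _ _ _
    _ < ENNReal.ofReal ε := by
        rw [← ENNReal.ofReal_add hε4.le hε4.le, ← ENNReal.ofReal_add hε4.le (by positivity)]
        exact (ENNReal.ofReal_lt_ofReal_iff hε).2 (by linarith)

theorem exists_continuous_family (k : ℕ → C(Y, X))
    (htail : ∀ ε : ℝ, 0 < ε → ∃ n, ∀ y, (Φ.ext fun i => dist x₀ (k (n + i) y)) ≤ ENNReal.ofReal ε) :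
    ∃ S : C(Y, SummableMultiset Φ x₀), ∀ y, (S y).IsEnumeration fun i => k i y := by
  have hsum (y : Y) : Φ.IsSummable fun i => dist x₀ (k i y) :=
    Φ.isSummable_of_tail_le fun ε hε => (htail ε hε).imp fun n hn => hn y
  have hex (y : Y) : ∃ S : SummableMultiset Φ x₀, S.IsEnumeration fun i => k i y := by
    have hfin (x : X) (hx : x ≠ x₀) : {i | k i y = x}.Finite := by
      have := (hsum y).1.eventually_lt_const (dist_pos.2 hx.symm)
      rw [← Nat.cofinite_eq_atTop, Filter.eventually_cofinite] at this
      refine this.subset fun i (hi : k i y = x) => ?_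
      simp [hi]
    obtain ⟨S, hS⟩ := CountableMultiset.exists_isEnumeration hfin
    exact ⟨⟨S, _, hS, hsum y⟩, hS⟩
  choose S hS using hex
  exact ⟨⟨S, continuous_of_tail_le (fun i => (k i).continuous) hS htail⟩, hS⟩

/-- The embedding of `X` that sends a point to the multiset with that point only. -/
theorem exists_singleton_map (Φ : SymmetricNorm) (x₀ : X) : ∃ j : C(X, SummableMultiset Φ x₀),
    ∀ x, (j x).IsEnumeration fun i => if i = 0 then x else x₀ := by
  obtain ⟨S, hS⟩ := exists_continuous_family (Φ := Φ) (x₀ := x₀)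
    (fun i => if i = 0 then ContinuousMap.id X else ContinuousMap.const X x₀) fun ε hε =>
      ⟨1, fun x => by simp [Φ.ext_zero]⟩
  refine ⟨S, fun x => ?_⟩
  convert hS x using 2 with i
  split_ifs <;> rfl

end Families

end SummableMultiset

/-! ### Tools for homotopies and commutativity of the fundamental group -/

theorem Path.homotopic_of_simplyConnected {Y Z : Type*} [TopologicalSpace Y] [TopologicalSpace Z]
    [SimplyConnectedSpace Y] (f : C(Y, Z)) {y₀ y₁ : Y} (p q : Path y₀ y₁) {a b : Z} {P Q : Path a b}
    (hP : ∀ t, P t = f (p t)) (hQ : ∀ t, Q t = f (q t)) : P.Homotopic Q := by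
  obtain rfl : a = f y₀ := by simpa using hP 0
  obtain rfl : b = f y₁ := by simpa using hP 1
  obtain rfl : P = p.map f.continuous := Path.ext (funext hP)
  obtain rfl : Q = q.map f.continuous := Path.ext (funext hQ)
  exact (SimplyConnectedSpace.paths_homotopic p q).map f

/-- `f i` is the largest stage `m ≤ i` valid for `i`; stage `0` is the default, and each stage is
eventually valid. -/
theorem exists_tendsto_atTop_of_eventually {P : ℕ → ℕ → Prop} (h0 : ∀ i, P 0 i)
    (h : ∀ m, ∀ᶠ i in atTop, P m i) : ∃ f : ℕ → ℕ, Tendsto f atTop atTop ∧ ∀ i, P (f i) i := by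
  classical
  refine ⟨fun i => Nat.findGreatest (fun m => P m i) i, tendsto_atTop.2 fun m => ?_, fun i =>
    Nat.findGreatest_spec (P := fun m => P m i) (Nat.zero_le i) (h0 i)⟩
  filter_upwards [h m, eventually_ge_atTop m] with i hi hm
  exact Nat.le_findGreatest hm hi

/-- Functions of the unit interval that rise from `0` to `1` on consecutive intervals. -/
noncomputable def ramp (i : ℕ) : C(unitInterval, unitInterval) :=
  ⟨fun s => Set.projIcc (0 : ℝ) 1 zero_le_one ((i + 1) * (i + 2) * (s : ℝ) - i * (i + 2)), by fun_prop⟩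

theorem ramp_zero (i : ℕ) : ramp i 0 = 0 := by
  refine Set.projIcc_of_le_left zero_le_one ?_
  simp only [Set.Icc.coe_zero, mul_zero, zero_sub, Left.neg_nonpos_iff]
  positivity

theorem ramp_one (i : ℕ) : ramp i 1 = 1 := by
  refine Set.projIcc_of_right_le zero_le_one ?_
  simp only [Set.Icc.coe_one]
  nlinarith [(Nat.cast_nonneg i : (0 : ℝ) ≤ i)]

theorem mem_Ioo_of_ramp {i : ℕ} {s : unitInterval} (h0 : ramp i s ≠ 0) (h1 : ramp i s ≠ 1) :
    (i : ℝ) < (i + 1) * s ∧ (i + 2) * (s : ℝ) < i + 1 := by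
  have hi : (0 : ℝ) ≤ i := Nat.cast_nonneg i
  constructor
  · by_contra! h
    refine h0 (Set.projIcc_of_le_left zero_le_one ?_)
    nlinarith
  · by_contra! h
    refine h1 (Set.projIcc_of_right_le zero_le_one ?_)
    nlinarith

/-- The ramp of index `i` moves only between `i / (i + 1)` and `(i + 1) / (i + 2)`. These intervals
are disjoint, so at most one ramp is in motion at a time. -/
theorem eq_of_ramp {i j : ℕ} {s : unitInterval} (hi0 : ramp i s ≠ 0) (hi1 : ramp i s ≠ 1)
    (hj0 : ramp j s ≠ 0) (hj1 : ramp j s ≠ 1) : i = j := by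
  have key {i j : ℕ} (hi : (i + 2) * (s : ℝ) < i + 1) (hj : (j : ℝ) < (j + 1) * s) : j ≤ i := by
    by_contra! h
    have : (i : ℝ) + 1 ≤ j := by exact_mod_cast h
    nlinarith [s.2.1, s.2.2]
  exact le_antisymm (key (mem_Ioo_of_ramp hj0 hj1).2 (mem_Ioo_of_ramp hi0 hi1).1)
    (key (mem_Ioo_of_ramp hi0 hi1).2 (mem_Ioo_of_ramp hj0 hj1).1)

namespace SummableMultiset

variable {X : Type u} [MetricSpace X] {Φ : SymmetricNorm} {x₀ : X}

theorem eq_base_of_isEnumeration_trivialMultiset {s : ℕ → X}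
    (hs : (trivialMultiset Φ x₀).IsEnumeration s) (i : ℕ) : s i = x₀ := by
  by_contra h
  have := hs (s i) h
  rw [trivialMultiset_mult h, Set.encard_eq_zero] at this
  exact Set.eq_empty_iff_forall_notMem.1 this i rfl

theorem IsContinuousEnumeration.apply_zero {S : Path (trivialMultiset Φ x₀) (trivialMultiset Φ x₀)}
    {γ : ℕ → C(unitInterval, X)} (hγ : IsContinuousEnumeration S γ) (i : ℕ) : γ i 0 = x₀ := by
  have := hγ 0
  rw [S.source] at this
  exact eq_base_of_isEnumeration_trivialMultiset this i

theorem IsContinuousEnumeration.apply_one {S : Path (trivialMultiset Φ x₀) (trivialMultiset Φ x₀)}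
    {γ : ℕ → C(unitInterval, X)} (hγ : IsContinuousEnumeration S γ) (i : ℕ) : γ i 1 = x₀ := by
  have := hγ 1
  rw [S.target] at this
  exact eq_base_of_isEnumeration_trivialMultiset this i

/-- The pointwise sum of two loops. -/
noncomputable def addLoop (S T : Path (trivialMultiset Φ x₀) (trivialMultiset Φ x₀)) :
    Path (trivialMultiset Φ x₀) (trivialMultiset Φ x₀) where
  toFun t := S t + T t
  source' := by rw [S.source, T.source, add_trivialMultiset]
  target' := by rw [S.target, T.target, add_trivialMultiset]

/-- For `(a, b) ↦ S a + T b` on the contractible square, the diagonal gives the pointwise sum and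
the path along two sides the concatenation. -/
theorem addLoop_homotopic_trans (S T : Path (trivialMultiset Φ x₀) (trivialMultiset Φ x₀)) :
    (addLoop S T).Homotopic (S.trans T) := by
  have : ContractibleSpace unitInterval :=
    (convex_Icc (0 : ℝ) 1).contractibleSpace ⟨0, Set.left_mem_Icc.2 zero_le_one⟩
  let f : C(unitInterval × unitInterval, SummableMultiset Φ x₀) :=
    ⟨fun y => S y.1 + T y.2, by fun_prop⟩
  let a : Path (0 : unitInterval) 1 := ⟨⟨id, continuous_id⟩, rfl, rfl⟩
  refine Path.homotopic_of_simplyConnected f (a.prod a)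
    ((a.prod (Path.refl 0)).trans ((Path.refl 1).prod a)) (fun t => rfl) fun t => ?_
  rw [Path.trans_apply, Path.trans_apply]
  split_ifs
  · change _ = S _ + T 0
    rw [T.source, add_trivialMultiset]
    rfl
  · change _ = S 1 + T _
    rw [S.target, trivialMultiset_add]
    rfl

theorem addLoop_comm (S T : Path (trivialMultiset Φ x₀) (trivialMultiset Φ x₀)) :
    addLoop S T = addLoop T S :=
  Path.ext (funext fun t => add_comm' (S t) (T t))

/-- The Eckmann–Hilton argument: both products are homotopic to the pointwise sum, which is
commutative. -/
theorem fundamentalGroup_mul_comm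
    (g h : FundamentalGroup (SummableMultiset Φ x₀) (trivialMultiset Φ x₀)) : g * h = h * g := by
  obtain ⟨S, rfl⟩ := Path.Homotopic.Quotient.mk_surjective g
  obtain ⟨T, rfl⟩ := Path.Homotopic.Quotient.mk_surjective h
  change Path.Homotopic.Quotient.mk (T.trans S) = Path.Homotopic.Quotient.mk (S.trans T)
  have h := addLoop_homotopic_trans S T
  rw [addLoop_comm] at h
  exact Quotient.sound ((addLoop_homotopic_trans T S).symm.trans h)

variable (Φ x₀) in
/-- The embedding of `X` that sends a point to the multiset with that point only. -/
noncomputable def singletonMap : C(X, SummableMultiset Φ x₀) := (exists_singleton_map Φ x₀).choose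

theorem isEnumeration_singletonMap (x : X) :
    (singletonMap Φ x₀ x).IsEnumeration fun i => if i = 0 then x else x₀ :=
  (exists_singleton_map Φ x₀).choose_spec x

theorem singletonMap_base : singletonMap Φ x₀ x₀ = trivialMultiset Φ x₀ := by
  have h := isEnumeration_singletonMap (Φ := Φ) (x₀ := x₀) x₀
  simp only [ite_self] at h
  exact h.unique CountableMultiset.isEnumeration_trivial

/-- A loop in `X` as a loop of multisets. -/
noncomputable def singletonLoop (Φ : SymmetricNorm) (p : Path x₀ x₀) :
    Path (trivialMultiset Φ x₀) (trivialMultiset Φ x₀) :=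
  (p.map (singletonMap Φ x₀).continuous).cast singletonMap_base.symm singletonMap_base.symm

theorem isContinuousEnumeration_singletonLoop (p : Path x₀ x₀) :
    IsContinuousEnumeration (singletonLoop Φ p) fun i =>
      if i = 0 then p.toContinuousMap else ContinuousMap.const _ x₀ := by
  intro t
  have h := isEnumeration_singletonMap (Φ := Φ) (x₀ := x₀) (p t)
  convert h using 2 with i
  · rfl
  · split_ifs with h0 <;> simp [h0]

variable (Φ x₀) in
/-- The homomorphism of fundamental groups induced by the embedding of `X`. -/
noncomputable def singletonHom :
    FundamentalGroup X x₀ →* FundamentalGroup (SummableMultiset Φ x₀) (trivialMultiset Φ x₀) :=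
  FundamentalGroup.mapOfEq (singletonMap Φ x₀) singletonMap_base

theorem singletonHom_mk (p : Path x₀ x₀) :
    singletonHom Φ x₀ (FundamentalGroup.fromPath (Path.Homotopic.Quotient.mk p)) =
      FundamentalGroup.fromPath (Path.Homotopic.Quotient.mk (singletonLoop Φ p)) :=
  FundamentalGroup.mapOfEq_apply (singletonMap Φ x₀) singletonMap_base _

theorem IsEnumeration.eq_singletonMap_add {S T : SummableMultiset Φ x₀} {s : ℕ → X}
    (hs : S.IsEnumeration s) (ht : T.IsEnumeration fun i => s (i + 1)) :
    S = singletonMap Φ x₀ (s 0) + T := by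
  refine ext_mult fun x hx => ?_
  rw [add_mult, ← hs x hx, ← ht x hx, ← isEnumeration_singletonMap (s 0) x hx]
  have e : {i | s i = x} = {i | (if i = 0 then s 0 else x₀) = x} ∪ Nat.succ '' {i | s (i + 1) = x} := by
    ext i
    cases i <;> simp [hx.symm]
  rw [e, Set.encard_union_eq, Set.InjOn.encard_image (Nat.succ_injective.injOn)]
  rw [Set.disjoint_left]
  rintro _ h ⟨j, -, rfl⟩
  simp [hx.symm] at h

end SummableMultiset

/-! ### Contraction of small loops and surjectivity from `π₁(X)` -/

namespace SummableMultiset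

variable {X : Type u} [MetricSpace X] {Φ : SymmetricNorm} {x₀ : X}

/-- Loops in a simply connected set that shrink to the base point can be contracted by homotopies
that shrink to the base point. -/
theorem exists_shrinking_homotopies (hX : LocallySimplyConnected X) {U : Set X}
    (hU : IsSimplyConnected U) {γ : ℕ → C(unitInterval, X)} (h0 : ∀ i, γ i 0 = x₀)
    (h1 : ∀ i, γ i 1 = x₀) (hγU : ∀ i t, γ i t ∈ U)
    (hγ : ∀ V ∈ 𝓝 x₀, {i | ¬ ∀ t, γ i t ∈ V}.Finite) :
    ∃ H : ℕ → C(unitInterval × unitInterval, X),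
      (∀ i t, H i (0, t) = γ i t) ∧ (∀ i t, H i (1, t) = x₀) ∧ (∀ i s, H i (s, 0) = x₀) ∧
        (∀ i s, H i (s, 1) = x₀) ∧ ∀ ε > 0, ∃ n, ∀ i ≥ n, ∀ y, dist x₀ (H i y) ≤ ε := by
  choose V hVsub hVo hVmem hVsc using fun m : ℕ => hX x₀ (Metric.ball x₀ (1 / (m + 1)))
    (Metric.ball_mem_nhds x₀ Nat.one_div_pos_of_nat)
  -- Stage `0` is `U`, so every loop has a stage available. The homotopy with index `i` will run in
  -- `W (f i)` with `f` tending to infinity, hence shrinks to `x₀`.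
  let W (m : ℕ) : Set X := if m = 0 then U else V m
  have hW (m : ℕ) : IsSimplyConnected (W m) := by
    simp only [W]
    split_ifs
    exacts [hU, hVsc m]
  obtain ⟨f, hf, hfW⟩ := exists_tendsto_atTop_of_eventually (P := fun m i => ∀ t, γ i t ∈ W m)
    hγU fun m => by
      simp only [W]
      split_ifs
      · exact Eventually.of_forall hγU
      · rw [← Nat.cofinite_eq_atTop, Filter.eventually_cofinite]
        exact hγ _ ((hVo m).mem_nhds (hVmem m))
  choose F hF using fun i => (isSimplyConnected_iff_exists_homotopy_refl_forall_mem.1 (hW (f i))).2 x₀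
    ⟨γ i, h0 i, h1 i⟩ (hfW i)
  refine ⟨fun i => (F i).toContinuousMap, fun i t => (F i).apply_zero t, fun i t => (F i).apply_one t,
    fun i s => (F i).source s, fun i s => (F i).target s, fun ε hε => ?_⟩
  obtain ⟨m, hm⟩ := exists_nat_one_div_lt hε
  obtain ⟨n, hn⟩ := eventually_atTop.1 (hf.eventually_ge_atTop (m + 1))
  refine ⟨n, fun i hi y => ?_⟩
  have hfi := hn i hi
  have hy := hF i y
  simp only [W, if_neg (show f i ≠ 0 by omega)] at hy
  have h2 := hVsub _ hy
  rw [Metric.mem_ball, dist_comm] at h2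
  have h3 : (1 : ℝ) / (f i + 1) ≤ 1 / (m + 1) := by
    have : (m : ℝ) ≤ f i := by exact_mod_cast (by omega : m ≤ f i)
    gcongr
  exact (h2.trans_le (h3.trans hm.le)).le

/-- A loop of multisets contained in a simply connected set is null-homotopic: its terms are
contracted one after the other. -/
theorem homotopic_refl_of_forall_mem (hX : LocallySimplyConnected X) (hΦ : Φ.IsRegular) {U : Set X}
    (hU : IsSimplyConnected U) {S : Path (trivialMultiset Φ x₀) (trivialMultiset Φ x₀)}
    {γ : ℕ → C(unitInterval, X)} (hγ : IsContinuousEnumeration S γ) (hγU : ∀ i t, γ i t ∈ U) :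
    S.Homotopic (Path.refl _) := by
  classical
  obtain ⟨H, H0, H1, Hl, Hr, Hε⟩ := exists_shrinking_homotopies hX hU hγ.apply_zero hγ.apply_one hγU
    fun V hV => finite_exists_notMem S.continuous hγ hV
  -- The homotopies become small one by one, but nothing bounds their joint `Φ`-size; so the terms
  -- move on disjoint time intervals.
  let k (i : ℕ) : C(unitInterval × unitInterval, X) :=
    ⟨fun y => H i (ramp i y.1, y.2), by fun_prop⟩
  obtain ⟨F, hF⟩ := exists_continuous_family (Φ := Φ) (x₀ := x₀) k fun ε hε => by
    obtain ⟨n₁, hn₁⟩ := exists_tail_le hΦ S.continuous (fun i => (γ i).continuous) hγ (half_pos hε)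
    obtain ⟨n₂, hn₂⟩ := Hε (ε / 2) (half_pos hε)
    refine ⟨max n₁ n₂, fun y => ?_⟩
    -- `β` pays for the at most one term in motion. Terms at rest are in their original position or
    -- at `x₀`, and the tail of `γ` bounds them.
    let β (i : ℕ) : ℝ :=
      if ramp (max n₁ n₂ + i) y.1 ≠ 0 ∧ ramp (max n₁ n₂ + i) y.1 ≠ 1 then ε / 2 else 0
    have hβ (i : ℕ) : 0 ≤ β i := by
      simp only [β]
      split_ifs
      exacts [(half_pos hε).le, le_rfl]
    have hβ' (i : ℕ) (hi : β i ≠ 0) :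
        ramp (max n₁ n₂ + i) y.1 ≠ 0 ∧ ramp (max n₁ n₂ + i) y.1 ≠ 1 := by
      by_contra h
      exact hi (if_neg h)
    calc (Φ.ext fun i => dist x₀ (k (max n₁ n₂ + i) y))
        ≤ Φ.ext fun i => dist x₀ (γ (max n₁ n₂ + i) y.2) + β i := by
          refine Φ.ext_mono fun i => ?_
          rw [abs_of_nonneg dist_nonneg, abs_of_nonneg (add_nonneg dist_nonneg (hβ i))]
          change dist x₀ (H _ (ramp _ y.1, y.2)) ≤ _
          by_cases h0 : ramp (max n₁ n₂ + i) y.1 = 0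
          · rw [h0, H0]
            exact le_add_of_nonneg_right (hβ i)
          by_cases h1 : ramp (max n₁ n₂ + i) y.1 = 1
          · rw [h1, H1, dist_self]
            exact add_nonneg dist_nonneg (hβ i)
          · simp only [β, if_pos (And.intro h0 h1)]
            exact (hn₂ _ (by omega) _).trans (le_add_of_nonneg_left dist_nonneg)
      _ ≤ ENNReal.ofReal (ε / 2) + ENNReal.ofReal (ε / 2) := by
          refine (Φ.ext_add_le _ _).trans (add_le_add ?_ ?_)
          · exact (Φ.ext_tail_antitone (fun i => dist x₀ (γ i y.2)) (le_max_left _ _)).trans (hn₁ _)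
          · refine Φ.ext_le_of_subsingleton (fun i j hi hj => ?_) fun i => ?_
            · have := eq_of_ramp (hβ' i hi).1 (hβ' i hi).2 (hβ' j hj).1 (hβ' j hj).2
              omega
            · rw [abs_of_nonneg (hβ i)]
              simp only [β]
              split_ifs
              exacts [le_rfl, (half_pos hε).le]
      _ = ENNReal.ofReal ε := by
          rw [← ENNReal.ofReal_add (half_pos hε).le (half_pos hε).le, add_halves]
  have htriv {y : unitInterval × unitInterval} (h : ∀ i, k i y = x₀) : F y = trivialMultiset Φ x₀ := by
    have hy := hF y
    simp only [h] at hy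
    exact hy.unique CountableMultiset.isEnumeration_trivial
  exact ⟨{ toContinuousMap := F
           map_zero_left := fun t => by
             have hy := hF (0, t)
             simp only [k, ContinuousMap.coe_mk, ramp_zero, H0] at hy
             exact hy.unique (hγ t)
           map_one_left := fun t => htriv fun i => by
             simp only [k, ContinuousMap.coe_mk, ramp_one, H1]
           prop' := by
             rintro s t (rfl | rfl)
             · exact (htriv fun i => Hl i _).trans S.source.symm
             · exact (htriv fun i => Hr i _).trans S.target.symm }⟩

/-- Every loop of multisets is homotopic to a loop in `X`. -/
theorem singletonHom_surjective (hX : LocallySimplyConnected X) (hΦ : Φ.IsRegular) :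
    Function.Surjective (singletonHom Φ x₀) := by
  obtain ⟨U, -, hUo, hUmem, hU⟩ := hX x₀ Set.univ univ_mem
  -- Induction on the number of initial terms that may leave `U`: the first term splits off as a
  -- loop in `X`, and the rest is again a loop of multisets.
  have key : ∀ N : ℕ, ∀ (S : Path (trivialMultiset Φ x₀) (trivialMultiset Φ x₀))
      (γ : ℕ → C(unitInterval, X)), IsContinuousEnumeration S γ → (∀ i ≥ N, ∀ t, γ i t ∈ U) →
        FundamentalGroup.fromPath (Path.Homotopic.Quotient.mk S) ∈ (singletonHom Φ x₀).range := by
    intro N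
    induction N with
    | zero =>
      intro S γ hγ hγU
      have h := homotopic_refl_of_forall_mem hX hΦ hU hγ fun i => hγU i (Nat.zero_le i)
      rw [show Path.Homotopic.Quotient.mk S = Path.Homotopic.Quotient.mk (Path.refl _) from
        Quotient.sound h]
      exact one_mem _
    | succ N ih =>
      intro S γ hγ hγU
      obtain ⟨R, hR⟩ := exists_continuous_family (Φ := Φ) (x₀ := x₀) (fun i => γ (i + 1))
        fun ε hε => by
          obtain ⟨n, hn⟩ := exists_tail_le hΦ S.continuous (fun i => (γ i).continuous) hγ hε
          refine ⟨n, fun t => ?_⟩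
          have := (Φ.ext_tail_antitone (fun i => dist x₀ (γ i t)) (Nat.le_succ n)).trans (hn t)
          simpa only [Nat.succ_eq_add_one, add_right_comm] using this
      have hend {t : unitInterval} (h : ∀ i, γ i t = x₀) : R t = trivialMultiset Φ x₀ := by
        have hy := hR t
        simp only [h] at hy
        exact hy.unique CountableMultiset.isEnumeration_trivial
      let R' : Path (trivialMultiset Φ x₀) (trivialMultiset Φ x₀) :=
        ⟨R, hend hγ.apply_zero, hend hγ.apply_one⟩
      have hR' := ih R' (fun i => γ (i + 1)) hR fun i hi => hγU (i + 1) (by omega)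
      let p : Path x₀ x₀ := ⟨γ 0, hγ.apply_zero 0, hγ.apply_one 0⟩
      have hS : S = addLoop (singletonLoop Φ p) R' :=
        Path.ext (funext fun t => (hγ t).eq_singletonMap_add (hR t))
      rw [hS, show Path.Homotopic.Quotient.mk (addLoop (singletonLoop Φ p) R') =
        Path.Homotopic.Quotient.mk ((singletonLoop Φ p).trans R') from
        Quotient.sound (addLoop_homotopic_trans _ _)]
      exact mul_mem hR' ⟨FundamentalGroup.fromPath (Path.Homotopic.Quotient.mk p), singletonHom_mk p⟩
  intro g
  obtain ⟨S, rfl⟩ := Path.Homotopic.Quotient.mk_surjective g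
  obtain ⟨γ, hγ⟩ := exists_continuous_enumeration S.continuous
  have hfin := finite_exists_notMem S.continuous hγ (hUo.mem_nhds hUmem)
  obtain ⟨N, hN⟩ := hfin.bddAbove
  refine key (N + 1) S γ hγ fun i hi => ?_
  by_contra h
  have := hN (show i ∈ {i | ¬ ∀ t, γ i t ∈ U} from h)
  omega

end SummableMultiset

/-! ### The isomorphism with the first homology group -/

namespace SummableMultiset

variable {X : Type u} [MetricSpace X] {Φ : SymmetricNorm} {x₀ : X}

theorem finite_not_isNullHomotopicLoop (hX : LocallySimplyConnected X)
    {S : Path (trivialMultiset Φ x₀) (trivialMultiset Φ x₀)} {γ : ℕ → C(unitInterval, X)}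
    (hγ : IsContinuousEnumeration S γ) : {i | ¬ IsNullHomotopicLoop x₀ (γ i)}.Finite := by
  obtain ⟨U, -, hUo, hUmem, hU⟩ := hX x₀ Set.univ univ_mem
  exact (finite_exists_notMem S.continuous hγ (hUo.mem_nhds hUmem)).subset fun i hi hm =>
    hi (hU.isNullHomotopicLoop hm (hγ.apply_zero i) (hγ.apply_one i))

/-- On loops the corrections cancel, so any simply connected neighbourhood of `x₀` gives access to
the normalized invariance. -/
theorem finsum_pathClass_eq_of_homotopic (hX : LocallySimplyConnected X)
    {S T : Path (trivialMultiset Φ x₀) (trivialMultiset Φ x₀)} (hST : S.Homotopic T)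
    {γ δ : ℕ → C(unitInterval, X)} (hγ : IsContinuousEnumeration S γ)
    (hδ : IsContinuousEnumeration T δ) : ∑ᶠ i, pathClass (γ i) = ∑ᶠ i, pathClass (δ i) := by
  obtain ⟨U, -, hUo, hUmem, hU⟩ := hX x₀ Set.univ univ_mem
  obtain ⟨Θ, -, -, hΘ⟩ := hU.exists_normalization hUmem
  have h := finsum_normalizedClass_eq_of_homotopic hX (hUo.mem_nhds hUmem) hΘ hST hγ hδ
  simpa only [normalizedClass_of_loop ((hγ.apply_zero _).trans (hγ.apply_one _).symm),
    normalizedClass_of_loop ((hδ.apply_zero _).trans (hδ.apply_one _).symm)] using h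

/-- The sum of the classes of the terms of a continuous enumeration of a loop. -/
noncomputable def sumClass
    (g : FundamentalGroup (SummableMultiset Φ x₀) (trivialMultiset Φ x₀)) : chainClasses X :=
  ∑ᶠ i, pathClass ((exists_continuous_enumeration
    (Path.Homotopic.Quotient.mk_surjective g).choose.continuous).choose i)

theorem sumClass_mk (hX : LocallySimplyConnected X)
    {S : Path (trivialMultiset Φ x₀) (trivialMultiset Φ x₀)} {γ : ℕ → C(unitInterval, X)}
    (hγ : IsContinuousEnumeration S γ) :
    sumClass (FundamentalGroup.fromPath (Path.Homotopic.Quotient.mk S)) = ∑ᶠ i, pathClass (γ i) :=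
  finsum_pathClass_eq_of_homotopic hX (Quotient.exact
    (Path.Homotopic.Quotient.mk_surjective (Path.Homotopic.Quotient.mk S)).choose_spec)
    (exists_continuous_enumeration (Path.Homotopic.Quotient.mk_surjective
      (Path.Homotopic.Quotient.mk S)).choose.continuous).choose_spec hγ

/-- All terms are at `x₀` at the junction, so arbitrary enumerations of the two loops concatenate
term by term. -/
theorem sumClass_mul (hX : LocallySimplyConnected X)
    (g h : FundamentalGroup (SummableMultiset Φ x₀) (trivialMultiset Φ x₀)) :
    sumClass (g * h) = sumClass g + sumClass h := by
  obtain ⟨S, rfl⟩ := Path.Homotopic.Quotient.mk_surjective g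
  obtain ⟨T, rfl⟩ := Path.Homotopic.Quotient.mk_surjective h
  obtain ⟨γ, hγ⟩ := exists_continuous_enumeration S.continuous
  obtain ⟨δ, hδ⟩ := exists_continuous_enumeration T.continuous
  have hγ' : IsContinuousEnumeration S γ := hγ
  have hδ' : IsContinuousEnumeration T δ := hδ
  let p (i : ℕ) : Path x₀ x₀ := ⟨γ i, hγ'.apply_zero i, hγ'.apply_one i⟩
  let q (i : ℕ) : Path x₀ x₀ := ⟨δ i, hδ'.apply_zero i, hδ'.apply_one i⟩
  have hpq : IsContinuousEnumeration (T.trans S) fun i => ((q i).trans (p i)).toContinuousMap := by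
    intro t
    simp only [Path.coe_toContinuousMap, Path.trans_apply]
    split_ifs
    exacts [hδ _, hγ _]
  have hsupp {S : Path (trivialMultiset Φ x₀) (trivialMultiset Φ x₀)} {γ : ℕ → C(unitInterval, X)}
      (hγ : IsContinuousEnumeration S γ) : (Function.support fun i => pathClass (γ i)).Finite :=
    (finite_not_isNullHomotopicLoop hX hγ).subset fun i hi hn => hi hn.pathClass_eq_zero
  refine (sumClass_mk hX hpq).trans ?_
  rw [sumClass_mk hX hγ', sumClass_mk hX hδ', add_comm,
    ← finsum_add_distrib (hsupp hδ') (hsupp hγ')]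
  exact finsum_congr fun i => pathClass_trans (q i) (p i)

theorem sumClass_singletonHom (hX : LocallySimplyConnected X) (g : FundamentalGroup X x₀) :
    sumClass (singletonHom Φ x₀ g) = Multiplicative.toAdd (loopClass x₀ g) := by
  obtain ⟨p, rfl⟩ := Path.Homotopic.Quotient.mk_surjective g
  refine (congrArg sumClass (singletonHom_mk p)).trans
    ((sumClass_mk hX (isContinuousEnumeration_singletonLoop p)).trans ?_)
  rw [finsum_eq_single _ 0 fun i hi => by rw [if_neg hi, pathClass_const]]
  rfl

theorem exists_homologyInclusion_eq_sumClass (hX : LocallySimplyConnected X)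
    (g : FundamentalGroup (SummableMultiset Φ x₀) (trivialMultiset Φ x₀)) :
    ∃ h : singularH1 X, homologyInclusion h = sumClass g := by
  obtain ⟨S, rfl⟩ := Path.Homotopic.Quotient.mk_surjective g
  obtain ⟨γ, hγ⟩ := exists_continuous_enumeration S.continuous
  have hγ' : IsContinuousEnumeration S γ := hγ
  obtain ⟨h, hh⟩ := exists_homologyInclusion_eq (finite_not_isNullHomotopicLoop hX hγ')
    (by simp [hγ'.apply_zero, hγ'.apply_one])
  exact ⟨h, hh.trans (sumClass_mk hX hγ').symm⟩

/-- A preimage in `π₁(X)` is null-homologous, hence lies in the commutator subgroup, which dies in a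
commutative group. -/
theorem eq_one_of_sumClass_eq_zero [PathConnectedSpace X] (hX : LocallySimplyConnected X)
    (hΦ : Φ.IsRegular) {g : FundamentalGroup (SummableMultiset Φ x₀) (trivialMultiset Φ x₀)}
    (hg : sumClass g = 0) : g = 1 := by
  obtain ⟨a, rfl⟩ := singletonHom_surjective hX hΦ g
  rw [sumClass_singletonHom hX] at hg
  have ha := mem_commutator_of_loopClass_eq_one a hg
  have hle : commutator (FundamentalGroup X x₀) ≤ (singletonHom Φ x₀).ker := by
    rw [commutator_def, Subgroup.commutator_le]
    intro b _ c _
    rw [MonoidHom.mem_ker, map_commutatorElement, commutatorElement_eq_one_iff_mul_comm]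
    exact fundamentalGroup_mul_comm _ _
  exact hle ha

/-- The isomorphism between the fundamental group of the space of multisets and the first
homology group. -/
theorem exists_mulEquiv_singularH1 [PathConnectedSpace X] (hX : LocallySimplyConnected X)
    (hΦ : Φ.IsRegular) :
    ∃ Ψ : FundamentalGroup (SummableMultiset Φ x₀) (trivialMultiset Φ x₀) ≃*
      Multiplicative (singularH1 X),
      ∀ g, homologyInclusion (Multiplicative.toAdd (Ψ g)) = sumClass g := by
  choose ψ hψ using exists_homologyInclusion_eq_sumClass (Φ := Φ) (x₀ := x₀) hX
  let Ψ : FundamentalGroup (SummableMultiset Φ x₀) (trivialMultiset Φ x₀) →*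
      Multiplicative (singularH1 X) :=
    MonoidHom.mk' (fun g => Multiplicative.ofAdd (ψ g)) fun g h => by
      refine congrArg Multiplicative.ofAdd (homologyInclusion_injective ?_ : ψ (g * h) = ψ g + ψ h)
      rw [map_add, hψ, hψ, hψ, sumClass_mul hX]
  refine ⟨MulEquiv.ofBijective Ψ ⟨?_, ?_⟩, hψ⟩
  · rw [injective_iff_map_eq_one]
    intro g hg
    refine eq_one_of_sumClass_eq_zero hX hΦ ?_
    rw [← hψ, show ψ g = 0 from hg, map_zero]
  -- Every homology class is the class of a single loop in `X`.
  · intro h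
    obtain ⟨p, hp⟩ := exists_pathClass_eq x₀ (Multiplicative.toAdd h)
    refine ⟨singletonHom Φ x₀ (FundamentalGroup.fromPath (Path.Homotopic.Quotient.mk p)), ?_⟩
    refine congrArg Multiplicative.ofAdd (homologyInclusion_injective ?_ : ψ _ = Multiplicative.toAdd h)
    rw [hψ, sumClass_singletonHom hX, ← hp]
    rfl

end SummableMultiset

/-! ### The theorem -/

theorem mainTheorem2 {X : Type u} [MetricSpace X] [PathConnectedSpace X]
    (hX : LocallySimplyConnected X) (x₀ : X) (Φ : SymmetricNorm) (hΦ : Φ.IsRegular) :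
    -- every loop at the trivial multiset has a continuous enumeration
    (∀ S : Path (SummableMultiset.trivialMultiset Φ x₀) (SummableMultiset.trivialMultiset Φ x₀),
      ∃ γ : ℕ → C(unitInterval, X), SummableMultiset.IsContinuousEnumeration S γ) ∧
    -- the isomorphism, and its value on the class of a loop
    (∃ Ψ : FundamentalGroup (SummableMultiset Φ x₀) (SummableMultiset.trivialMultiset Φ x₀) ≃*
        Multiplicative (singularH1 X),
      ∀ (S : Path (SummableMultiset.trivialMultiset Φ x₀) (SummableMultiset.trivialMultiset Φ x₀))
        (γ : ℕ → C(unitInterval, X)), SummableMultiset.IsContinuousEnumeration S γ →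
        (∀ i, γ i 0 = x₀ ∧ γ i 1 = x₀) ∧
        IsFormalSumClass x₀ γ
          (Multiplicative.toAdd (Ψ (FundamentalGroup.fromPath (Path.Homotopic.Quotient.mk S))))) ∧
    -- for loops at an arbitrary basepoint, the class of the formal sum of `U`-extensions depends
    -- only on the homotopy class of the loop
    (∀ U ∈ 𝓝 x₀, IsSimplyConnected U → ∀ (S₀ : SummableMultiset Φ x₀) (S T : Path S₀ S₀),
      S.Homotopic T → ∀ γ δ : ℕ → C(unitInterval, X), SummableMultiset.IsContinuousEnumeration S γ →
        SummableMultiset.IsContinuousEnumeration T δ →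
        ∀ γ' δ' : ℕ → C(unitInterval, X), (∀ i, IsUExtension x₀ U (γ i) (γ' i)) →
          (∀ i, IsUExtension x₀ U (δ i) (δ' i)) →
          ∃ h : singularH1 X, IsFormalSumClass x₀ γ' h ∧ IsFormalSumClass x₀ δ' h) := by
  obtain ⟨Ψ, hΨ⟩ := SummableMultiset.exists_mulEquiv_singularH1 (x₀ := x₀) hX hΦ
  refine ⟨fun S => SummableMultiset.exists_continuous_enumeration S.continuous,
    ⟨Ψ, fun S γ hγ => ⟨fun i => ⟨hγ.apply_zero i, hγ.apply_one i⟩, ?_⟩⟩, ?_⟩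
  · refine isFormalSumClass_of_finite (SummableMultiset.finite_not_isNullHomotopicLoop hX hγ)
      (by simp [hγ.apply_zero, hγ.apply_one]) ?_
    rw [hΨ, SummableMultiset.sumClass_mk hX hγ]
  · intro U hU hUsc S₀ S T hST γ δ hγ hδ γ' δ' hγ' hδ'
    exact SummableMultiset.exists_isFormalSumClass_of_homotopic hX hU hUsc hST hγ hδ hγ' hδ'
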